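/- Let $V$ be an arbitrary symmetric monoidal category with unit object $I$. Then the category of quasisymmetric $2$-operads in $V$ is equivalent to the category of (right) braided operads in $V$. The two categories are as follows. A $2$-ordinal is a finite set $T$ with two irreflexive relations $<_0,<_1$ such that for $a\neq b$ there is exactly one $p$ with $a<_pb$ or $b<_pa$, and such that $a<_pb$, $b<_qc$ imply $a<_{\min(p,q)}c$. The total order of $T$ is: $a<b$ iff $a<_0b$ or $a<_1b$. A map of $2$-ordinals is a map $\sigma:T\to S$ of sets such that $i<_pj$ implies $\sigma(i)<_r\sigma(j)$ for some $r\ge p$, or $\sigma(i)=\sigma(j)$, or $\sigma(j)<_r\sigma(i)$ for some $r>p$. It is a quasibijection if it is bijective. $Ord(2)$ is the skeletal category of $2$-ordinals (the empty one included); $U_2$ is the one-point $2$-ordinal; the fibres $T_i=\sigma^{-1}(i)$ are $2$-ordinals, taken in the total order of $S$. A $2$-operad (pruned, $1$-terminal) in $V$ is a family of objects $A_T$, $T\in Ord(2)$, with a unit $e:I\to A_{U_2}$ and a multiplication $m_\sigma:A_S\otimes A_{T_0}\otimes\cdots\otimes A_{T_k}\to A_T$ for every map $\sigma:T\to S$ of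 $2$-ordinals, which is associative for all composites $T\to S\to R$ (up to the symmetries of $V$) and unital for the identities $T\to T$ and the maps $T\to U_2$. Every quasibijection $\sigma:T\to S$ induces $A(\sigma):A_S\cong A_S\otimes I\otimes\cdots\otimes I\to A_S\otimes A_{U_2}\otimes\cdots\otimes A_{U_2}\xrightarrow{m_\sigma}A_T$, and $A$ is quasisymmetric if all these $A(\sigma)$ are isomorphisms. Morphisms are the families $A_T\to B_T$ that preserve units and multiplications. A braided operad (in the sense of Fiedorowicz) is a family of objects $A_n$, $n\ge 0$ (the operations with $n$ inputs), with a right action $A(\rho)$, $\rho\in Br_n$, of the braid group $Br_n$ on each $A_n$, a unit $e:I\to A_1$ and, for every order preserving map $\sigma:\{0,\dots,n-1\}\to\{0,\dots,k-1\}$ with fibres of sizes $n_0,\dots,n_{k-1}$, a multiplication $\mu_\sigma:A_k\otimes A_{n_0}\otimes\cdots\otimes A_{n_{k-1}}\to A_n$. It is associative for composites of order preserving maps and unital for the identities and the maps to the one-point ordinal, and it satisfies two equivariance conditions. (1) For $\rho\in Br_k$ with underlying permutation $p(\rho)$, one has $A(\pi)\circ\mu_\sigma=\mu_{\sigma'}\circ(A(\rho)\otimes\tau(\rho))$,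 where $\sigma'$ is the order preserving map whose fibre over $i$ has $n_{p(\rho)(i)}$ elements, $\tau(\rho):A_{n_0}\otimes\cdots\otimes A_{n_{k-1}}\to A_{n_{p(\rho)(0)}}\otimes\cdots\otimes A_{n_{p(\rho)(k-1)}}$ is the symmetry of $V$, and $\pi\in Br_n$ is $\rho$ with the strand that ends at the place $i$ replaced by $n_i$ parallel strands, for all $i$. (2) For $\rho_i\in Br_{n_i}$, one has $A(\rho_0\oplus\cdots\oplus\rho_{k-1})\circ\mu_\sigma=\mu_\sigma\circ(\mathrm{id}\otimes A(\rho_0)\otimes\cdots\otimes A(\rho_{k-1}))$. Morphisms are the families $A_n\to B_n$ that commute with the braid actions and preserve units and multiplications. -/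

import Mathlib

open CategoryTheory MonoidalCategory

universe v u

namespace TwoOperads

/-! ## Braid groups, direct sums of braids and cabling -/

/-- Artin's relations between the generators `σ_0, …, σ_{n-2}` of the braid group on `n` strands. -/
inductive ArtinRel (n : ℕ) : FreeGroup (Fin (n - 1)) → Prop
  | braid (i j : Fin (n - 1)) (h : i.val + 1 = j.val) :
      ArtinRel n ((FreeGroup.of i * FreeGroup.of j * FreeGroup.of i) *
        (FreeGroup.of j * FreeGroup.of i * FreeGroup.of j)⁻¹)
  | comm (i j : Fin (n - 1)) (h : i.val + 1 < j.val) :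
      ArtinRel n ((FreeGroup.of i * FreeGroup.of j) * (FreeGroup.of j * FreeGroup.of i)⁻¹)

/-- The braid group on `n` strands, in Artin's presentation. The product `a * b` is read as the
composite "first `b`, then `a`", as for permutations. The groups on `0` and `1` strands are
trivial. -/
abbrev BraidGroup (n : ℕ) : Type := PresentedGroup {r | ArtinRel n r}

/-- The homomorphism out of a braid group given by elements that satisfy Artin's relations. -/
def BraidGroup.lift {n : ℕ} {G : Type*} [Group G] (f : Fin (n - 1) → G)
    (hb : ∀ i j : Fin (n - 1), i.val + 1 = j.val → f i * f j * f i = f j * f i * f j)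
    (hc : ∀ i j : Fin (n - 1), i.val + 1 < j.val → f i * f j = f j * f i) :
    BraidGroup n →* G :=
  PresentedGroup.toGroup (f := f) (by
    rintro r (⟨i, j, h⟩ | ⟨i, j, h⟩)
    · rw [map_mul, map_inv, mul_inv_eq_one]
      simpa using hb i j h
    · rw [map_mul, map_inv, mul_inv_eq_one]
      simpa using hc i j h)

theorem BraidGroup.lift_of {n : ℕ} {G : Type*} [Group G] (f : Fin (n - 1) → G)
    (hb : ∀ i j : Fin (n - 1), i.val + 1 = j.val → f i * f j * f i = f j * f i * f j)
    (hc : ∀ i j : Fin (n - 1), i.val + 1 < j.val → f i * f j = f j * f i) (i : Fin (n - 1)) :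
    BraidGroup.lift f hb hc (PresentedGroup.of i) = f i :=
  PresentedGroup.toGroup.of (f := f) _

/-- The elementary braid which crosses the strands at the positions `i` and `i + 1`
(and, by convention, `1` if there are no such positions). -/
def crossing (n i : ℕ) : BraidGroup n :=
  if h : i < n - 1 then PresentedGroup.of ⟨i, h⟩ else 1

theorem crossing_braid {n i : ℕ} (h : i + 2 < n) :
    crossing n i * crossing n (i + 1) * crossing n i =
      crossing n (i + 1) * crossing n i * crossing n (i + 1) := by
  have h1 : i < n - 1 := by omega
  have h2 : i + 1 < n - 1 := by omega
  have := (PresentedGroup.one_of_mem (rels := {r | ArtinRel n r})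
    (ArtinRel.braid ⟨i, h1⟩ ⟨i + 1, h2⟩ rfl))
  rw [map_mul, map_inv, mul_inv_eq_one, map_mul, map_mul, map_mul, map_mul] at this
  simp only [crossing, h1, h2, dif_pos]
  exact this

theorem crossing_comm (n : ℕ) {i j : ℕ} (h : i + 1 < j) :
    crossing n i * crossing n j = crossing n j * crossing n i := by
  by_cases h2 : j < n - 1
  · have h1 : i < n - 1 := by omega
    have := (PresentedGroup.one_of_mem (rels := {r | ArtinRel n r})
      (ArtinRel.comm ⟨i, h1⟩ ⟨j, h2⟩ h))
    rw [map_mul, map_inv, mul_inv_eq_one, map_mul, map_mul] at this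
    simp only [crossing, h1, h2, dif_pos]
    exact this
  · simp [crossing, h2]

/-- The transposition of the places `i` and `i + 1`. -/
def adjSwap {k : ℕ} (i : Fin (k - 1)) : Equiv.Perm (Fin k) :=
  Equiv.swap ⟨i.val, by omega⟩ ⟨i.val + 1, by omega⟩

theorem adjSwap_braid {k : ℕ} (i j : Fin (k - 1)) (h : i.val + 1 = j.val) :
    adjSwap i * adjSwap j * adjSwap i = adjSwap j * adjSwap i * adjSwap j := by
  obtain ⟨i, hi⟩ := i
  obtain ⟨j, hj⟩ := j
  simp only at h
  subst h
  have h1 := Equiv.swap_mul_swap_mul_swap (x := (⟨i, by omega⟩ : Fin k))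
    (y := ⟨i + 1, by omega⟩) (z := ⟨i + 1 + 1, by omega⟩) (by simp) (by simp; omega)
  have h2 := Equiv.swap_mul_swap_mul_swap (x := (⟨i + 1 + 1, by omega⟩ : Fin k))
    (y := ⟨i + 1, by omega⟩) (z := ⟨i, by omega⟩) (by simp) (by simp; omega)
  rw [Equiv.swap_comm (⟨i + 1, _⟩ : Fin k) ⟨i, _⟩,
    Equiv.swap_comm (⟨i + 1 + 1, _⟩ : Fin k) ⟨i + 1, _⟩] at h2
  unfold adjSwap
  rw [h2, h1, Equiv.swap_comm]

theorem adjSwap_comm {k : ℕ} (i j : Fin (k - 1)) (h : i.val + 1 < j.val) :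
    adjSwap i * adjSwap j = adjSwap j * adjSwap i := by
  refine Equiv.Perm.Disjoint.commute (Equiv.Perm.disjoint_iff_disjoint_support.2 ?_)
  unfold adjSwap
  rw [Equiv.Perm.support_swap (by simp), Equiv.Perm.support_swap (by simp)]
  simp
  omega

/-- The permutation underlying a braid. -/
def BraidGroup.perm {n : ℕ} : BraidGroup n →* Equiv.Perm (Fin n) :=
  BraidGroup.lift adjSwap adjSwap_braid adjSwap_comm

/-- Decompositions of `n` strands into `k` consecutive blocks, by the sizes of the blocks. -/
abbrev Blocks (k n : ℕ) : Type := {m : Fin k → ℕ // ∑ i, m i = n}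

/-- The number of strands in the first `t` blocks. -/
def Blocks.offset {k n : ℕ} (m : Blocks k n) (t : ℕ) : ℕ :=
  ∑ j : Fin k, if j.val < t then m.1 j else 0

theorem Blocks.offset_succ {k n : ℕ} (m : Blocks k n) (i : Fin k) :
    m.offset (i.val + 1) = m.offset i.val + m.1 i := by
  have : m.1 i = ∑ j : Fin k, if j = i then m.1 j else 0 := by simp
  rw [Blocks.offset, Blocks.offset, this, ← Finset.sum_add_distrib]
  refine Finset.sum_congr rfl fun j _ => ?_
  rcases lt_trichotomy j i with h | h | h
  · have h' := Fin.lt_def.1 h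
    simp [h', h.ne, Nat.lt_succ_of_lt h']
  · simp [h]
  · have h' := Fin.lt_def.1 h
    have h1 : ¬ j.val < i.val + 1 := by omega
    have h2 : ¬ j.val < i.val := by omega
    simp [h1, h2, h.ne']

theorem Blocks.offset_le {k n : ℕ} (m : Blocks k n) (t : ℕ) : m.offset t ≤ n := by
  refine le_of_le_of_eq ?_ m.2
  exact Finset.sum_le_sum fun j _ => by split <;> simp

theorem Blocks.offset_mono {k n : ℕ} (m : Blocks k n) {t t' : ℕ} (h : t ≤ t') :
    m.offset t ≤ m.offset t' := by
  refine Finset.sum_le_sum fun j _ => ?_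
  by_cases h1 : j.val < t
  · simp [h1, lt_of_lt_of_le h1 h]
  · simp [h1]

/-- The sizes of the source blocks when blocks are permuted: the block at place `i` goes to the
place `π i`, where the target has `m (π i)` strands. -/
def Blocks.permute {k n : ℕ} (m : Blocks k n) (π : Equiv.Perm (Fin k)) : Blocks k n :=
  ⟨fun i => m.1 (π i), by rw [Equiv.sum_comp π m.1]; exact m.2⟩

/-- A braid on `m` strands put on the strands `off, …, off + m - 1` of `n` strands. -/
def shift (off m n : ℕ) (h : off + m ≤ n) : BraidGroup m →* BraidGroup n :=
  BraidGroup.lift (fun i => crossing n (off + i.val))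
    (by
      intro i j hij
      rw [← hij, ← add_assoc]
      exact crossing_braid (by omega))
    (by
      intro i j hij
      exact crossing_comm n (by omega))

/-- The concatenation `ρ_0 ⊕ ⋯ ⊕ ρ_{k-1}` of braids, side by side. -/
def directSum {k n : ℕ} (m : Blocks k n) (ρ : ∀ i : Fin k, BraidGroup (m.1 i)) : BraidGroup n :=
  (List.ofFn fun i : Fin k => shift (m.offset i.val) (m.1 i) n
    (by rw [← m.offset_succ]; exact m.offset_le _) (ρ i)).prod

/-- The strand at position `p` crosses the next `b` strands. -/
def strandCross (n p : ℕ) : ℕ → BraidGroup n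
  | 0 => 1
  | b + 1 => crossing n (p + b) * strandCross n p b

/-- The `a` parallel strands from position `p` on cross the next `b` parallel strands:
an elementary braid with its two strands replaced by `a` and `b` parallel strands. -/
def blockCross (n p : ℕ) : ℕ → ℕ → BraidGroup n
  | 0, _ => 1
  | a + 1, b => blockCross n p a b * strandCross n (p + a) b

theorem crossing_strandCross_comm (n : ℕ) {p b i : ℕ} (h : i + 1 < p ∨ p + b < i) :
    crossing n i * strandCross n p b = strandCross n p b * crossing n i := by
  induction b with
  | zero => simp [strandCross]
  | succ b ih =>
    have hc : crossing n i * crossing n (p + b) = crossing n (p + b) * crossing n i := by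
      rcases h with h | h
      · exact crossing_comm n (by omega)
      · exact (crossing_comm n (by omega)).symm
    rw [strandCross, ← mul_assoc, hc, mul_assoc, ih (by omega), mul_assoc]

theorem crossing_blockCross_comm (n : ℕ) {p a b i : ℕ} (h : i + 1 < p ∨ p + a + b ≤ i) :
    crossing n i * blockCross n p a b = blockCross n p a b * crossing n i := by
  induction a with
  | zero => simp [blockCross]
  | succ a ih =>
    rw [blockCross, ← mul_assoc, ih (by omega), mul_assoc,
      crossing_strandCross_comm n (by omega), mul_assoc]

theorem strandCross_blockCross_comm (n : ℕ) {p a b q c : ℕ} (h : p + a + b ≤ q) :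
    strandCross n q c * blockCross n p a b = blockCross n p a b * strandCross n q c := by
  induction c with
  | zero => simp [strandCross]
  | succ c ih =>
    rw [strandCross, mul_assoc, ih, ← mul_assoc, crossing_blockCross_comm n (by omega), mul_assoc]

theorem blockCross_comm (n : ℕ) {p a b q c d : ℕ} (h : p + a + b ≤ q) :
    blockCross n p a b * blockCross n q c d = blockCross n q c d * blockCross n p a b := by
  induction c with
  | zero => simp [blockCross]
  | succ c ih =>
    rw [blockCross, ← mul_assoc, ih, mul_assoc,
      ← strandCross_blockCross_comm n (by omega), mul_assoc]

theorem strandCross_strandCross_crossing {n q b : ℕ} (h : q + b + 2 ≤ n) :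
    strandCross n q b * strandCross n (q + 1) b * crossing n q =
      crossing n (q + b) * (strandCross n q b * strandCross n (q + 1) b) := by
  induction b with
  | zero => simp [strandCross]
  | succ b ih =>
    have e1 : strandCross n q b * crossing n (q + 1 + b) =
        crossing n (q + 1 + b) * strandCross n q b :=
      (crossing_strandCross_comm n (by omega)).symm
    have e2 := crossing_braid (n := n) (i := q + b) (by omega)
    have e3 : q + 1 + b = q + b + 1 := by omega
    have ih' := ih (by omega)
    rw [e3] at e1
    simp only [strandCross, e3, ← add_assoc]
    calc crossing n (q + b) * strandCross n q b *
            (crossing n (q + b + 1) * strandCross n (q + 1) b) * crossing n q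
        = crossing n (q + b) * (strandCross n q b * crossing n (q + b + 1)) *
            strandCross n (q + 1) b * crossing n q := by simp only [mul_assoc]
      _ = crossing n (q + b) * crossing n (q + b + 1) *
            (strandCross n q b * strandCross n (q + 1) b * crossing n q) := by
          rw [e1]; simp only [mul_assoc]
      _ = (crossing n (q + b) * crossing n (q + b + 1) * crossing n (q + b)) *
            (strandCross n q b * strandCross n (q + 1) b) := by
          rw [ih']; simp only [mul_assoc]
      _ = crossing n (q + b + 1) * crossing n (q + b) *
            (crossing n (q + b + 1) * strandCross n q b) * strandCross n (q + 1) b := by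
          rw [e2]; simp only [mul_assoc]
      _ = _ := by rw [← e1]; simp only [mul_assoc]

theorem blockCross_crossing {n p a b i : ℕ} (hi : i + 1 < a) (h : p + a + b ≤ n) :
    blockCross n p a b * crossing n (p + i) = crossing n (p + b + i) * blockCross n p a b := by
  induction a with
  | zero => omega
  | succ a ih =>
    by_cases h1 : i + 1 < a
    · rw [blockCross, mul_assoc, ← crossing_strandCross_comm n (by omega), ← mul_assoc,
        ih h1 (by omega), mul_assoc]
    · obtain rfl : a = i + 1 := by omega
      have e := strandCross_strandCross_crossing (n := n) (q := p + i) (b := b) (by omega)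
      have e2 : crossing n (p + b + i) * blockCross n p i b =
          blockCross n p i b * crossing n (p + b + i) :=
        crossing_blockCross_comm n (by omega)
      simp only [blockCross, ← add_assoc]
      rw [mul_assoc, mul_assoc, ← mul_assoc (strandCross n (p + i) b), e,
        show p + i + b = p + b + i by omega, ← mul_assoc, ← e2]
      simp only [mul_assoc]

theorem blockCross_strandCross {n p a b i c : ℕ} (hi : i + c + 1 ≤ a) (h : p + a + b ≤ n) :
    blockCross n p a b * strandCross n (p + i) c =
      strandCross n (p + b + i) c * blockCross n p a b := by
  induction c with
  | zero => simp [strandCross]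
  | succ c ih =>
    rw [strandCross, strandCross, ← mul_assoc, add_assoc p i c,
      blockCross_crossing (by omega) h, mul_assoc, ih (by omega), ← mul_assoc,
      show p + b + (i + c) = p + b + i + c by omega]

theorem blockCross_blockCross {n p a b c d : ℕ} (hi : c + d ≤ a) (h : p + a + b ≤ n) :
    blockCross n p a b * blockCross n p c d =
      blockCross n (p + b) c d * blockCross n p a b := by
  induction c with
  | zero => simp [blockCross]
  | succ c ih =>
    rw [blockCross, blockCross, ← mul_assoc, ih (by omega), mul_assoc,
      blockCross_strandCross (by omega) h, mul_assoc]

theorem blockCross_add (n p a b c : ℕ) :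
    blockCross n p (a + b) c = blockCross n p a c * blockCross n (p + a) b c := by
  induction b with
  | zero => simp [blockCross]
  | succ b ih =>
    rw [← add_assoc, blockCross, ih, blockCross, mul_assoc, add_assoc p a b]

theorem blockCross_braid {n p a b c : ℕ} (h : p + a + b + c ≤ n) :
    blockCross n p b a * blockCross n (p + b) c a * blockCross n p c b =
      blockCross n (p + a) c b * blockCross n p c a * blockCross n (p + c) b a := by
  rw [← blockCross_add, mul_assoc, ← blockCross_add, add_comm c b,
    blockCross_blockCross (by omega) (by omega)]

/-- The elementary braid `σ_i` with the strand which ends at the place `j` replaced by `m j`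
parallel strands, for all `j`. -/
def blockGen {k n : ℕ} (i : Fin (k - 1)) (m : Blocks k n) : BraidGroup n :=
  blockCross n (m.offset i.val) (m.1 ⟨i.val + 1, by omega⟩) (m.1 ⟨i.val, by omega⟩)

theorem Blocks.permute_one {k n : ℕ} (m : Blocks k n) : m.permute 1 = m := rfl

theorem Blocks.permute_permute {k n : ℕ} (m : Blocks k n) (π π' : Equiv.Perm (Fin k)) :
    (m.permute π).permute π' = m.permute (π * π') := rfl

theorem adjSwap_mul_self {k : ℕ} (i : Fin (k - 1)) : adjSwap i * adjSwap i = 1 :=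
  Equiv.swap_mul_self _ _

theorem Blocks.offset_permute_adjSwap {k n : ℕ} (m : Blocks k n) (i : Fin (k - 1)) {t : ℕ}
    (h : t ≤ i.val ∨ i.val + 2 ≤ t) : (m.permute (adjSwap i)).offset t = m.offset t := by
  unfold Blocks.offset Blocks.permute
  rw [← Equiv.sum_comp (adjSwap i) (fun j : Fin k => if j.val < t then m.1 j else 0)]
  refine Finset.sum_congr rfl fun j _ => ?_
  have : (adjSwap i j).val < t ↔ j.val < t := by
    unfold adjSwap
    rw [Equiv.swap_apply_def]
    split_ifs with h1 h2
    · subst h1; simp; omega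
    · subst h2; simp; omega
    · rfl
  simp [this]

theorem adjSwap_left {k i : ℕ} (h : i < k - 1) :
    adjSwap ⟨i, h⟩ (⟨i, by omega⟩ : Fin k) = ⟨i + 1, by omega⟩ := Equiv.swap_apply_left _ _

theorem adjSwap_right {k i : ℕ} (h : i < k - 1) :
    adjSwap ⟨i, h⟩ (⟨i + 1, by omega⟩ : Fin k) = ⟨i, by omega⟩ := Equiv.swap_apply_right _ _

theorem adjSwap_ne {k i : ℕ} (h : i < k - 1) {t : ℕ} (ht : t < k) (h1 : t ≠ i) (h2 : t ≠ i + 1) :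
    adjSwap ⟨i, h⟩ (⟨t, ht⟩ : Fin k) = ⟨t, ht⟩ :=
  Equiv.swap_apply_of_ne_of_ne (by simpa using h1) (by simpa using h2)

theorem blockGen_braid {k n : ℕ} (i j : Fin (k - 1)) (h : i.val + 1 = j.val) (m : Blocks k n) :
    blockGen i m * blockGen j (m.permute (adjSwap i)) *
        blockGen i ((m.permute (adjSwap i)).permute (adjSwap j)) =
      blockGen j m * blockGen i (m.permute (adjSwap j)) *
        blockGen j ((m.permute (adjSwap j)).permute (adjSwap i)) := by
  obtain ⟨i, hi⟩ := i
  obtain ⟨j, hj⟩ := j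
  simp only at h
  subst h
  have v (π : Equiv.Perm (Fin k)) (t : Fin k) (m : Blocks k n) : (m.permute π).1 t = m.1 (π t) :=
    rfl
  have e1 := adjSwap_left hi
  have e2 := adjSwap_right hi
  have e3 := adjSwap_ne hi (t := i + 1 + 1) (by omega) (by omega) (by omega)
  have e4 := adjSwap_left hj
  have e5 := adjSwap_right hj
  have e6 := adjSwap_ne hj (t := i) (by omega) (by omega) (by omega)
  have o1 := m.offset_succ ⟨i, by omega⟩
  have o2 := m.offset_succ ⟨i + 1, by omega⟩
  have o3 := m.offset_succ ⟨i + 1 + 1, by omega⟩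
  have o4 := m.offset_le (i + 1 + 1 + 1)
  have p1 := (m.permute (adjSwap ⟨i, hi⟩)).offset_succ ⟨i, by omega⟩
  have p2 := ((m.permute (adjSwap ⟨i + 1, hj⟩)).permute (adjSwap ⟨i, hi⟩)).offset_succ
    ⟨i, by omega⟩
  have q1 := m.offset_permute_adjSwap ⟨i, hi⟩ (t := i) (by simp)
  have q2 := m.offset_permute_adjSwap ⟨i + 1, hj⟩ (t := i) (by simp)
  have q3 := (m.permute (adjSwap ⟨i, hi⟩)).offset_permute_adjSwap ⟨i + 1, hj⟩ (t := i) (by simp)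
  have q4 := (m.permute (adjSwap ⟨i + 1, hj⟩)).offset_permute_adjSwap ⟨i, hi⟩ (t := i) (by simp)
  simp only [v, e1, e4] at o1 o2 o3 o4 p1 p2 q1 q2 q3 q4
  have key := blockCross_braid (n := n) (p := m.offset i) (a := m.1 ⟨i, by omega⟩)
    (b := m.1 ⟨i + 1, by omega⟩) (c := m.1 ⟨i + 1 + 1, by omega⟩) (by omega)
  simp only [blockGen, v, e1, e2, e3, e4, e5, e6, p1, p2, q1, q2, q3, q4, o1]
  exact key

theorem blockGen_comm {k n : ℕ} (i j : Fin (k - 1)) (h : i.val + 1 < j.val) (m : Blocks k n) :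
    blockGen i m * blockGen j (m.permute (adjSwap i)) =
      blockGen j m * blockGen i (m.permute (adjSwap j)) := by
  obtain ⟨i, hi⟩ := i
  obtain ⟨j, hj⟩ := j
  simp only at h
  have v (π : Equiv.Perm (Fin k)) (t : Fin k) (m : Blocks k n) : (m.permute π).1 t = m.1 (π t) :=
    rfl
  have e1 := adjSwap_ne hi (t := j) (by omega) (by omega) (by omega)
  have e2 := adjSwap_ne hi (t := j + 1) (by omega) (by omega) (by omega)
  have e3 := adjSwap_ne hj (t := i) (by omega) (by omega) (by omega)
  have e4 := adjSwap_ne hj (t := i + 1) (by omega) (by omega) (by omega)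
  have q1 := m.offset_permute_adjSwap ⟨i, hi⟩ (t := j) (by simp; omega)
  have q2 := m.offset_permute_adjSwap ⟨j, hj⟩ (t := i) (by simp; omega)
  have o1 := m.offset_succ ⟨i, by omega⟩
  have o2 := m.offset_succ ⟨i + 1, by omega⟩
  have o3 := m.offset_mono (t := i + 1 + 1) (t' := j) (by omega)
  simp only at o1 o2
  simp only [blockGen, v, e1, e2, e3, e4, q1, q2]
  exact blockCross_comm n (by omega)

/-- One step of cabling, on pairs (block sizes at the source, braid up to now). -/
def cableStep {k n : ℕ} (i : Fin (k - 1)) : Equiv.Perm (Blocks k n × BraidGroup n) where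
  toFun x := (x.1.permute (adjSwap i), x.2 * blockGen i x.1)
  invFun x := (x.1.permute (adjSwap i), x.2 * (blockGen i (x.1.permute (adjSwap i)))⁻¹)
  left_inv x := by
    simp [Blocks.permute_permute, adjSwap_mul_self, Blocks.permute_one]
  right_inv x := by
    simp [Blocks.permute_permute, adjSwap_mul_self, Blocks.permute_one]

/-- The right action of braids on pairs (block sizes, braid) by cabling. -/
def cableAction {k n : ℕ} : BraidGroup k →* (Equiv.Perm (Blocks k n × BraidGroup n))ᵐᵒᵖ :=
  BraidGroup.lift (fun i => MulOpposite.op (cableStep i))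
    (by
      intro i j h
      simp only [← MulOpposite.op_mul]
      refine congrArg _ (Equiv.ext fun x => Prod.ext ?_ ?_)
      · exact congrArg x.1.permute (adjSwap_braid i j h)
      · have := blockGen_braid i j h x.1
        simp only [cableStep, Equiv.Perm.mul_apply, Equiv.coe_fn_mk]
        rw [mul_assoc, mul_assoc, ← mul_assoc (blockGen i _), this]
        simp only [mul_assoc])
    (by
      intro i j h
      simp only [← MulOpposite.op_mul]
      refine congrArg _ (Equiv.ext fun x => Prod.ext ?_ ?_)
      · exact congrArg x.1.permute (adjSwap_comm i j h)
      · have := blockGen_comm i j h x.1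
        simp only [cableStep, Equiv.Perm.mul_apply, Equiv.coe_fn_mk]
        rw [mul_assoc, mul_assoc, this])

/-- Cabling `Γ(ρ; 1, …, 1)`: the strand of `ρ` which ends at the place `i` is replaced by `m i`
parallel strands, for all `i`. The source blocks have the sizes `m (perm ρ i)`. See `cable_of` and
`cable_mul` for the two equations that determine it. -/
def cable {k n : ℕ} (ρ : BraidGroup k) (m : Blocks k n) : BraidGroup n :=
  ((cableAction ρ).unop (m, 1)).2

theorem cableAction_apply {k n : ℕ} (ρ : BraidGroup k) (m : Blocks k n) (b : BraidGroup n) :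
    (cableAction ρ).unop (m, b) = (m.permute ρ.perm, b * cable ρ m) := by
  have key : ∀ (m : Blocks k n) (b c : BraidGroup n),
      ((cableAction ρ).unop (m, b)).1 = m.permute ρ.perm ∧
        ((cableAction ρ).unop (m, c * b)).2 = c * ((cableAction ρ).unop (m, b)).2 := by
    have hmem : ρ ∈ Subgroup.closure (Set.range (PresentedGroup.of (rels := {r | ArtinRel k r}))) :=
      by rw [PresentedGroup.closure_range_of]; trivial
    induction hmem using Subgroup.closure_induction with
    | mem x hx =>
      obtain ⟨i, rfl⟩ := hx
      intro m b c
      have h1 : cableAction (n := n) (PresentedGroup.of (rels := {r | ArtinRel k r}) i) =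
        MulOpposite.op (cableStep i) := BraidGroup.lift_of _ _ _ i
      have h2 : BraidGroup.perm (PresentedGroup.of (rels := {r | ArtinRel k r}) i) = adjSwap i :=
        BraidGroup.lift_of _ _ _ i
      rw [h1, h2]
      exact ⟨rfl, mul_assoc _ _ _⟩
    | one => intro m b c; simp [Blocks.permute_one]
    | mul x y _ _ hx hy =>
      intro m b c
      simp only [map_mul, MulOpposite.unop_mul, Equiv.Perm.mul_apply]
      obtain ⟨p, hp⟩ : ∃ p, (cableAction x).unop (m, b) = (m.permute x.perm, p) :=
        ⟨_, Prod.ext (hx m b c).1 rfl⟩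
      have hq : (cableAction x).unop (m, c * b) = (m.permute x.perm, c * p) := by
        refine Prod.ext (hx m _ c).1 ?_
        rw [(hx m b c).2, hp]
      rw [hp, hq]
      exact ⟨(hy _ p c).1, (hy _ p c).2⟩
    | inv x _ hx =>
      intro m b c
      have h0 (y : Blocks k n × BraidGroup n) :
          (cableAction x).unop ((cableAction x⁻¹).unop y) = y := by
        rw [← Equiv.Perm.mul_apply, ← MulOpposite.unop_mul, ← map_mul]; simp
      have h1 (b : BraidGroup n) : ((cableAction x⁻¹).unop (m, b)).1 = m.permute x⁻¹.perm := by
        have := (hx ((cableAction x⁻¹).unop (m, b)).1 ((cableAction x⁻¹).unop (m, b)).2 1).1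
        rw [Prod.mk.eta, h0] at this
        simp only at this
        have h2 := congrArg (fun m' => Blocks.permute m' x⁻¹.perm) this
        simp only [Blocks.permute_permute] at h2
        rw [h2, ← map_mul, mul_inv_cancel, map_one, Blocks.permute_one]
      refine ⟨h1 b, ?_⟩
      have e : (cableAction x).unop (((cableAction x⁻¹).unop (m, b)).1,
          c * ((cableAction x⁻¹).unop (m, b)).2) = (m, c * b) := by
        refine Prod.ext ?_ ?_
        · rw [(hx _ _ 1).1, h1, Blocks.permute_permute, map_inv, inv_mul_cancel,
            Blocks.permute_one]
        · rw [(hx _ _ c).2, Prod.mk.eta, h0]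
      have e' := congrArg (cableAction x⁻¹).unop e
      have h0' (y : Blocks k n × BraidGroup n) :
          (cableAction x⁻¹).unop ((cableAction x).unop y) = y := by
        rw [← Equiv.Perm.mul_apply, ← MulOpposite.unop_mul, ← map_mul]; simp
      rw [h0'] at e'
      rw [← e']
  refine Prod.ext (key m b 1).1 ?_
  have := (key m 1 b).2
  rwa [mul_one] at this

/-- The cable of an elementary braid is an elementary block crossing. -/
theorem cable_of {k n : ℕ} (i : Fin (k - 1)) (m : Blocks k n) :
    cable (PresentedGroup.of i) m = blockGen i m := by
  have h1 : cableAction (n := n) (PresentedGroup.of (rels := {r | ArtinRel k r}) i) =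
    MulOpposite.op (cableStep i) := BraidGroup.lift_of _ _ _ i
  rw [cable, h1]
  exact one_mul _

/-- Cabling respects composition. -/
theorem cable_mul {k n : ℕ} (a b : BraidGroup k) (m : Blocks k n) :
    cable (a * b) m = cable a m * cable b (m.permute a.perm) := by
  have h : (cableAction (a * b)).unop (m, 1) = (cableAction b).unop ((cableAction a).unop (m, 1)) :=
    by rw [map_mul, MulOpposite.unop_mul, Equiv.Perm.mul_apply]
  rw [cableAction_apply a, one_mul, cableAction_apply b] at h
  exact congrArg Prod.snd h

/-! ## Fibres of maps between the ordinals `Fin n` -/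

/-- The number of elements of the fibre of `f` over `i`. -/
def fibCard {n k : ℕ} (f : Fin n → Fin k) (i : Fin k) : ℕ :=
  (Finset.univ.filter fun x => f x = i).card

/-- The order preserving inclusion of the fibre of `f` over `i`, as an ordinal. -/
def fibEmb {n k : ℕ} (f : Fin n → Fin k) (i : Fin k) : Fin (fibCard f i) ↪o Fin n :=
  (Finset.univ.filter fun x => f x = i).orderEmbOfFin rfl

theorem range_fibEmb {n k : ℕ} (f : Fin n → Fin k) (i : Fin k) :
    Set.range (fibEmb f i) = {x | f x = i} := by
  have h := Finset.range_orderEmbOfFin (Finset.univ.filter fun x => f x = i) rfl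
  refine Eq.trans h ?_
  simp

theorem map_fibEmb {n k : ℕ} (f : Fin n → Fin k) (i : Fin k) (j : Fin (fibCard f i)) :
    f (fibEmb f i j) = i := by
  have : fibEmb f i j ∈ Set.range (fibEmb f i) := ⟨j, rfl⟩
  rwa [range_fibEmb] at this

theorem exists_fibEmb_eq {n k : ℕ} (f : Fin n → Fin k) {i : Fin k} {x : Fin n} (h : f x = i) :
    ∃ j, fibEmb f i j = x := by
  have : x ∈ Set.range (fibEmb f i) := by rw [range_fibEmb]; exact h
  exact this

section FibMap

variable {n l k : ℕ} {f : Fin n → Fin l} {g : Fin l → Fin k} {h : Fin n → Fin k}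

/-- The map `f_i : h⁻¹(i) → g⁻¹(i)` of fibres induced by `f`, where `h = g ∘ f`. -/
noncomputable def fibMap (c : ∀ x, h x = g (f x)) (i : Fin k) (j : Fin (fibCard h i)) :
    Fin (fibCard g i) :=
  (exists_fibEmb_eq g ((c _).symm.trans (map_fibEmb h i j))).choose

theorem fibEmb_fibMap (c : ∀ x, h x = g (f x)) (i : Fin k) (j : Fin (fibCard h i)) :
    fibEmb g i (fibMap c i j) = f (fibEmb h i j) :=
  (exists_fibEmb_eq g ((c _).symm.trans (map_fibEmb h i j))).choose_spec

/-- The fibre of `f_i` over `j` and the fibre of `f` over the element `j` of `g⁻¹(i)` are the same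
subset of the source of `f`. -/
theorem range_fibEmb_fibMap (c : ∀ x, h x = g (f x)) (i : Fin k) (j : Fin (fibCard g i)) :
    Set.range ((fibEmb (fibMap c i) j).trans (fibEmb h i)) = Set.range (fibEmb f (fibEmb g i j)) := by
  ext x
  rw [range_fibEmb]
  constructor
  · rintro ⟨y, rfl⟩
    change f (fibEmb h i (fibEmb (fibMap c i) j y)) = fibEmb g i j
    rw [← fibEmb_fibMap c, map_fibEmb (fibMap c i)]
  · intro hx
    have hx' : f x = fibEmb g i j := hx
    obtain ⟨z, rfl⟩ := exists_fibEmb_eq h (i := i) (x := x) (by rw [c, hx', map_fibEmb g])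
    rw [← fibEmb_fibMap c] at hx'
    obtain ⟨y, rfl⟩ := exists_fibEmb_eq (fibMap c i) ((fibEmb g i).injective hx')
    exact ⟨y, rfl⟩

end FibMap

theorem eq_of_range_eq {a b n : ℕ} {φ : Fin a ↪o Fin n} {ψ : Fin b ↪o Fin n}
    (h : Set.range φ = Set.range ψ) : a = b := by
  have h1 := congrArg Set.ncard h
  rw [← Set.image_univ, ← Set.image_univ, Set.ncard_image_of_injective _ φ.injective,
    Set.ncard_image_of_injective _ ψ.injective] at h1
  simpa [Set.ncard_univ] using h1

theorem fibCard_fibMap {n l k : ℕ} {f : Fin n → Fin l} {g : Fin l → Fin k} {h : Fin n → Fin k}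
    (c : ∀ x, h x = g (f x)) (i : Fin k) (j : Fin (fibCard g i)) :
    fibCard (fibMap c i) j = fibCard f (fibEmb g i j) :=
  eq_of_range_eq (range_fibEmb_fibMap c i j)

theorem sum_fibCard {n k : ℕ} (f : Fin n → Fin k) : ∑ i, fibCard f i = n := by
  unfold fibCard
  rw [← Finset.card_eq_sum_card_fiberwise (t := Finset.univ) (by intro x _; simp)]
  simp

theorem fibCard_bijective {n k : ℕ} {f : Fin n → Fin k} (h : Function.Bijective f) (i : Fin k) :
    fibCard f i = 1 := by
  obtain ⟨x, rfl⟩ := h.2 i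
  unfold fibCard
  rw [Finset.card_eq_one]
  exact ⟨x, by ext y; simp [h.1.eq_iff]⟩

theorem fibCard_fin_one {n : ℕ} (f : Fin n → Fin 1) (i : Fin 1) : fibCard f i = n := by
  unfold fibCard
  rw [Finset.filter_true_of_mem (fun x _ => Subsingleton.elim _ _)]
  simp

/-- The sizes of the fibres of a map, as sizes of blocks. -/
def fibBlocks {n k : ℕ} (f : Fin n → Fin k) : Blocks k n := ⟨fibCard f, sum_fibCard f⟩

theorem orderHom_comp_apply {n l k : ℕ} (σ : Fin n →o Fin l) (ω : Fin l →o Fin k) (x : Fin n) :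
    (ω.comp σ) x = ω (σ x) := rfl

/-- The order preserving map `σ_i : (ω ∘ σ)⁻¹(i) → ω⁻¹(i)` of fibres induced by `σ`. -/
noncomputable def fibHom {n l k : ℕ} (σ : Fin n →o Fin l) (ω : Fin l →o Fin k) (i : Fin k) :
    Fin (fibCard (ω.comp σ) i) →o Fin (fibCard ω i) where
  toFun := fibMap (orderHom_comp_apply σ ω) i
  monotone' a b h := by
    rw [← (fibEmb ω i).le_iff_le, fibEmb_fibMap, fibEmb_fibMap]
    exact σ.monotone ((fibEmb _ i).monotone h)

theorem fibCard_fibHom {n l k : ℕ} (σ : Fin n →o Fin l) (ω : Fin l →o Fin k) (i : Fin k)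
    (j : Fin (fibCard ω i)) : fibCard (fibHom σ ω i) j = fibCard σ (fibEmb ω i j) :=
  fibCard_fibMap (orderHom_comp_apply σ ω) i j

/-! ## Tensor products of finite families in a symmetric monoidal category -/

section Tensor

variable {V : Type u} [Category.{v} V] [MonoidalCategory V] {ι κ : Type*}

/-- The tensor product of the `X i`, with `i` running through a list, bracketed to the right. -/
def listProd (X : ι → V) : List ι → V
  | [] => 𝟙_ V
  | i :: L => X i ⊗ listProd X L

/-- The tensor product of a family of morphisms. -/
def listProdMap {X Y : ι → V} (f : ∀ i, X i ⟶ Y i) : (L : List ι) → (listProd X L ⟶ listProd Y L)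
  | [] => 𝟙 (𝟙_ V)
  | i :: L => f i ⊗ₘ listProdMap f L

/-- Renaming of indices; it is an identity up to the equality of its source and target. -/
def listProdReindex (X : ι → V) (g : κ → ι) :
    (L : List κ) → (listProd (fun j => X (g j)) L ≅ listProd X (L.map g))
  | [] => Iso.refl (𝟙_ V)
  | j :: L => whiskerLeftIso (X (g j)) (listProdReindex X g L)

/-- Associativity: removal of brackets in a product of two products. -/
def listProdAppend (X : ι → V) (L' : List ι) :
    (L : List ι) → (listProd X L ⊗ listProd X L' ⟶ listProd X (L ++ L'))
  | [] => (λ_ _).hom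
  | i :: L => (α_ (X i) (listProd X L) (listProd X L')).hom ≫ X i ◁ listProdAppend X L' L

/-- Associativity: removal of brackets in a product of products. -/
def listProdFlatten (X : ι → V) (L : κ → List ι) :
    (K : List κ) → (listProd (fun j => listProd X (L j)) K ⟶ listProd X (K.flatMap L))
  | [] => 𝟙 (𝟙_ V)
  | j :: K => listProd X (L j) ◁ listProdFlatten X L K ≫ listProdAppend X (K.flatMap L) (L j)

/-- The map `I ≅ I ⊗ ⋯ ⊗ I ⟶ X i₁ ⊗ ⋯ ⊗ X iₙ` given by a family of maps `I ⟶ X i`. -/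
def listProdUnit {X : ι → V} (e : ∀ i, 𝟙_ V ⟶ X i) : (L : List ι) → (𝟙_ V ⟶ listProd X L)
  | [] => 𝟙 (𝟙_ V)
  | i :: L => (λ_ (𝟙_ V)).inv ≫ (e i ⊗ₘ listProdUnit e L)

theorem listProdMap_id (X : ι → V) (L : List ι) : listProdMap (fun i => 𝟙 (X i)) L = 𝟙 _ := by
  induction L with
  | nil => rfl
  | cons i L ih => simp [listProdMap, ih, listProd]

theorem listProdMap_comp {X Y Z : ι → V} (f : ∀ i, X i ⟶ Y i) (g : ∀ i, Y i ⟶ Z i) (L : List ι) :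
    listProdMap (fun i => f i ≫ g i) L = listProdMap f L ≫ listProdMap g L := by
  induction L with
  | nil => simp [listProdMap, listProd]
  | cons i L ih => simp [listProdMap, ih, listProd]

/-- The tensor product `X 0 ⊗ (X 1 ⊗ ⋯ ⊗ (X (k - 1) ⊗ I))` of a family indexed by an ordinal. -/
def tprod {k : ℕ} (X : Fin k → V) : V := listProd X (List.finRange k)

/-- The tensor product `⨂ f i` of a family of morphisms. -/
def tprodMap {k : ℕ} {X Y : Fin k → V} (f : ∀ i, X i ⟶ Y i) : tprod X ⟶ tprod Y :=
  listProdMap f (List.finRange k)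

/-- The map `I ≅ I ⊗ ⋯ ⊗ I ⟶ X 0 ⊗ ⋯ ⊗ X (k - 1)` given by a family of maps `I ⟶ X i`. -/
def tprodUnit {k : ℕ} {X : Fin k → V} (e : ∀ i, 𝟙_ V ⟶ X i) : 𝟙_ V ⟶ tprod X :=
  listProdUnit e (List.finRange k)

/-- The identification of an object with the tensor product of the one element family. -/
def tprodOne (X : Fin 1 → V) : X 0 ⟶ tprod X := (ρ_ (X 0)).inv

theorem tprodMap_id {k : ℕ} (X : Fin k → V) : tprodMap (fun i => 𝟙 (X i)) = 𝟙 (tprod X) :=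
  listProdMap_id X _

theorem tprodMap_comp {k : ℕ} {X Y Z : Fin k → V} (f : ∀ i, X i ⟶ Y i) (g : ∀ i, Y i ⟶ Z i) :
    tprodMap (fun i => f i ≫ g i) = tprodMap f ≫ tprodMap g :=
  listProdMap_comp f g _

variable [SymmetricCategory V]

/-- The symmetry `⨂ (X i ⊗ Y i) ≅ (⨂ X i) ⊗ (⨂ Y i)`. -/
def listProdUnzip (X Y : ι → V) :
    (L : List ι) → (listProd (fun i => X i ⊗ Y i) L ⟶ listProd X L ⊗ listProd Y L)
  | [] => (λ_ (𝟙_ V)).inv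
  | i :: L => (X i ⊗ Y i) ◁ listProdUnzip X Y L ≫
      tensorμ (X i) (Y i) (listProd X L) (listProd Y L)

/-- The symmetry which moves the (first) factor with the index `i` to the front. -/
def listProdPull [DecidableEq ι] (X : ι → V) (i : ι) :
    (L : List ι) → i ∈ L → (listProd X L ⟶ X i ⊗ listProd X (L.erase i))
  | [], h => absurd h List.not_mem_nil
  | a :: L, h =>
    if hai : a = i then eqToHom (by subst hai; rw [List.erase_cons_head]; rfl)
    else
      X a ◁ listProdPull X i L ((List.mem_cons.1 h).resolve_left (Ne.symm hai)) ≫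
        (α_ (X a) (X i) (listProd X (L.erase i))).inv ≫
        (β_ (X a) (X i)).hom ▷ listProd X (L.erase i) ≫
        (α_ (X i) (X a) (listProd X (L.erase i))).hom ≫
        X i ◁ eqToHom (by rw [List.erase_cons_tail (by simpa using hai)]; rfl)

/-- The symmetry between tensor products of the same factors in different orders. For lists
without repetitions it is the canonical one, which sends each factor to the factor with the same
index. -/
def listProdPerm [DecidableEq ι] (X : ι → V) :
    (L' L : List ι) → L.Perm L' → (listProd X L ⟶ listProd X L')
  | [], _, h => eqToHom (by rw [List.Perm.eq_nil h])
  | i :: L', L, h =>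
    listProdPull X i L (h.mem_iff.2 List.mem_cons_self) ≫
      X i ◁ listProdPerm X L' (L.erase i) (by simpa using h.erase i)

/-- The symmetry `τ(π) : X 0 ⊗ ⋯ ⊗ X (k - 1) ⟶ X (π 0) ⊗ ⋯ ⊗ X (π (k - 1))`. -/
def tprodSymm {k : ℕ} (π : Equiv.Perm (Fin k)) (X : Fin k → V) :
    tprod X ⟶ tprod (fun i => X (π i)) :=
  listProdPerm X ((List.finRange k).map π) (List.finRange k)
      ((List.perm_ext_iff_of_nodup (List.nodup_finRange k)
        ((List.nodup_finRange k).map π.injective)).2 fun a => by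
          simpa using ⟨π.symm a, π.apply_symm_apply a⟩) ≫
    (listProdReindex X π (List.finRange k)).inv

theorem flatMap_fibEmb_perm {l k : ℕ} (g : Fin l → Fin k) :
    ((List.finRange k).flatMap fun i => (List.finRange (fibCard g i)).map (fibEmb g i)).Perm
      (List.finRange l) := by
  refine (List.perm_ext_iff_of_nodup ?_ (List.nodup_finRange l)).2 fun a => ?_
  · refine List.nodup_flatMap.2 ⟨fun i _ => (List.nodup_finRange _).map (fibEmb g i).injective, ?_⟩
    refine (List.nodup_finRange k).imp ?_
    intro i i' hne x hx hx'
    simp only [List.mem_map, List.mem_finRange, true_and] at hx hx'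
    obtain ⟨j, rfl⟩ := hx
    obtain ⟨j', hj'⟩ := hx'
    exact hne (by rw [← map_fibEmb g i j, ← hj', map_fibEmb g])
  · simpa using ⟨g a, exists_fibEmb_eq g rfl⟩

/-- The symmetry `⨂_i ⨂_{j ∈ g⁻¹(i)} X j ≅ ⨂_j X j` for a map `g` of ordinals. It is an
associativity isomorphism if `g` preserves the order; in general it permutes the factors. -/
def tprodFibres {l k : ℕ} (g : Fin l → Fin k) (X : Fin l → V) :
    tprod (fun i => tprod fun j => X (fibEmb g i j)) ⟶ tprod X :=
  tprodMap (fun i => (listProdReindex X (fibEmb g i) (List.finRange (fibCard g i))).hom) ≫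
    listProdFlatten X (fun i => (List.finRange (fibCard g i)).map (fibEmb g i))
      (List.finRange k) ≫
    listProdPerm X _ _ (flatMap_fibEmb_perm g)

/-- The symmetry
`R ⊗ ⨂_i (P i ⊗ ⨂_{j ∈ g⁻¹(i)} X j) ≅ (R ⊗ ⨂_i P i) ⊗ ⨂_j X j`
which compares the two ways to compose operations. -/
def regroup {l k : ℕ} (g : Fin l → Fin k) (R : V) (P : Fin k → V) (X : Fin l → V) :
    R ⊗ tprod (fun i => P i ⊗ tprod fun j => X (fibEmb g i j)) ⟶ (R ⊗ tprod P) ⊗ tprod X :=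
  R ◁ (listProdUnzip P (fun i => tprod fun j => X (fibEmb g i j)) (List.finRange k) ≫
      tprod P ◁ tprodFibres g X) ≫
    (α_ R (tprod P) (tprod X)).inv

end Tensor

/-! ## Braided operads -/

section Braided

variable (V : Type u) [Category.{v} V] [MonoidalCategory V] [SymmetricCategory V]

/-- A right braided operad in a symmetric monoidal category. The object `obj n` consists of the
operations with `n` inputs; `obj`, `act`, `act_one` and `act_mul` are a contravariant functor on
the groupoid of braid groups. -/
structure BraidedOperad where
  /-- the operations with `n` inputs -/
  obj : ℕ → V
  /-- the right action of the braids -/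
  act : ∀ {n : ℕ}, BraidGroup n → (obj n ⟶ obj n)
  act_one : ∀ n : ℕ, act (1 : BraidGroup n) = 𝟙 (obj n)
  act_mul : ∀ {n : ℕ} (a b : BraidGroup n), act (a * b) = act a ≫ act b
  /-- the unit -/
  unit : 𝟙_ V ⟶ obj 1
  /-- the multiplication, for every order preserving map -/
  mul : ∀ {n k : ℕ} (σ : Fin n →o Fin k), obj k ⊗ tprod (fun i => obj (fibCard σ i)) ⟶ obj n
  assoc : ∀ {n l k : ℕ} (σ : Fin n →o Fin l) (ω : Fin l →o Fin k),
    regroup ω (obj k) (fun i => obj (fibCard ω i)) (fun j => obj (fibCard σ j)) ≫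
        mul ω ▷ tprod (fun j => obj (fibCard σ j)) ≫ mul σ =
      obj k ◁ tprodMap (fun i =>
          obj (fibCard ω i) ◁ tprodMap (fun j =>
            eqToHom (congrArg obj (fibCard_fibHom σ ω i j).symm)) ≫ mul (fibHom σ ω i)) ≫
        mul (ω.comp σ)
  mul_unit : ∀ n : ℕ,
    (ρ_ (obj n)).inv ≫
        obj n ◁ tprodUnit (fun i => unit ≫
          eqToHom (congrArg obj (fibCard_bijective Function.bijective_id i).symm)) ≫
        mul (OrderHom.id : Fin n →o Fin n) = 𝟙 (obj n)
  unit_mul : ∀ {n : ℕ} (σ : Fin n →o Fin 1),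
    (λ_ (obj n)).inv ≫ unit ▷ obj n ≫
        obj 1 ◁ (eqToHom (congrArg obj (fibCard_fin_one σ 0).symm) ≫
          tprodOne (fun i => obj (fibCard σ i))) ≫
        mul σ = 𝟙 (obj n)
  /-- The first equivariance condition. Here `σ'` is the order preserving map whose fibre over `i`
  has as many elements as the fibre of `σ` over `ρ(i)`. -/
  equivariance_base : ∀ {n k : ℕ} (σ σ' : Fin n →o Fin k) (ρ : BraidGroup k)
    (h : ∀ i, fibCard σ' i = fibCard σ (ρ.perm i)),
    mul σ ≫ act (cable ρ (fibBlocks σ)) =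
      (act ρ ⊗ₘ (tprodSymm ρ.perm (fun i => obj (fibCard σ i)) ≫
          tprodMap (fun i => eqToHom (congrArg obj (h i).symm)))) ≫ mul σ'
  /-- The second equivariance condition. -/
  equivariance_fibre : ∀ {n k : ℕ} (σ : Fin n →o Fin k) (ρ : ∀ i, BraidGroup (fibCard σ i)),
    mul σ ≫ act (directSum (fibBlocks σ) ρ) =
      obj k ◁ tprodMap (fun i => act (ρ i)) ≫ mul σ

variable {V}

/-- Morphisms of braided operads: morphisms of braided collections which preserve units and
multiplications. -/
@[ext]
structure BraidedOperad.Hom (A B : BraidedOperad V) where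
  app : ∀ n : ℕ, A.obj n ⟶ B.obj n
  act : ∀ {n : ℕ} (ρ : BraidGroup n), A.act ρ ≫ app n = app n ≫ B.act ρ
  unit : A.unit ≫ app 1 = B.unit
  mul : ∀ {n k : ℕ} (σ : Fin n →o Fin k),
    A.mul σ ≫ app n = (app k ⊗ₘ tprodMap (fun i => app (fibCard σ i))) ≫ B.mul σ

instance : Category (BraidedOperad V) where
  Hom := BraidedOperad.Hom
  id A :=
    { app := fun n => 𝟙 (A.obj n)
      act := by simp
      unit := by simp
      mul := by simp [tprodMap_id] }
  comp f g :=
    { app := fun n => f.app n ≫ g.app n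
      act := fun ρ => by rw [← Category.assoc, f.act, Category.assoc, g.act, Category.assoc]
      unit := by rw [← Category.assoc, f.unit, g.unit]
      mul := fun σ => by
        rw [← Category.assoc, f.mul, Category.assoc, g.mul, tprodMap_comp,
          ← MonoidalCategory.tensorHom_comp_tensorHom, Category.assoc] }
  id_comp f := BraidedOperad.Hom.ext (funext fun n => Category.id_comp _)
  comp_id f := BraidedOperad.Hom.ext (funext fun n => Category.comp_id _)
  assoc f g h := BraidedOperad.Hom.ext (funext fun n => Category.assoc _ _ _)

end Braided

/-! ## `d`-ordinals -/

/-- The objects of the skeletal category of `d`-ordinals: a `d`-ordinal on the set `Fin card`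
whose total order (`a < b` iff `a <_p b` for some `p`) is the usual order of `Fin card`. Every
`d`-ordinal is isomorphic to exactly one of these, by exactly one isomorphism. -/
@[ext]
structure NOrdinal (d : ℕ) where
  card : ℕ
  /-- `lt p a b` is `a <_p b` -/
  lt : Fin d → Fin card → Fin card → Prop
  irrefl : ∀ p a, ¬ lt p a a
  existsUnique : ∀ a b, a ≠ b → ∃! p, lt p a b ∨ lt p b a
  trans : ∀ {p q a b c}, lt p a b → lt q b c → lt (min p q) a c
  lt_of_lt : ∀ {p a b}, lt p a b → a < b

namespace NOrdinal

variable {d : ℕ}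

/-- Maps of `d`-ordinals. -/
@[ext]
structure Hom (T S : NOrdinal d) where
  toFun : Fin T.card → Fin S.card
  cond : ∀ {p i j}, T.lt p i j →
    (∃ r, p ≤ r ∧ S.lt r (toFun i) (toFun j)) ∨ toFun i = toFun j ∨
      ∃ r, p < r ∧ S.lt r (toFun j) (toFun i)

instance : Category (NOrdinal d) where
  Hom := Hom
  id T := ⟨id, fun {p i j} h => Or.inl ⟨p, le_rfl, h⟩⟩
  comp f g := ⟨g.toFun ∘ f.toFun, fun {p i j} h => by
    rcases f.cond h with ⟨r, hr, h1⟩ | h1 | ⟨r, hr, h1⟩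
    · rcases g.cond h1 with ⟨s, hs, h2⟩ | h2 | ⟨s, hs, h2⟩
      · exact Or.inl ⟨s, hr.trans hs, h2⟩
      · exact Or.inr (Or.inl h2)
      · exact Or.inr (Or.inr ⟨s, hr.trans_lt hs, h2⟩)
    · exact Or.inr (Or.inl (congrArg g.toFun h1))
    · rcases g.cond h1 with ⟨s, hs, h2⟩ | h2 | ⟨s, hs, h2⟩
      · exact Or.inr (Or.inr ⟨s, hr.trans_le hs, h2⟩)
      · exact Or.inr (Or.inl h2.symm)
      · exact Or.inl ⟨s, (hr.trans hs).le, h2⟩⟩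

/-- The underlying map of a map of `d`-ordinals. -/
abbrev fn {T S : NOrdinal d} (σ : T ⟶ S) : Fin T.card → Fin S.card := Hom.toFun σ

theorem fn_comp_apply {T S R : NOrdinal d} (σ : T ⟶ S) (ω : S ⟶ R) (x : Fin T.card) :
    fn (σ ≫ ω) x = fn ω (fn σ x) := rfl

/-- Quasibijections: the maps of `d`-ordinals which are bijective. -/
def IsQuasibijection {T S : NOrdinal d} (σ : T ⟶ S) : Prop := Function.Bijective (fn σ)

/-- The terminal `d`-ordinal, with one element. -/
abbrev terminal (d : ℕ) : NOrdinal d where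
  card := 1
  lt _ _ _ := False
  irrefl _ _ h := h
  existsUnique a b h := absurd (Subsingleton.elim a b) h
  trans h := h.elim
  lt_of_lt h := h.elim

/-- The `d`-ordinal structure on a subset, given by its order preserving enumeration. -/
abbrev restrict (T : NOrdinal d) {a : ℕ} (φ : Fin a ↪o Fin T.card) : NOrdinal d where
  card := a
  lt p a b := T.lt p (φ a) (φ b)
  irrefl p x := T.irrefl p (φ x)
  existsUnique _ _ h := T.existsUnique _ _ (fun e => h (φ.injective e))
  trans h h' := T.trans h h'
  lt_of_lt h := φ.lt_iff_lt.1 (T.lt_of_lt h)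

theorem restrict_eq (T : NOrdinal d) {a b : ℕ} {φ : Fin a ↪o Fin T.card} {ψ : Fin b ↪o Fin T.card}
    (h : Set.range φ = Set.range ψ) : T.restrict φ = T.restrict ψ := by
  obtain rfl := eq_of_range_eq h
  rw [OrderEmbedding.range_inj.1 h]

theorem eq_of_card_eq_one {T S : NOrdinal d} (hT : T.card = 1) (hS : S.card = 1) : T = S := by
  obtain ⟨a, l, i, e, t, o⟩ := T
  obtain ⟨a', l', i', e', t', o'⟩ := S
  simp only at hT hS
  subst hT
  subst hS
  have : l = l' := by
    funext p x y
    obtain rfl := Subsingleton.elim x y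
    exact propext ⟨fun h => absurd h (i p x), fun h => absurd h (i' p x)⟩
  subst this
  rfl

/-- The fibre of a map of `d`-ordinals. -/
abbrev fibre {T S : NOrdinal d} (σ : T ⟶ S) (i : Fin S.card) : NOrdinal d :=
  T.restrict (fibEmb (fn σ) i)

/-- The map `σ_i : (σ ≫ ω)⁻¹(i) ⟶ ω⁻¹(i)` of fibres induced by `σ`. -/
noncomputable def fibreMap {T S R : NOrdinal d} (σ : T ⟶ S) (ω : S ⟶ R) (i : Fin R.card) :
    fibre (σ ≫ ω) i ⟶ fibre ω i where
  toFun := fibMap (fn_comp_apply σ ω) i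
  cond {p x y} h := by
    have e := fibEmb_fibMap (fn_comp_apply σ ω) i
    rw [← (fibEmb (fn ω) i).injective.eq_iff]
    simp only [e]
    exact σ.cond h

theorem fibre_fibreMap {T S R : NOrdinal d} (σ : T ⟶ S) (ω : S ⟶ R) (i : Fin R.card)
    (j : Fin (fibre ω i).card) :
    fibre (fibreMap σ ω i) j = fibre σ (fibEmb (fn ω) i j) :=
  T.restrict_eq (φ := (fibEmb (fn (fibreMap σ ω i)) j).trans (fibEmb (fn (σ ≫ ω)) i))
    (range_fibEmb_fibMap (fn_comp_apply σ ω) i j)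

theorem fibre_of_isQuasibijection {T S : NOrdinal d} {σ : T ⟶ S} (h : IsQuasibijection σ)
    (i : Fin S.card) : fibre σ i = terminal d :=
  eq_of_card_eq_one (fibCard_bijective h i) rfl

theorem fibre_terminal {T : NOrdinal d} (σ : T ⟶ terminal d) (i : Fin (terminal d).card) :
    fibre σ i = T :=
  (T.restrict_eq (ψ := OrderIso.refl (Fin T.card) |>.toOrderEmbedding) (by
    rw [range_fibEmb]
    ext x
    simp only [Set.mem_ofPred_eq, Set.mem_range]
    exact ⟨fun _ => ⟨x, rfl⟩, fun _ => Subsingleton.elim (α := Fin 1) (fn σ x) i⟩)).trans rfl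

theorem isQuasibijection_id (T : NOrdinal d) : IsQuasibijection (𝟙 T) := Function.bijective_id

end NOrdinal

/-! ## `d`-operads and quasisymmetric `d`-operads -/

section NOperads

open NOrdinal

variable (d : ℕ) (V : Type u) [Category.{v} V] [MonoidalCategory V] [SymmetricCategory V]

/-- The data of a (pruned, `(d-1)`-terminal) `d`-operad: a collection of objects indexed by the
skeletal category of `d`-ordinals, a unit, and a multiplication for every map of `d`-ordinals. -/
structure NOperadData where
  obj : NOrdinal d → V
  /-- the unit -/
  unit : 𝟙_ V ⟶ obj (terminal d)
  /-- the multiplication, for every map of `d`-ordinals -/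
  mul : ∀ {T S : NOrdinal d} (σ : T ⟶ S), obj S ⊗ tprod (fun i => obj (fibre σ i)) ⟶ obj T

variable {d V}

/-- The map `A(σ) : A_S ≅ A_S ⊗ I ⊗ ⋯ ⊗ I ⟶ A_S ⊗ A_U ⊗ ⋯ ⊗ A_U ⟶ A_T` for a quasibijection
`σ : T ⟶ S`, where `U` is the terminal `d`-ordinal. -/
def NOperadData.quasi (A : NOperadData d V) {T S : NOrdinal d} (σ : T ⟶ S)
    (h : IsQuasibijection σ) : A.obj S ⟶ A.obj T :=
  (ρ_ (A.obj S)).inv ≫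
    A.obj S ◁ tprodUnit (fun i => A.unit ≫
      eqToHom (congrArg A.obj (fibre_of_isQuasibijection h i).symm)) ≫
    A.mul σ

variable (d V)

/-- A (pruned, `(d-1)`-terminal) `d`-operad in a symmetric monoidal category. -/
structure NOperad extends NOperadData d V where
  assoc : ∀ {T S R : NOrdinal d} (σ : T ⟶ S) (ω : S ⟶ R),
    regroup (fn ω) (obj R) (fun i => obj (fibre ω i)) (fun j => obj (fibre σ j)) ≫
        mul ω ▷ tprod (fun j => obj (fibre σ j)) ≫ mul σ =
      obj R ◁ tprodMap (fun i =>
          obj (fibre ω i) ◁ tprodMap (fun j =>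
            eqToHom (congrArg obj (fibre_fibreMap σ ω i j).symm)) ≫ mul (fibreMap σ ω i)) ≫
        mul (σ ≫ ω)
  mul_unit : ∀ T : NOrdinal d, toNOperadData.quasi (𝟙 T) (isQuasibijection_id T) = 𝟙 (obj T)
  unit_mul : ∀ {T : NOrdinal d} (σ : T ⟶ terminal d),
    (λ_ (obj T)).inv ≫ unit ▷ obj T ≫
        obj (terminal d) ◁ (eqToHom (congrArg obj (fibre_terminal σ (0 : Fin 1)).symm) ≫
          tprodOne (fun i => obj (fibre σ i))) ≫
        mul σ = 𝟙 (obj T)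

variable {d V}

/-- Morphisms of `d`-operads: families of morphisms which preserve units and multiplications. -/
@[ext]
structure NOperad.Hom (A B : NOperad d V) where
  app : ∀ T : NOrdinal d, A.obj T ⟶ B.obj T
  unit : A.unit ≫ app (terminal d) = B.unit
  mul : ∀ {T S : NOrdinal d} (σ : T ⟶ S),
    A.mul σ ≫ app T = (app S ⊗ₘ tprodMap (fun i => app (fibre σ i))) ≫ B.mul σ

instance : Category (NOperad d V) where
  Hom := NOperad.Hom
  id A :=
    { app := fun T => 𝟙 (A.obj T)
      unit := by simp
      mul := by simp [tprodMap_id] }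
  comp f g :=
    { app := fun T => f.app T ≫ g.app T
      unit := by rw [← Category.assoc, f.unit, g.unit]
      mul := fun σ => by
        rw [← Category.assoc, f.mul, Category.assoc, g.mul, tprodMap_comp,
          ← MonoidalCategory.tensorHom_comp_tensorHom, Category.assoc] }
  id_comp f := NOperad.Hom.ext (funext fun n => Category.id_comp _)
  comp_id f := NOperad.Hom.ext (funext fun n => Category.comp_id _)
  assoc f g h := NOperad.Hom.ext (funext fun n => Category.assoc _ _ _)

variable (d V)

/-- A `d`-operad is quasisymmetric if `A(σ)` is an isomorphism for every quasibijection `σ`. -/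
def IsQuasisymmetric : ObjectProperty (NOperad d V) := fun A =>
  ∀ {T S : NOrdinal d} (σ : T ⟶ S) (h : IsQuasibijection σ), IsIso (A.quasi σ h)

/-- The category of quasisymmetric `d`-operads, a full subcategory of the one of `d`-operads. -/
abbrev QuasisymmetricOperad : Type (max u v) := (IsQuasisymmetric d V).FullSubcategory

end NOperads

end TwoOperads

set_option linter.unusedSectionVars false

/-! From braided operads to `2`-operads. Let `B` be a braided operad, and put `A_T = B_n` with `n`
the cardinality of `T`. A map `σ : T → S` has an underlying function `f`, which need not preserve
the order. The permutation `sortPerm f` puts its fibres one after another, and it has a preferred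
lift to the braid group, the positive permutation braid `posBraid (sortPerm f)`, given by any
reduced word (Matsumoto's theorem, `PosLift.unique`). The multiplication `m_σ` is `μ` for the order
preserving map with the same fibre sizes, followed by the action of this braid
(`BraidedOperad.sortMul`).

By the two equivariance conditions, associativity for `h = g ∘ f` reduces to one equation between
braids (`cable_posBraid_sortPerm`): the cable of the braid of `g`, times the braid of `f`, is the
direct sum of the braids of the maps of fibres `f_i`, times the braid of `h`. Both sides have the
same permutation, so it is enough that both are positive permutation braids, that is, that no two
strands cross twice. Here the axioms of `2`-ordinals enter (`NOrdinal.le_of_lt_of_lt`): a map that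
reverses a pair raises strictly the index of the relation between its members. As the only indices
are `0` and `1`, a pair is reversed at most once.

In this `2`-operad a quasibijection acts by the positive braid of its permutation, so the operad is
quasisymmetric. The generators of the braid groups are among these actions, and a quasibijection
which is the identity on points acts as an identity. Hence a morphism of `2`-operads depends only on
cardinalities, commutes with all braids, and comes from exactly one morphism of braided operads: the
functor is fully faithful.

Essential surjectivity. Let `A` be quasisymmetric. Transport along `A(T → oneBlock n)`, for `T` of
cardinality `n`, makes the objects depend only on cardinalities. The multiplications then depend
only on the underlying functions (`cardData_mul`), since changing the source or the base by a
quasibijection which is the identity on points has no effect. Each permutation `w` acts by `permMap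
w`, the action of the quasibijection from `discrete n` to `oneBlock n` given by `w`. If `w` ascends
at `i`, the quasibijection given by `w * adjSwap i` factors through a `2`-ordinal in which only `i`
and `i + 1` share a block, so `permMap` is multiplicative there (`CardOperad.permMap_mul_adjSwap`).
This gives Artin's relations and a braid action. Both equivariance conditions are checked on
generators, where they are associativity with a quasibijection as the inner map
(`NOperad.mul_quasi`) or as the outer map (`NOperad.quasi_mul`), and are extended to all braids by
multiplicativity. The construction by sorting, applied to this braided operad, gives back the
original multiplications.

All symmetries of `V` are handled by one coherence statement (`PermRel.unique`, used as
`IsCan.ext`): morphisms that permute distinct factors are determined by the permutation. -/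

namespace TwoOperads

/-! ## Coherence for tensor products of finite families -/

section Coherence

variable {V : Type u} [Category.{v} V] [MonoidalCategory V] [SymmetricCategory V]

/-- The symmetry exchanging the first two factors. -/
def swapFactors (A B C : V) : A ⊗ (B ⊗ C) ⟶ B ⊗ (A ⊗ C) :=
  (α_ A B C).inv ≫ (β_ A B).hom ▷ C ≫ (α_ B A C).hom

theorem swapFactors_self (A B C : V) : swapFactors A B C ≫ swapFactors B A C = 𝟙 _ := by
  simp [swapFactors, ← comp_whiskerRight_assoc]

theorem whiskerLeft_swapFactors (A B : V) {C D : V} (f : C ⟶ D) :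
    A ◁ B ◁ f ≫ swapFactors A B D = swapFactors A B C ≫ B ◁ A ◁ f := by
  have h : A ◁ B ◁ f ≫ (α_ A B D).inv = (α_ A B C).inv ≫ (A ⊗ B) ◁ f := by simp
  rw [swapFactors, swapFactors, reassoc_of% h, whisker_exchange_assoc]
  simp

/-- The Yang–Baxter equation with a spectator `C`. It settles the case of `PermRel.pull` in which
both exchanged factors differ from the extracted one. -/
theorem swapFactors_braid (A B I C : V) :
    A ◁ swapFactors B I C ≫ swapFactors A I (B ⊗ C) ≫ I ◁ swapFactors A B C =
      swapFactors A B (I ⊗ C) ≫ B ◁ swapFactors A I C ≫ swapFactors B I (A ⊗ C) := by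
  have h1 : A ◁ swapFactors B I C ≫ swapFactors A I (B ⊗ C) ≫ I ◁ swapFactors A B C =
      𝟙 _ ⊗≫ (A ◁ (β_ B I).hom ⊗≫ (β_ A I).hom ▷ B ⊗≫ I ◁ (β_ A B).hom) ▷ C ⊗≫ 𝟙 _ := by
    simp only [swapFactors]; monoidal
  have h2 : swapFactors A B (I ⊗ C) ≫ B ◁ swapFactors A I C ≫ swapFactors B I (A ⊗ C) =
      𝟙 _ ⊗≫ ((β_ A B).hom ▷ I ⊗≫ B ◁ (β_ A I).hom ⊗≫ (β_ B I).hom ▷ A) ▷ C ⊗≫ 𝟙 _ := by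
    simp only [swapFactors]; monoidal
  rw [h1, h2, BraidedCategory.yang_baxter' A B I]
  monoidal

theorem whiskerLeft_comp_eq_id (A : V) {B C : V} {f : B ⟶ C} {g : C ⟶ B} (h : f ≫ g = 𝟙 B) :
    A ◁ f ≫ A ◁ g = 𝟙 (A ⊗ B) := by
  rw [← MonoidalCategory.whiskerLeft_comp, h, MonoidalCategory.whiskerLeft_id]

theorem isIso_whiskerLeft_comp_swapFactors (A B : V) {C D : V} (p : C ⟶ B ⊗ D) [IsIso p] :
    IsIso (A ◁ p ≫ swapFactors A B D) := by
  have : IsIso (swapFactors A B D) := ⟨_, swapFactors_self _ _ _, swapFactors_self _ _ _⟩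
  infer_instance

theorem whiskerLeft_comp_swapFactors {A B C C' D D' : V} {f : C ⟶ C'} {p : C ⟶ B ⊗ D}
    {p' : C' ⟶ B ⊗ D'} {f' : D ⟶ D'} (h : f ≫ p' = p ≫ B ◁ f') :
    A ◁ f ≫ A ◁ p' ≫ swapFactors A B D' = (A ◁ p ≫ swapFactors A B D) ≫ B ◁ A ◁ f' := by
  rw [← MonoidalCategory.whiskerLeft_comp_assoc, h, MonoidalCategory.whiskerLeft_comp,
    Category.assoc, Category.assoc, whiskerLeft_swapFactors]

theorem swapFactors_comp_whiskerLeft_swapFactors (A B I : V) {C D : V} (p : C ⟶ I ⊗ D) :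
    swapFactors A B C ≫ B ◁ (A ◁ p ≫ swapFactors A I D) ≫ swapFactors B I (A ⊗ D) =
      (A ◁ (B ◁ p ≫ swapFactors B I D) ≫ swapFactors A I (B ⊗ D)) ≫ I ◁ swapFactors A B D := by
  simp only [MonoidalCategory.whiskerLeft_comp, Category.assoc]
  rw [swapFactors_braid, reassoc_of% whiskerLeft_swapFactors]

variable {ι κ : Type*}

/-- The morphisms which permute the factors of a product. -/
inductive PermRel (X : ι → V) : (L L' : List ι) → (listProd X L ⟶ listProd X L') → Prop
  | nil : PermRel X [] [] (𝟙 (𝟙_ V))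
  | cons (a : ι) {L L' : List ι} {f : listProd X L ⟶ listProd X L'} (h : PermRel X L L' f) :
      PermRel X (a :: L) (a :: L') (X a ◁ f)
  | swap (a b : ι) (L : List ι) :
      PermRel X (a :: b :: L) (b :: a :: L) (swapFactors (X a) (X b) (listProd X L))
  | trans {L M N : List ι} {f : listProd X L ⟶ listProd X M} {g : listProd X M ⟶ listProd X N}
      (hf : PermRel X L M f) (hg : PermRel X M N g) : PermRel X L N (f ≫ g)

/-- The morphisms which move the first occurrence of a factor to the front. -/
inductive PullRel (X : ι → V) (i : ι) :
    (L M : List ι) → (listProd X L ⟶ X i ⊗ listProd X M) → Prop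
  | head (L : List ι) : PullRel X i (i :: L) L (𝟙 (X i ⊗ listProd X L))
  | tail {a : ι} (hne : a ≠ i) {L M : List ι} {p : listProd X L ⟶ X i ⊗ listProd X M}
      (h : PullRel X i L M p) :
      PullRel X i (a :: L) (a :: M) (X a ◁ p ≫ swapFactors (X a) (X i) (listProd X M))

variable {X : ι → V}

theorem PermRel.perm {L L' : List ι} {f : listProd X L ⟶ listProd X L'} (h : PermRel X L L' f) :
    L.Perm L' := by
  induction h with
  | nil => exact .nil
  | cons a _ ih => exact .cons a ih
  | swap a b L => exact .swap b a L
  | trans _ _ h1 h2 => exact h1.trans h2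

theorem PermRel.refl (X : ι → V) (L : List ι) : PermRel X L L (𝟙 _) := by
  induction L with
  | nil => exact .nil
  | cons a L ih => simpa using! ih.cons a

theorem PermRel.exists_inv {L L' : List ι} {f : listProd X L ⟶ listProd X L'}
    (h : PermRel X L L' f) : ∃ g, PermRel X L' L g ∧ f ≫ g = 𝟙 _ ∧ g ≫ f = 𝟙 _ := by
  induction h with
  | nil => exact ⟨_, .nil, Category.comp_id (𝟙 (𝟙_ V)), Category.comp_id (𝟙 (𝟙_ V))⟩
  | cons a _ ih =>
    obtain ⟨g, hg, h1, h2⟩ := ih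
    exact ⟨_, hg.cons a, whiskerLeft_comp_eq_id (X a) h1, whiskerLeft_comp_eq_id (X a) h2⟩
  | swap a b L => exact ⟨_, .swap b a L, swapFactors_self _ _ _, swapFactors_self _ _ _⟩
  | trans _ _ h1 h2 =>
    obtain ⟨g1, hg1, e1, e1'⟩ := h1
    obtain ⟨g2, hg2, e2, e2'⟩ := h2
    exact ⟨_, hg2.trans hg1, by simp [reassoc_of% e2, e1], by simp [reassoc_of% e1', e2']⟩

theorem PullRel.isIso {i : ι} {L M : List ι} {p : listProd X L ⟶ X i ⊗ listProd X M}
    (h : PullRel X i L M p) : IsIso p := by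
  induction h with
  | head L => exact IsIso.id (X i ⊗ listProd X L)
  | tail _ _ _ => exact isIso_whiskerLeft_comp_swapFactors _ _ _

/-- At each letter exactly one of `head` and `tail` applies, so there is no choice. The equality is
heterogeneous because the type of `p` contains the remaining list. -/
theorem PullRel.unique {i : ι} {L M M' : List ι} {p : listProd X L ⟶ X i ⊗ listProd X M}
    {p' : listProd X L ⟶ X i ⊗ listProd X M'} (h : PullRel X i L M p) (h' : PullRel X i L M' p') :
    M = M' ∧ p ≍ p' := by
  induction h generalizing M' with
  | head L =>
    cases h' with
    | head => exact ⟨rfl, HEq.rfl⟩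
    | tail hne => exact absurd rfl hne
  | tail hne _ ih =>
    cases h' with
    | head => exact absurd rfl hne
    | tail _ h' =>
      obtain ⟨rfl, h2⟩ := ih h'
      obtain rfl := eq_of_heq h2
      exact ⟨rfl, HEq.rfl⟩

/-- The engine of coherence: a permuting morphism can be pushed past the extraction of a factor `i`,
and what remains is again a permuting morphism, of shorter lists. -/
theorem PermRel.pull {i : ι} {L L' : List ι} {f : listProd X L ⟶ listProd X L'}
    (h : PermRel X L L' f) (hL : L.Nodup) {M : List ι} {p : listProd X L ⟶ X i ⊗ listProd X M}
    (hp : PullRel X i L M p) :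
    ∃ (M' : List ι) (p' : listProd X L' ⟶ X i ⊗ listProd X M')
      (f' : listProd X M ⟶ listProd X M'),
      PullRel X i L' M' p' ∧ PermRel X M M' f' ∧ f ≫ p' = p ≫ X i ◁ f' := by
  induction h generalizing M with
  | nil => cases hp
  | @cons a L L' f hf ih =>
    cases hp with
    | head => exact ⟨_, _, _, .head _, hf, (Category.comp_id _).trans (Category.id_comp (X i ◁ f)).symm⟩
    | tail hne hp =>
      obtain ⟨M', p', f', h1, h2, h3⟩ := ih (List.nodup_cons.1 hL).2 hp
      exact ⟨_, _, _, .tail hne h1, h2.cons a, whiskerLeft_comp_swapFactors h3⟩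
  | swap a b L =>
    -- Distinctness matters here: for `a = b = i` the exchange would change which factor occurs
    -- first, and the square would not commute.
    have hab : b ≠ a := by
      rintro rfl; simp at hL
    cases hp with
    | head =>
      refine ⟨_, _, _, .tail hab (.head _), .refl X _, ?_⟩
      have h : swapFactors (X i) (X b) (listProd X L) ≫
          X b ◁ 𝟙 _ ≫ swapFactors (X b) (X i) (listProd X L) = 𝟙 _ ≫ X i ◁ 𝟙 _ := by
        simp [swapFactors_self]
      exact h
    | tail hne hp =>
      cases hp with
      | head =>
        refine ⟨_, _, _, .head _, .refl X _, ?_⟩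
        have h : swapFactors (X a) (X i) (listProd X L) ≫ 𝟙 _ =
            (X a ◁ 𝟙 _ ≫ swapFactors (X a) (X i) (listProd X L)) ≫ X i ◁ 𝟙 _ := by
          simp
        exact h
      | @tail _ hne' _ M p hp =>
        exact ⟨_, _, _, .tail hne' (.tail hne hp), .swap a b M,
          swapFactors_comp_whiskerLeft_swapFactors _ _ _ p⟩
  | trans hf hg ih1 ih2 =>
    obtain ⟨M', p', f', h1, h2, h3⟩ := ih1 hL hp
    obtain ⟨M'', p'', f'', h1', h2', h3'⟩ := ih2 (hf.perm.nodup_iff.1 hL) h1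
    exact ⟨_, _, _, h1', h2.trans h2', by
      rw [Category.assoc, h3', reassoc_of% h3, MonoidalCategory.whiskerLeft_comp]⟩

theorem PermRel.eq_id_of_nil {L L' : List ι} {f : listProd X L ⟶ listProd X L'}
    (h : PermRel X L L' f) (hL : L = []) : ∃ e : L' = L, f = eqToHom (by rw [e]) := by
  induction h with
  | nil => exact ⟨rfl, rfl⟩
  | cons => cases hL
  | swap => cases hL
  | trans _ _ h1 h2 =>
    subst hL
    obtain ⟨rfl, rfl⟩ := h1 rfl
    obtain ⟨rfl, rfl⟩ := h2 rfl
    exact ⟨rfl, by simp⟩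

/-- Coherence: a permutation of different factors determines a unique morphism. -/
theorem PermRel.unique {L L' : List ι} {f g : listProd X L ⟶ listProd X L'}
    (hf : PermRel X L L' f) (hg : PermRel X L L' g) (hL : L.Nodup) : f = g := by
  induction L generalizing L' with
  | nil =>
    obtain ⟨rfl, rfl⟩ := hf.eq_id_of_nil rfl
    obtain ⟨_, rfl⟩ := hg.eq_id_of_nil rfl
    rfl
  | cons i L ih =>
    -- Pull the head `i` out of both morphisms. The extractions at the target agree by
    -- `PullRel.unique` and are isomorphisms, so they can be cancelled and only the tails remain.
    obtain ⟨M, p, f', h1, h2, h3⟩ := hf.pull hL (.head (i := i) L)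
    obtain ⟨M', p', g', h1', h2', h3'⟩ := hg.pull hL (.head (i := i) L)
    obtain ⟨rfl, h⟩ := h1.unique h1'
    obtain rfl := eq_of_heq h
    have := h1.isIso
    rw [← cancel_mono p, h3, h3', ih h2 h2' (List.nodup_cons.1 hL).2]

end Coherence

/-! ### Labelled objects and canonical morphisms between them. -/

section Labels

variable {V : Type u} [Category.{v} V] [MonoidalCategory V] [SymmetricCategory V] {ι κ : Type*}

/-- Removal of brackets in a product of two products, as an isomorphism. -/
def listProdAppendIso (X : ι → V) (L' : List ι) :
    (L : List ι) → (listProd X L ⊗ listProd X L' ≅ listProd X (L ++ L'))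
  | [] => λ_ _
  | i :: L => α_ (X i) (listProd X L) (listProd X L') ≪≫
      whiskerLeftIso (X i) (listProdAppendIso X L' L)

/-- Conjugation by rebracketing is compatible with a new head factor `A`. This and the next three
lemmas are the inductive steps which show that `PermRel` is stable under whiskering and contains the
associators; `e`, `e'`, `d`, `d'` stand for instances of `listProdAppendIso`. -/
theorem whiskerRight_conj_cons (A : V) {Y Y' Z W W' : V} (e : Y ⊗ Z ≅ W) (e' : Y' ⊗ Z ≅ W')
    (f : Y ⟶ Y') :
    (α_ A Y Z ≪≫ whiskerLeftIso A e).inv ≫ (A ◁ f) ▷ Z ≫ (α_ A Y' Z ≪≫ whiskerLeftIso A e').hom =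
      A ◁ (e.inv ≫ f ▷ Z ≫ e'.hom) := by
  simp

theorem whiskerLeft_conj_cons (A : V) {Y Z Z' W W' : V} (e : Y ⊗ Z ≅ W) (e' : Y ⊗ Z' ≅ W')
    (f : Z ⟶ Z') :
    (α_ A Y Z ≪≫ whiskerLeftIso A e).inv ≫ (A ⊗ Y) ◁ f ≫
        (α_ A Y Z' ≪≫ whiskerLeftIso A e').hom =
      A ◁ (e.inv ≫ Y ◁ f ≫ e'.hom) := by
  simp

theorem whiskerRight_conj_swapFactors (A B : V) {Y Z W : V} (e : Y ⊗ Z ≅ W) :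
    (α_ A (B ⊗ Y) Z ≪≫ whiskerLeftIso A (α_ B Y Z ≪≫ whiskerLeftIso B e)).inv ≫
        swapFactors A B Y ▷ Z ≫
          (α_ B (A ⊗ Y) Z ≪≫ whiskerLeftIso B (α_ A Y Z ≪≫ whiskerLeftIso A e)).hom =
      swapFactors A B W := by
  have h : swapFactors A B Y ▷ Z ≫ (α_ B (A ⊗ Y) Z).hom ≫ B ◁ (α_ A Y Z).hom =
      (α_ A (B ⊗ Y) Z).hom ≫ A ◁ (α_ B Y Z).hom ≫ swapFactors A B (Y ⊗ Z) := by
    simp only [swapFactors]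
    monoidal
  simp only [Iso.trans_hom, Iso.trans_inv, whiskerLeftIso_hom, whiskerLeftIso_inv,
    MonoidalCategory.whiskerLeft_comp, Category.assoc]
  rw [reassoc_of% h, ← whiskerLeft_swapFactors, ← MonoidalCategory.whiskerLeft_comp_assoc,
    ← MonoidalCategory.whiskerLeft_comp_assoc]
  simp

theorem associator_conj_cons (A : V) {Y Z W U : V} {T T' : V} (e : Y ⊗ Z ≅ U) (e' : U ⊗ W ≅ T)
    (d : Z ⊗ W ≅ T') {T'' : V} (d' : Y ⊗ T' ≅ T'') :
    ((α_ A U W ≪≫ whiskerLeftIso A e').inv ≫ (α_ A Y Z ≪≫ whiskerLeftIso A e).inv ▷ W) ≫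
        (α_ (A ⊗ Y) Z W).hom ≫
        ((A ⊗ Y) ◁ d.hom ≫ (α_ A Y T' ≪≫ whiskerLeftIso A d').hom) =
      A ◁ ((e'.inv ≫ e.inv ▷ W) ≫ (α_ Y Z W).hom ≫ (Y ◁ d.hom ≫ d'.hom)) := by
  simp

theorem associator_conj {Y Y' Z Z' W W' U T U' T' : V} (a : Y ≅ Y') (b : Z ≅ Z') (c : W ≅ W')
    (e : Y' ⊗ Z' ≅ U) (e' : U ⊗ W' ≅ T) (d : Z' ⊗ W' ≅ U') (d' : Y' ⊗ U' ≅ T') :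
    ((((a ⊗ᵢ b) ≪≫ e) ⊗ᵢ c) ≪≫ e').inv ≫ (α_ Y Z W).hom ≫
        ((a ⊗ᵢ ((b ⊗ᵢ c) ≪≫ d)) ≪≫ d').hom =
      (e'.inv ≫ e.inv ▷ W') ≫ (α_ Y' Z' W').hom ≫ (Y' ◁ d.hom ≫ d'.hom) := by
  have h1 : (e.inv ≫ (a.inv ⊗ₘ b.inv)) ⊗ₘ c.inv =
      e.inv ▷ W' ≫ ((a.inv ⊗ₘ b.inv) ⊗ₘ c.inv) := by
    rw [← tensorHom_id, tensorHom_comp_tensorHom, Category.id_comp]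
  have h2 : a.hom ⊗ₘ ((b.hom ⊗ₘ c.hom) ≫ d.hom) =
      (a.hom ⊗ₘ b.hom ⊗ₘ c.hom) ≫ Y' ◁ d.hom := by
    simp [← id_tensorHom]
  simp only [Iso.trans_inv, Iso.trans_hom, tensorIso_hom, tensorIso_inv, Category.assoc, h1, h2,
    associator_naturality_assoc]
  simp

variable {X : ι → V}

theorem PermRel.of_eq {L L' : List ι} {f g : listProd X L ⟶ listProd X L'} (h : PermRel X L L' f)
    (e : g = f) : PermRel X L L' g :=
  e ▸ h

theorem PermRel.whiskerRight {L L' : List ι} {f : listProd X L ⟶ listProd X L'}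
    (h : PermRel X L L' f) (M : List ι) : PermRel X (L ++ M) (L' ++ M)
      ((listProdAppendIso X M L).inv ≫ f ▷ listProd X M ≫ (listProdAppendIso X M L').hom) := by
  induction h with
  | nil =>
    have h : (λ_ (listProd X M)).inv ≫ 𝟙 (𝟙_ V) ▷ listProd X M ≫ (λ_ _).hom = 𝟙 _ := by simp
    exact h ▸ PermRel.refl X M
  | cons a _ ih => exact (whiskerRight_conj_cons (X a) _ _ _).symm ▸ ih.cons a
  | swap a b L =>
    exact (whiskerRight_conj_swapFactors (X a) (X b) (listProdAppendIso X M L)).symm ▸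
      PermRel.swap a b (L ++ M)
  | trans _ _ h1 h2 => simpa using h1.trans h2

theorem PermRel.whiskerLeft {M M' : List ι} {f : listProd X M ⟶ listProd X M'}
    (h : PermRel X M M' f) (L : List ι) : PermRel X (L ++ M) (L ++ M')
      ((listProdAppendIso X M L).inv ≫ listProd X L ◁ f ≫ (listProdAppendIso X M' L).hom) := by
  induction L with
  | nil =>
    have e : (λ_ (listProd X M)).inv ≫ 𝟙_ V ◁ f ≫ (λ_ _).hom = f := by simp
    exact e.symm ▸ h
  | cons a L ih => exact (whiskerLeft_conj_cons (X a) _ _ _).symm ▸ ih.cons a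

theorem PermRel.associator (X : ι → V) (L M N : List ι) : PermRel X (L ++ M ++ N) (L ++ (M ++ N))
    (((listProdAppendIso X N (L ++ M)).inv ≫ (listProdAppendIso X M L).inv ▷ listProd X N) ≫
      (α_ _ _ _).hom ≫
      (listProd X L ◁ (listProdAppendIso X N M).hom ≫ (listProdAppendIso X (M ++ N) L).hom)) := by
  induction L with
  | nil =>
    have e : ((listProdAppendIso X N M).inv ≫ (λ_ (listProd X M)).inv ▷ listProd X N) ≫
        (α_ _ _ _).hom ≫ (𝟙_ V ◁ (listProdAppendIso X N M).hom ≫ (λ_ _).hom) = 𝟙 _ := by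
      simp
    exact e.symm ▸ PermRel.refl X (M ++ N)
  | cons a L ih => exact (associator_conj_cons (X a) _ _ _ _).symm ▸ ih.cons a

/-- A description of an object as a product of members of the family `X`, in some order. -/
structure Lab (X : ι → V) (Y : V) where
  letters : List ι
  iso : Y ≅ listProd X letters

namespace Lab

/-- The tensor unit is the product of no factors. -/
def unit (X : ι → V) : Lab X (𝟙_ V) := ⟨[], Iso.refl (𝟙_ V)⟩

/-- A single factor. -/
def single {Y : V} (i : ι) (h : Y = X i) : Lab X Y :=
  ⟨[i], eqToIso h ≪≫ (ρ_ (X i)).symm⟩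

/-- The product of a list of factors. -/
def self (X : ι → V) (L : List ι) : Lab X (listProd X L) := ⟨L, Iso.refl _⟩

/-- The description of the tensor product of two objects. -/
def tensor {Y Z : V} (a : Lab X Y) (b : Lab X Z) : Lab X (Y ⊗ Z) :=
  ⟨a.letters ++ b.letters, (a.iso ⊗ᵢ b.iso) ≪≫ listProdAppendIso X b.letters a.letters⟩

/-- The description of the tensor product of a family of objects. -/
def list {F : κ → V} (a : ∀ j, Lab X (F j)) : (K : List κ) → Lab X (listProd F K)
  | [] => unit X
  | j :: K => tensor (a j) (list a K)

/-- The description of the tensor product of a family of objects indexed by an ordinal. -/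
def tprod {k : ℕ} {F : Fin k → V} (a : ∀ j, Lab X (F j)) : Lab X (tprod F) :=
  list a (List.finRange k)

theorem letters_list {F : κ → V} (a : ∀ j, Lab X (F j)) (K : List κ) :
    (list a K).letters = K.flatMap fun j => (a j).letters := by
  induction K with
  | nil => rfl
  | cons j K ih => exact congrArg ((a j).letters ++ ·) ih

end Lab

/-- The morphisms between described objects which permute the factors in the way that the
descriptions prescribe. -/
def IsCan {Y Z : V} (a : Lab X Y) (b : Lab X Z) (f : Y ⟶ Z) : Prop :=
  PermRel X a.letters b.letters (a.iso.inv ≫ f ≫ b.iso.hom)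

namespace IsCan

/-- The working form of coherence: an equation between symmetries follows once both sides are seen
to be canonical for labels without repetition. This is how `regroup_unit_left`, `regroup_reindex`
and `tprodSymm_mul` are obtained. -/
theorem ext {Y Z : V} {a : Lab X Y} {b : Lab X Z} {f g : Y ⟶ Z} (hb : b.letters.Nodup)
    (hf : IsCan a b f) (hg : IsCan a b g) : f = g := by
  have := PermRel.unique hf hg (hf.perm.nodup_iff.2 hb)
  simpa using this

theorem id {Y : V} (a : Lab X Y) : IsCan a a (𝟙 Y) := by
  simpa [IsCan] using PermRel.refl X a.letters

theorem comp {Y Z W : V} {a : Lab X Y} {b : Lab X Z} {c : Lab X W} {f : Y ⟶ Z} {g : Z ⟶ W}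
    (hf : IsCan a b f) (hg : IsCan b c g) : IsCan a c (f ≫ g) := by
  simpa [IsCan] using PermRel.trans hf hg

theorem exists_inv {Y Z : V} {a : Lab X Y} {b : Lab X Z} {f : Y ⟶ Z} (hf : IsCan a b f) :
    ∃ g, IsCan b a g ∧ f ≫ g = 𝟙 Y ∧ g ≫ f = 𝟙 Z := by
  obtain ⟨g, h1, h2, h3⟩ := PermRel.exists_inv hf
  refine ⟨b.iso.hom ≫ g ≫ a.iso.inv, by simpa [IsCan] using h1, ?_, ?_⟩
  · rw [← cancel_epi a.iso.inv, ← cancel_mono a.iso.hom]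
    simpa using h2
  · have e : f = a.iso.hom ≫ (a.iso.inv ≫ f ≫ b.iso.hom) ≫ b.iso.inv := by simp
    rw [e]
    simp only [Category.assoc, Iso.inv_hom_id_assoc] at h3 ⊢
    rw [reassoc_of% h3]
    simp

theorem isIso {Y Z : V} {a : Lab X Y} {b : Lab X Z} {f : Y ⟶ Z} (hf : IsCan a b f) : IsIso f := by
  obtain ⟨g, -, h2, h3⟩ := hf.exists_inv
  exact ⟨g, h2, h3⟩

theorem inv {Y Z : V} {a : Lab X Y} {b : Lab X Z} {f : Y ⟶ Z} (hf : IsCan a b f) [IsIso f] :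
    IsCan b a (inv f) := by
  obtain ⟨g, h1, h2, h3⟩ := hf.exists_inv
  rwa [IsIso.inv_eq_of_hom_inv_id h2]

theorem iso_inv {Y Z : V} {a : Lab X Y} {b : Lab X Z} {f : Y ≅ Z} (hf : IsCan a b f.hom) :
    IsCan b a f.inv := by
  simpa using hf.inv

theorem self_iso {Y : V} (a : Lab X Y) : IsCan a (Lab.self X a.letters) a.iso.hom := by
  simpa [IsCan, Lab.self] using PermRel.refl X a.letters

theorem single_eqToHom {Y Z : V} {i i' : ι} (hi : i = i') (h : Y = X i) (h' : Z = X i')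
    (e : Y = Z) : IsCan (Lab.single i h) (Lab.single i' h') (eqToHom e) := by
  subst hi
  subst h
  subst h'
  exact id _

theorem whiskerRight {Y Y' Z : V} {a : Lab X Y} {a' : Lab X Y'} {f : Y ⟶ Y'} (hf : IsCan a a' f)
    (b : Lab X Z) : IsCan (a.tensor b) (a'.tensor b) (f ▷ Z) := by
  have := PermRel.whiskerRight hf b.letters
  have e : (a.tensor b).iso.inv ≫ f ▷ Z ≫ (a'.tensor b).iso.hom =
      (listProdAppendIso X b.letters a.letters).inv ≫
        (a.iso.inv ≫ f ≫ a'.iso.hom) ▷ listProd X b.letters ≫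
          (listProdAppendIso X b.letters a'.letters).hom := by
    simp [Lab.tensor, ← tensorHom_id]
  rw [IsCan, e]
  exact this

theorem whiskerLeft {Y Z Z' : V} (a : Lab X Y) {b : Lab X Z} {b' : Lab X Z'} {f : Z ⟶ Z'}
    (hf : IsCan b b' f) : IsCan (a.tensor b) (a.tensor b') (Y ◁ f) := by
  have := PermRel.whiskerLeft hf a.letters
  have e : (a.tensor b).iso.inv ≫ Y ◁ f ≫ (a.tensor b').iso.hom =
      (listProdAppendIso X b.letters a.letters).inv ≫
        listProd X a.letters ◁ (b.iso.inv ≫ f ≫ b'.iso.hom) ≫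
          (listProdAppendIso X b'.letters a.letters).hom := by
    simp [Lab.tensor, ← id_tensorHom]
  rw [IsCan, e]
  exact this

theorem tensor {Y Y' Z Z' : V} {a : Lab X Y} {a' : Lab X Y'} {b : Lab X Z} {b' : Lab X Z'}
    {f : Y ⟶ Y'} {g : Z ⟶ Z'} (hf : IsCan a a' f) (hg : IsCan b b' g) :
    IsCan (a.tensor b) (a'.tensor b') (f ⊗ₘ g) := by
  rw [MonoidalCategory.tensorHom_def]
  exact (hf.whiskerRight b).comp (hg.whiskerLeft a')

theorem associator {Y Z W : V} (a : Lab X Y) (b : Lab X Z) (c : Lab X W) :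
    IsCan ((a.tensor b).tensor c) (a.tensor (b.tensor c)) (α_ Y Z W).hom := by
  have := PermRel.associator X a.letters b.letters c.letters
  have e : ((a.tensor b).tensor c).iso.inv ≫ (α_ Y Z W).hom ≫ (a.tensor (b.tensor c)).iso.hom =
      ((listProdAppendIso X c.letters (a.letters ++ b.letters)).inv ≫
        (listProdAppendIso X b.letters a.letters).inv ▷ listProd X c.letters) ≫
      (α_ _ _ _).hom ≫ (listProd X a.letters ◁ (listProdAppendIso X c.letters b.letters).hom ≫
        (listProdAppendIso X (b.letters ++ c.letters) a.letters).hom) := by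
    exact associator_conj a.iso b.iso c.iso _ _ _ _
  rw [IsCan, e]
  exact this

theorem leftUnitor {Y : V} (a : Lab X Y) : IsCan ((Lab.unit X).tensor a) a (λ_ Y).hom := by
  have e : ((Lab.unit X).tensor a).iso.inv ≫ (λ_ Y).hom ≫ a.iso.hom = 𝟙 _ := by
    have : ((λ_ (listProd X a.letters)).inv ≫ (𝟙 (𝟙_ V) ⊗ₘ a.iso.inv)) ≫ (λ_ Y).hom ≫ a.iso.hom =
      𝟙 _ := by simp
    exact this
  rw [IsCan, e]
  exact PermRel.refl X a.letters

theorem rightUnitor_conj_cons (A : V) {Y W : V} (e : Y ⊗ 𝟙_ V ≅ W) :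
    ((α_ A Y (𝟙_ V) ≪≫ whiskerLeftIso A e).inv ≫ (𝟙 (A ⊗ Y) ⊗ₘ 𝟙 (𝟙_ V))) ≫
        (ρ_ (A ⊗ Y)).hom ≫ 𝟙 (A ⊗ Y) =
      A ◁ ((e.inv ≫ (𝟙 Y ⊗ₘ 𝟙 (𝟙_ V))) ≫ (ρ_ Y).hom ≫ 𝟙 Y) := by
  simp

theorem rightUnitor_self (X : ι → V) (L : List ι) :
    IsCan ((Lab.self X L).tensor (Lab.unit X)) (Lab.self X L) (ρ_ (listProd X L)).hom := by
  induction L with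
  | nil =>
    have e : ((λ_ (𝟙_ V)).inv ≫ (𝟙 (𝟙_ V) ⊗ₘ 𝟙 (𝟙_ V))) ≫ (ρ_ (𝟙_ V)).hom ≫ 𝟙 (𝟙_ V) =
      𝟙 _ := by
      rw [← unitors_equal]
      simp
    exact (PermRel.refl X []).of_eq e
  | cons a L ih =>
    exact (PermRel.cons a ih).of_eq (rightUnitor_conj_cons (X a) (listProdAppendIso X [] L))

theorem rightUnitor {Y : V} (a : Lab X Y) : IsCan (a.tensor (Lab.unit X)) a (ρ_ Y).hom := by
  have e : (ρ_ Y).hom = a.iso.hom ▷ 𝟙_ V ≫ (ρ_ _).hom ≫ a.iso.inv := by simp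
  rw [e]
  exact ((self_iso a).whiskerRight _).comp ((rightUnitor_self X a.letters).comp
    (self_iso a).iso_inv)

theorem self_cons (X : ι → V) (a : ι) (L : List ι) :
    IsCan (Lab.self X (a :: L)) ((Lab.single a rfl).tensor (Lab.self X L))
      (𝟙 (X a ⊗ listProd X L)) := by
  have e : 𝟙 _ ≫ 𝟙 (X a ⊗ listProd X L) ≫ ((𝟙 _ ≫ (ρ_ (X a)).inv) ⊗ₘ 𝟙 (listProd X L)) ≫
      (α_ _ _ _).hom ≫ X a ◁ (λ_ _).hom = 𝟙 _ := by simp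
  exact (PermRel.refl X (a :: L)).of_eq e

theorem braiding_single (X : ι → V) (a b : ι) :
    IsCan ((Lab.single (X := X) a rfl).tensor (Lab.single b rfl))
      ((Lab.single b rfl).tensor (Lab.single a rfl)) (β_ (X a) (X b)).hom := by
  have e : ((((α_ (X a) (𝟙_ V) (X b ⊗ 𝟙_ V)) ≪≫ whiskerLeftIso (X a) (λ_ _)).inv) ≫
      (((ρ_ (X a)).hom ≫ 𝟙 _) ⊗ₘ ((ρ_ (X b)).hom ≫ 𝟙 _))) ≫ (β_ (X a) (X b)).hom ≫
      ((𝟙 _ ≫ (ρ_ (X b)).inv) ⊗ₘ (𝟙 _ ≫ (ρ_ (X a)).inv)) ≫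
      (α_ (X b) (𝟙_ V) (X a ⊗ 𝟙_ V) ≪≫ whiskerLeftIso (X b) (λ_ _)).hom =
      swapFactors (X a) (X b) (𝟙_ V) := by
    simp only [swapFactors, Category.comp_id, Category.id_comp, Iso.trans_inv, Iso.trans_hom,
      whiskerLeftIso_inv, whiskerLeftIso_hom, Category.assoc]
    monoidal
  exact (PermRel.swap a b []).of_eq e

theorem braiding_unit {Y : V} (a : Lab X Y) :
    IsCan (a.tensor (Lab.unit X)) ((Lab.unit X).tensor a) (β_ Y (𝟙_ V)).hom := by
  rw [braiding_tensorUnit_right]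
  exact (rightUnitor a).comp (leftUnitor a).iso_inv

theorem braiding_unit_left {Y : V} (a : Lab X Y) :
    IsCan ((Lab.unit X).tensor a) (a.tensor (Lab.unit X)) (β_ (𝟙_ V) Y).hom := by
  rw [braiding_tensorUnit_left]
  exact (leftUnitor a).comp (rightUnitor a).iso_inv

theorem braiding_tensor_right {Y Z W : V} {a : Lab X Y} {b : Lab X Z} {c : Lab X W}
    (h1 : IsCan (a.tensor b) (b.tensor a) (β_ Y Z).hom)
    (h2 : IsCan (a.tensor c) (c.tensor a) (β_ Y W).hom) :
    IsCan (a.tensor (b.tensor c)) ((b.tensor c).tensor a) (β_ Y (Z ⊗ W)).hom := by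
  rw [BraidedCategory.braiding_tensor_right_hom]
  exact (associator a b c).iso_inv.comp ((h1.whiskerRight c).comp ((associator b a c).comp
    ((h2.whiskerLeft b).comp (associator b c a).iso_inv)))

theorem braiding_tensor_left {Y Z W : V} {a : Lab X Y} {b : Lab X Z} {c : Lab X W}
    (h1 : IsCan (a.tensor c) (c.tensor a) (β_ Y W).hom)
    (h2 : IsCan (b.tensor c) (c.tensor b) (β_ Z W).hom) :
    IsCan ((a.tensor b).tensor c) (c.tensor (a.tensor b)) (β_ (Y ⊗ Z) W).hom := by
  rw [BraidedCategory.braiding_tensor_left_hom]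
  exact (associator a b c).comp ((h2.whiskerLeft a).comp ((associator a c b).iso_inv.comp
    ((h1.whiskerRight b).comp (associator c a b))))

theorem braiding_congr {Y Y' Z Z' : V} {a : Lab X Y} {a' : Lab X Y'} {b : Lab X Z} {b' : Lab X Z'}
    {f : Y ≅ Y'} {g : Z ≅ Z'} (hf : IsCan a a' f.hom) (hg : IsCan b b' g.hom)
    (h : IsCan (a'.tensor b') (b'.tensor a') (β_ Y' Z').hom) :
    IsCan (a.tensor b) (b.tensor a) (β_ Y Z).hom := by
  have e : (β_ Y Z).hom = (f.hom ⊗ₘ g.hom) ≫ (β_ Y' Z').hom ≫ (g.inv ⊗ₘ f.inv) := by simp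
  rw [e]
  exact (hf.tensor hg).comp (h.comp (hg.iso_inv.tensor hf.iso_inv))

/-- After replacing both objects by the products of their letters, the hexagon identities reduce the
claim, by induction on the two lists, to the exchange of two letters and to braidings with the unit.
-/
theorem braiding {Y Z : V} (a : Lab X Y) (b : Lab X Z) :
    IsCan (a.tensor b) (b.tensor a) (β_ Y Z).hom := by
  refine braiding_congr (self_iso a) (self_iso b) ?_
  generalize a.letters = L
  generalize b.letters = M
  have h1 : ∀ (i : ι), IsCan ((Lab.single i rfl).tensor (Lab.self X M))
      ((Lab.self X M).tensor (Lab.single i rfl)) (β_ (X i) (listProd X M)).hom := by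
    intro i
    induction M with
    | nil => exact braiding_unit _
    | cons j M ih =>
      exact braiding_congr (f := Iso.refl _) (g := Iso.refl (X j ⊗ listProd X M)) (id _)
        (self_cons X j M) (braiding_tensor_right (braiding_single X i j) ih)
  induction L with
  | nil => exact braiding_unit_left _
  | cons i L ih =>
    exact braiding_congr (f := Iso.refl (X i ⊗ listProd X L)) (g := Iso.refl _)
      (self_cons X i L) (id _) (braiding_tensor_left (h1 i) ih)

end IsCan

end Labels

/-! ### The structural morphisms of finite tensor products: canonicity and naturality. -/

section Structural

variable {V : Type u} [Category.{v} V] [MonoidalCategory V] [SymmetricCategory V] {ι κ θ : Type*}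
  {X : ι → V}

namespace IsCan

theorem eqToHom_of_heq {Y Z : V} {a : Lab X Y} {b : Lab X Z} (h : Y = Z) (hab : a ≍ b) :
    IsCan a b (eqToHom h) := by
  subst h
  obtain rfl := eq_of_heq hab
  exact id a

theorem listProdMap {F G : κ → V} {a : ∀ j, Lab X (F j)} {b : ∀ j, Lab X (G j)}
    {f : ∀ j, F j ⟶ G j} (h : ∀ j, IsCan (a j) (b j) (f j)) (K : List κ) :
    IsCan (.list a K) (.list b K) (listProdMap f K) := by
  induction K with
  | nil => exact id _
  | cons j K ih => exact (h j).tensor ih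

theorem listProdReindex {F : κ → V} (a : ∀ j, Lab X (F j)) (g : θ → κ) (L : List θ) :
    IsCan (.list (fun j => a (g j)) L) (.list a (L.map g)) (listProdReindex F g L).hom := by
  induction L with
  | nil => exact id _
  | cons j L ih => exact ih.whiskerLeft (a (g j))

theorem listProdAppend {F : κ → V} (a : ∀ j, Lab X (F j)) (L' L : List κ) :
    IsCan ((Lab.list a L).tensor (.list a L')) (.list a (L ++ L')) (listProdAppend F L' L) := by
  induction L with
  | nil => exact leftUnitor _
  | cons j L ih => exact (associator _ _ _).comp (ih.whiskerLeft (a j))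

theorem listProdFlatten {F : κ → V} (a : ∀ j, Lab X (F j)) (L : θ → List κ) (K : List θ) :
    IsCan (.list (fun j => .list a (L j)) K) (.list a (K.flatMap L)) (listProdFlatten F L K) := by
  induction K with
  | nil => exact id _
  | cons j K ih => exact (ih.whiskerLeft _).comp (listProdAppend a _ _)

theorem tensorμ {Y Z Y' Z' : V} (a : Lab X Y) (b : Lab X Z) (a' : Lab X Y') (b' : Lab X Z') :
    IsCan ((a.tensor b).tensor (a'.tensor b')) ((a.tensor a').tensor (b.tensor b'))
      (tensorμ Y Z Y' Z') :=
  (associator _ _ _).comp (((associator _ _ _).iso_inv.whiskerLeft a).comp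
    ((((braiding _ _).whiskerRight b').whiskerLeft a).comp
      (((associator _ _ _).whiskerLeft a).comp (associator _ _ _).iso_inv)))

theorem listProdUnzip {F G : κ → V} (a : ∀ j, Lab X (F j)) (b : ∀ j, Lab X (G j)) (K : List κ) :
    IsCan (.list (fun j => (a j).tensor (b j)) K) ((Lab.list a K).tensor (.list b K))
      (listProdUnzip F G K) := by
  induction K with
  | nil => exact (leftUnitor _).iso_inv
  | cons j K ih => exact (ih.whiskerLeft _).comp (tensorμ _ _ _ _)

theorem listProdUnit {F : κ → V} (a : ∀ j, Lab X (F j)) {e : ∀ j, 𝟙_ V ⟶ F j}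
    (h : ∀ j, IsCan (.unit X) (a j) (e j)) (K : List κ) :
    IsCan (.unit X) (.list a K) (listProdUnit e K) := by
  induction K with
  | nil => exact id _
  | cons j K ih => exact (leftUnitor _).iso_inv.comp ((h j).tensor ih)

theorem listProdPull [DecidableEq κ] {F : κ → V} (a : ∀ j, Lab X (F j)) (i : κ) (L : List κ)
    (h : i ∈ L) :
    IsCan (.list a L) ((a i).tensor (.list a (L.erase i))) (listProdPull F i L h) := by
  induction L with
  | nil => exact absurd h List.not_mem_nil
  | cons j L ih =>
    unfold TwoOperads.listProdPull
    split_ifs with hji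
    · subst hji
      refine eqToHom_of_heq _ ?_
      rw [List.erase_cons_head]
      rfl
    · refine ((ih _).whiskerLeft (a j)).comp ((associator _ _ _).iso_inv.comp
        (((braiding _ _).whiskerRight _).comp ((associator _ _ _).comp (whiskerLeft _ ?_))))
      refine eqToHom_of_heq _ ?_
      rw [List.erase_cons_tail (by simpa using hji)]
      rfl

theorem listProdPerm [DecidableEq κ] {F : κ → V} (a : ∀ j, Lab X (F j)) (L' L : List κ)
    (h : L.Perm L') : IsCan (.list a L) (.list a L') (listProdPerm F L' L h) := by
  induction L' generalizing L with
  | nil =>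
    refine eqToHom_of_heq _ ?_
    rw [List.Perm.eq_nil h]
  | cons i L' ih => exact (listProdPull a i L _).comp ((ih _ _).whiskerLeft (a i))

theorem tprodMap {k : ℕ} {F G : Fin k → V} {a : ∀ j, Lab X (F j)} {b : ∀ j, Lab X (G j)}
    {f : ∀ j, F j ⟶ G j} (h : ∀ j, IsCan (a j) (b j) (f j)) :
    IsCan (.tprod a) (.tprod b) (tprodMap f) :=
  listProdMap h _

theorem tprodUnit {k : ℕ} {F : Fin k → V} (a : ∀ j, Lab X (F j)) {e : ∀ j, 𝟙_ V ⟶ F j}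
    (h : ∀ j, IsCan (.unit X) (a j) (e j)) : IsCan (.unit X) (.tprod a) (tprodUnit e) :=
  listProdUnit a h _

theorem tprodOne {F : Fin 1 → V} (a : ∀ j, Lab X (F j)) :
    IsCan (a 0) (.tprod a) (tprodOne F) :=
  (rightUnitor (a 0)).iso_inv

theorem tprodSymm {k : ℕ} (π : Equiv.Perm (Fin k)) {F : Fin k → V} (a : ∀ j, Lab X (F j)) :
    IsCan (.tprod a) (.tprod fun i => a (π i)) (tprodSymm π F) :=
  (listProdPerm a _ _ _).comp (listProdReindex a π _).iso_inv

theorem tprodFibres {l k : ℕ} (g : Fin l → Fin k) {F : Fin l → V} (a : ∀ j, Lab X (F j)) :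
    IsCan (.tprod fun i => .tprod fun j => a (fibEmb g i j)) (.tprod a) (tprodFibres g F) :=
  (tprodMap fun i => listProdReindex a (fibEmb g i) _).comp
    ((listProdFlatten a _ _).comp (listProdPerm a _ _ _))

theorem regroup {l k : ℕ} (g : Fin l → Fin k) {R : V} {P : Fin k → V} {F : Fin l → V}
    (r : Lab X R) (p : ∀ i, Lab X (P i)) (a : ∀ j, Lab X (F j)) :
    IsCan (r.tensor (.tprod fun i => (p i).tensor (.tprod fun j => a (fibEmb g i j))))
      ((r.tensor (.tprod p)).tensor (.tprod a)) (regroup g R P F) :=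
  (((listProdUnzip p _ _).comp ((tprodFibres g a).whiskerLeft _)).whiskerLeft r).comp
    (associator _ _ _).iso_inv

end IsCan

/-! ### Naturality -/

theorem comp_square {A A' B B' C C' : V} {x : A ⟶ A'} {y : B ⟶ B'} {z : C ⟶ C'} {b : A' ⟶ B'}
    {b' : B' ⟶ C'} {c : A ⟶ B} {c' : B ⟶ C} (h : x ≫ b = c ≫ y) (h' : y ≫ b' = c' ≫ z) :
    x ≫ b ≫ b' = (c ≫ c') ≫ z := by
  rw [reassoc_of% h, h', Category.assoc]

section Naturality

variable {F G : κ → V}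

theorem listProdMap_reindex (f : ∀ j, F j ⟶ G j) (g : θ → κ) (L : List θ) :
    listProdMap (fun j => f (g j)) L ≫ (listProdReindex G g L).hom =
      (listProdReindex F g L).hom ≫ listProdMap f (L.map g) := by
  induction L with
  | nil => rfl
  | cons j L ih =>
    have h : (f (g j) ⊗ₘ listProdMap (fun j => f (g j)) L) ≫
        G (g j) ◁ (listProdReindex G g L).hom =
        F (g j) ◁ (listProdReindex F g L).hom ≫ (f (g j) ⊗ₘ listProdMap f (L.map g)) := by
      rw [← id_tensorHom, ← id_tensorHom, tensorHom_comp_tensorHom, ih, tensorHom_comp_tensorHom]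
      simp
    exact h

theorem listProdMap_append (f : ∀ j, F j ⟶ G j) (L' L : List κ) :
    (listProdMap f L ⊗ₘ listProdMap f L') ≫ listProdAppend G L' L =
      listProdAppend F L' L ≫ listProdMap f (L ++ L') := by
  induction L with
  | nil => 
    have h : (𝟙 (𝟙_ V) ⊗ₘ listProdMap f L') ≫ (λ_ (listProd G L')).hom =
        (λ_ (listProd F L')).hom ≫ listProdMap f L' := by simp
    exact h
  | cons j L ih =>
    have h : ((f j ⊗ₘ listProdMap f L) ⊗ₘ listProdMap f L') ≫
        (α_ (G j) (listProd G L) (listProd G L')).hom ≫ G j ◁ listProdAppend G L' L =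
        ((α_ (F j) (listProd F L) (listProd F L')).hom ≫ F j ◁ listProdAppend F L' L) ≫
          (f j ⊗ₘ listProdMap f (L ++ L')) := by
      rw [associator_naturality_assoc, ← id_tensorHom, ← id_tensorHom, tensorHom_comp_tensorHom,
        ih, Category.assoc, tensorHom_comp_tensorHom]
      simp
    exact h

theorem listProdMap_flatten (f : ∀ j, F j ⟶ G j) (L : θ → List κ) (K : List θ) :
    listProdMap (fun j => listProdMap f (L j)) K ≫ listProdFlatten G L K =
      listProdFlatten F L K ≫ listProdMap f (K.flatMap L) := by
  induction K with
  | nil => rfl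
  | cons j K ih =>
    have h : (listProdMap f (L j) ⊗ₘ listProdMap (fun j => listProdMap f (L j)) K) ≫
        listProd G (L j) ◁ listProdFlatten G L K ≫ listProdAppend G (K.flatMap L) (L j) =
        (listProd F (L j) ◁ listProdFlatten F L K ≫ listProdAppend F (K.flatMap L) (L j)) ≫
          listProdMap f (L j ++ K.flatMap L) := by
      rw [Category.assoc, ← listProdMap_append, ← id_tensorHom, ← id_tensorHom,
        tensorHom_comp_tensorHom_assoc, ih, tensorHom_comp_tensorHom_assoc]
      simp
    exact h

theorem listProdMap_unzip {F' G' : κ → V} (f : ∀ j, F j ⟶ G j) (f' : ∀ j, F' j ⟶ G' j)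
    (L : List κ) :
    listProdMap (fun j => f j ⊗ₘ f' j) L ≫ listProdUnzip G G' L =
      listProdUnzip F F' L ≫ (listProdMap f L ⊗ₘ listProdMap f' L) := by
  induction L with
  | nil =>
    have h : 𝟙 (𝟙_ V) ≫ (λ_ (𝟙_ V)).inv = (λ_ (𝟙_ V)).inv ≫ (𝟙 (𝟙_ V) ⊗ₘ 𝟙 (𝟙_ V)) := by simp
    exact h
  | cons j L ih =>
    have h : ((f j ⊗ₘ f' j) ⊗ₘ listProdMap (fun j => f j ⊗ₘ f' j) L) ≫
        (G j ⊗ G' j) ◁ listProdUnzip G G' L ≫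
          tensorμ (G j) (G' j) (listProd G L) (listProd G' L) =
        ((F j ⊗ F' j) ◁ listProdUnzip F F' L ≫
          tensorμ (F j) (F' j) (listProd F L) (listProd F' L)) ≫
          ((f j ⊗ₘ listProdMap f L) ⊗ₘ (f' j ⊗ₘ listProdMap f' L)) := by
      rw [Category.assoc, ← tensorμ_natural, ← id_tensorHom, ← id_tensorHom,
        tensorHom_comp_tensorHom_assoc, ih, tensorHom_comp_tensorHom_assoc]
      simp
    exact h

theorem listProdMap_eqToHom (f : ∀ j, F j ⟶ G j) {L L' : List κ} (h : L = L') :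
    listProdMap f L ≫ eqToHom (congrArg (listProd G) h) =
      eqToHom (congrArg (listProd F) h) ≫ listProdMap f L' := by
  subst h
  simp

theorem listProdMap_pull [DecidableEq κ] (f : ∀ j, F j ⟶ G j) (i : κ) (L : List κ) (hi : i ∈ L) :
    listProdMap f L ≫ listProdPull G i L hi =
      listProdPull F i L hi ≫ (f i ⊗ₘ listProdMap f (L.erase i)) := by
  induction L with
  | nil => exact absurd hi List.not_mem_nil
  | cons j L ih =>
    unfold listProdPull
    split_ifs with hji
    · subst hji
      -- The erased list becomes a variable `M`, so that substitution turns the `eqToHom` into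
      -- identities.
      have h : ∀ (M : List κ) (hM : L = M) (e : F j ⊗ listProd F L = F j ⊗ listProd F M)
          (e' : G j ⊗ listProd G L = G j ⊗ listProd G M),
          (f j ⊗ₘ listProdMap f L) ≫ eqToHom e' = eqToHom e ≫ (f j ⊗ₘ listProdMap f M) := by
        rintro M rfl e e'
        simp
      exact h _ (by rw [List.erase_cons_head]) _ _
    · have h : ∀ (M : List κ) (hM : j :: L.erase i = M) (e : F j ⊗ listProd F (L.erase i) = listProd F M)
          (e' : G j ⊗ listProd G (L.erase i) = listProd G M) (hi' : i ∈ L),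
          (f j ⊗ₘ listProdMap f L) ≫ G j ◁ listProdPull G i L hi' ≫
            (α_ (G j) (G i) (listProd G (L.erase i))).inv ≫
            (β_ (G j) (G i)).hom ▷ listProd G (L.erase i) ≫
            (α_ (G i) (G j) (listProd G (L.erase i))).hom ≫ G i ◁ eqToHom e' =
          (F j ◁ listProdPull F i L hi' ≫
            (α_ (F j) (F i) (listProd F (L.erase i))).inv ≫
            (β_ (F j) (F i)).hom ▷ listProd F (L.erase i) ≫
            (α_ (F i) (F j) (listProd F (L.erase i))).hom ≫ F i ◁ eqToHom e) ≫
            (f i ⊗ₘ listProdMap f M) := by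
        rintro M rfl e e' hi'
        have h1 : (f j ⊗ₘ listProdMap f L) ≫ G j ◁ listProdPull G i L hi' =
            F j ◁ listProdPull F i L hi' ≫ (f j ⊗ₘ (f i ⊗ₘ listProdMap f (L.erase i))) := by
          rw [← id_tensorHom, ← id_tensorHom, tensorHom_comp_tensorHom, ih,
            tensorHom_comp_tensorHom]
          simp
        have h2 : ((f j ⊗ₘ f i) ⊗ₘ listProdMap f (L.erase i)) ≫
            (β_ (G j) (G i)).hom ▷ listProd G (L.erase i) =
            (β_ (F j) (F i)).hom ▷ listProd F (L.erase i) ≫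
              ((f i ⊗ₘ f j) ⊗ₘ listProdMap f (L.erase i)) := by
          rw [← tensorHom_id, ← tensorHom_id, tensorHom_comp_tensorHom,
            BraidedCategory.braiding_naturality, tensorHom_comp_tensorHom]
          simp
        rw [reassoc_of% h1, associator_inv_naturality_assoc, reassoc_of% h2,
          associator_naturality_assoc]
        simp only [Category.assoc]
        congr 4
        exact (by simp : (f i ⊗ₘ (f j ⊗ₘ listProdMap f (L.erase i))) ≫ G i ◁ 𝟙 _ =
          F i ◁ 𝟙 _ ≫ (f i ⊗ₘ (f j ⊗ₘ listProdMap f (L.erase i))))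
      exact h _ (List.erase_cons_tail (by simpa using hji)).symm _ _ _

theorem listProdMap_perm [DecidableEq κ] (f : ∀ j, F j ⟶ G j) (L' L : List κ) (hL : L.Perm L') :
    listProdMap f L ≫ listProdPerm G L' L hL = listProdPerm F L' L hL ≫ listProdMap f L' := by
  induction L' generalizing L with
  | nil => exact listProdMap_eqToHom f (List.Perm.eq_nil hL)
  | cons i L' ih =>
    have h : ∀ (hi : i ∈ L) (hL' : (L.erase i).Perm L'),
        listProdMap f L ≫ listProdPull G i L hi ≫ G i ◁ listProdPerm G L' (L.erase i) hL' =
        (listProdPull F i L hi ≫ F i ◁ listProdPerm F L' (L.erase i) hL') ≫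
          (f i ⊗ₘ listProdMap f L') := by
      intro hi hL'
      rw [reassoc_of% listProdMap_pull, Category.assoc, ← id_tensorHom, ← id_tensorHom,
        tensorHom_comp_tensorHom, ih, tensorHom_comp_tensorHom]
      simp
    exact h _ _

theorem listProdUnit_map {e : ∀ j, 𝟙_ V ⟶ F j} (f : ∀ j, F j ⟶ G j) (L : List κ) :
    listProdUnit e L ≫ listProdMap f L = listProdUnit (fun j => e j ≫ f j) L := by
  induction L with
  | nil => exact Category.comp_id (𝟙 (𝟙_ V))
  | cons j L ih =>
    have h : ((λ_ (𝟙_ V)).inv ≫ (e j ⊗ₘ listProdUnit e L)) ≫ (f j ⊗ₘ listProdMap f L) =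
        (λ_ (𝟙_ V)).inv ≫ ((e j ≫ f j) ⊗ₘ listProdUnit (fun j => e j ≫ f j) L) := by
      rw [Category.assoc, tensorHom_comp_tensorHom, ih]
    exact h

end Naturality

theorem tprodUnit_map {k : ℕ} {F G : Fin k → V} {e : ∀ j, 𝟙_ V ⟶ F j} (f : ∀ j, F j ⟶ G j) :
    tprodUnit e ≫ tprodMap f = tprodUnit fun j => e j ≫ f j :=
  listProdUnit_map f _

theorem tprodMap_fibres {l k : ℕ} (g : Fin l → Fin k) {F G : Fin l → V} (f : ∀ j, F j ⟶ G j) :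
    tprodMap (fun i => tprodMap fun j => f (fibEmb g i j)) ≫ tprodFibres g G =
      tprodFibres g F ≫ tprodMap f := by
  have h1 : tprodMap (fun i => listProdMap (fun j => f (fibEmb g i j))
        (List.finRange (fibCard g i))) ≫
      tprodMap (fun i =>
        (listProdReindex G (fibEmb g i) (List.finRange (fibCard g i))).hom) =
      tprodMap (fun i => (listProdReindex F (fibEmb g i) (List.finRange (fibCard g i))).hom) ≫
        tprodMap fun i => listProdMap f ((List.finRange (fibCard g i)).map (fibEmb g i)) := by
    rw [← tprodMap_comp, ← tprodMap_comp]
    exact congrArg tprodMap (funext fun i => listProdMap_reindex f _ _)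
  exact comp_square h1 (comp_square (listProdMap_flatten f _ _) (listProdMap_perm f _ _ _))

theorem whiskerLeft_square {R R' A B C D : V} (r : R ⟶ R') {a : A ⟶ B} {b : B ⟶ D} {c : A ⟶ C}
    {d : C ⟶ D} (h : a ≫ b = c ≫ d) : (r ⊗ₘ a) ≫ R' ◁ b = R ◁ c ≫ (r ⊗ₘ d) := by
  rw [← id_tensorHom, ← id_tensorHom, tensorHom_comp_tensorHom, h, tensorHom_comp_tensorHom]
  simp

theorem regroup_naturality {l k : ℕ} (g : Fin l → Fin k) {R R' : V} {P P' : Fin k → V}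
    {F F' : Fin l → V} (r : R ⟶ R') (p : ∀ i, P i ⟶ P' i) (f : ∀ j, F j ⟶ F' j) :
    (r ⊗ₘ tprodMap fun i => p i ⊗ₘ tprodMap fun j => f (fibEmb g i j)) ≫ regroup g R' P' F' =
      regroup g R P F ≫ ((r ⊗ₘ tprodMap p) ⊗ₘ tprodMap f) := by
  have h1 : tprodMap (fun i => p i ⊗ₘ tprodMap fun j => f (fibEmb g i j)) ≫
      listProdUnzip P' (fun i => tprod fun j => F' (fibEmb g i j)) (List.finRange k) =
      listProdUnzip P (fun i => tprod fun j => F (fibEmb g i j)) (List.finRange k) ≫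
        (tprodMap p ⊗ₘ tprodMap fun i => tprodMap fun j => f (fibEmb g i j)) :=
    listProdMap_unzip _ _ _
  exact comp_square (whiskerLeft_square r (comp_square h1 (whiskerLeft_square _
    (tprodMap_fibres g f)))) (associator_inv_naturality _ _ _)

end Structural

/-! ### Insertion of units into a regrouped product. -/

section Units

variable {V : Type u} [Category.{v} V] [MonoidalCategory V] [SymmetricCategory V]

theorem Lab.letters_tprod_single {ι : Type*} {X : ι → V} {k : ℕ} {F : Fin k → V} (e : Fin k → ι)
    (h : ∀ i, F i = X (e i)) :
    (Lab.tprod fun i => Lab.single (e i) (h i)).letters = (List.finRange k).map e := by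
  rw [Lab.tprod, Lab.letters_list]
  exact List.flatMap_pure_eq_map e _

theorem Lab.nodup_tprod_single {ι : Type*} {X : ι → V} {k : ℕ} {F : Fin k → V} {e : Fin k → ι}
    (he : Function.Injective e) (h : ∀ i, F i = X (e i)) :
    (Lab.tprod fun i => Lab.single (e i) (h i)).letters.Nodup := by
  rw [Lab.letters_tprod_single]
  exact (List.nodup_finRange k).map he

theorem Lab.letters_tprod_unit {ι : Type*} {X : ι → V} {k : ℕ} :
    (Lab.tprod fun _ : Fin k => Lab.unit X).letters = [] := by
  rw [Lab.tprod, Lab.letters_list]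
  simp [Lab.unit]

/-- Insertion of units in the innermost factors. -/
theorem regroup_unit_right {l k : ℕ} (g : Fin l → Fin k) (R : V) (P : Fin k → V) {F : Fin l → V}
    (e : ∀ j, 𝟙_ V ⟶ F j) :
    R ◁ tprodMap (fun i => (ρ_ (P i)).inv ≫ P i ◁ tprodUnit fun j => e (fibEmb g i j)) ≫
        regroup g R P F =
      (ρ_ (R ⊗ tprod P)).inv ≫ (R ⊗ tprod P) ◁ tprodUnit e := by
  -- Coherence is applied with `𝟙_ V` in place of every `F j`, so that only `R` and the `P i` carry
  -- letters; the maps `e j` are put in afterwards by `regroup_naturality`.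
  let X : Option (Fin k) → V := fun o => o.elim R P
  let r : Lab X R := .single none rfl
  let p : ∀ i, Lab X (P i) := fun i => .single (some i) rfl
  have h1 : IsCan (r.tensor (.tprod p)) ((r.tensor (.tprod p)).tensor (.tprod fun _ => .unit X))
      (R ◁ tprodMap (fun i => (ρ_ (P i)).inv ≫ P i ◁ tprodUnit fun _ => 𝟙 (𝟙_ V)) ≫
        regroup g R P fun _ => 𝟙_ V) :=
    ((IsCan.tprodMap fun i => (IsCan.rightUnitor (p i)).iso_inv.comp
      ((IsCan.tprodUnit (fun _ => .unit X) fun _ => .id _).whiskerLeft (p i))).whiskerLeft r).comp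
      (IsCan.regroup g r p fun _ => .unit X)
  have h2 : IsCan (r.tensor (.tprod p)) ((r.tensor (.tprod p)).tensor (.tprod fun _ => .unit X))
      ((ρ_ (R ⊗ tprod P)).inv ≫ (R ⊗ tprod P) ◁ tprodUnit fun _ : Fin l => 𝟙 (𝟙_ V)) :=
    (IsCan.rightUnitor _).iso_inv.comp
      ((IsCan.tprodUnit (fun _ => .unit X) fun _ => .id _).whiskerLeft _)
  have hn : ((r.tensor (.tprod p)).tensor (.tprod fun _ : Fin l => .unit X)).letters.Nodup := by
    change ([none] ++ (Lab.tprod p).letters ++ (Lab.tprod fun _ : Fin l => .unit X).letters).Nodup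
    rw [Lab.letters_tprod_unit,
      show (Lab.tprod p).letters = _ from Lab.letters_tprod_single some fun _ => rfl]
    simpa using (List.nodup_finRange k).map (Option.some_injective _)
  have key := IsCan.ext hn h1 h2
  have e1 : R ◁ tprodMap (fun i => (ρ_ (P i)).inv ≫ P i ◁ tprodUnit fun j => e (fibEmb g i j)) =
      R ◁ tprodMap (fun i => (ρ_ (P i)).inv ≫ P i ◁ tprodUnit fun _ => 𝟙 (𝟙_ V)) ≫
        (𝟙 R ⊗ₘ tprodMap fun i => 𝟙 (P i) ⊗ₘ tprodMap fun j => e (fibEmb g i j)) := by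
    rw [← id_tensorHom, ← id_tensorHom, tensorHom_comp_tensorHom, ← tprodMap_comp]
    simp only [id_tensorHom, Category.assoc, ← MonoidalCategory.whiskerLeft_comp, tprodUnit_map,
      Category.id_comp]
  rw [e1, Category.assoc, regroup_naturality, reassoc_of% key, tprodMap_id, id_tensorHom_id,
    id_tensorHom, ← MonoidalCategory.whiskerLeft_comp, tprodUnit_map]
  simp only [Category.id_comp]

/-- Insertion of units in the outer factors. -/
theorem regroup_unit_left {l k : ℕ} (g : Fin l → Fin k) (R : V) {P Y : Fin k → V} {F : Fin l → V}
    (e : ∀ j, 𝟙_ V ⟶ P j) (t : ∀ i, Y i ⟶ tprod fun j => F (fibEmb g i j)) :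
    R ◁ tprodMap (fun i => (λ_ (Y i)).inv ≫ e i ▷ Y i ≫ P i ◁ t i) ≫ regroup g R P F =
      R ◁ (tprodMap t ≫ tprodFibres g F) ≫ ((ρ_ R).inv ≫ R ◁ tprodUnit e) ▷ tprod F := by
  -- Now the outer factors `P i` are replaced by units, and the letters belong to `R` and the `F j`;
  -- `t` is split off first and `e` is put in by naturality.
  let X : Option (Fin l) → V := fun o => o.elim R F
  let r : Lab X R := .single none rfl
  let f : ∀ i, Lab X (F i) := fun i => .single (some i) rfl
  have h1 : IsCan (r.tensor (.tprod fun i => .tprod fun j => f (fibEmb g i j)))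
      ((r.tensor (.tprod fun _ => .unit X)).tensor (.tprod f))
      (R ◁ tprodMap (fun i => (λ_ (tprod fun j => F (fibEmb g i j))).inv) ≫
        regroup g R (fun _ => 𝟙_ V) F) :=
    ((IsCan.tprodMap fun i => (IsCan.leftUnitor _).iso_inv).whiskerLeft r).comp
      (IsCan.regroup g r (fun _ => .unit X) f)
  have h2 : IsCan (r.tensor (.tprod fun i => .tprod fun j => f (fibEmb g i j)))
      ((r.tensor (.tprod fun _ => .unit X)).tensor (.tprod f))
      (R ◁ tprodFibres g F ≫ ((ρ_ R).inv ≫ R ◁ tprodUnit fun _ : Fin k => 𝟙 (𝟙_ V)) ▷ tprod F) :=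
    ((IsCan.tprodFibres g f).whiskerLeft r).comp (((IsCan.rightUnitor r).iso_inv.comp
      ((IsCan.tprodUnit (fun _ => .unit X) fun _ => .id _).whiskerLeft r)).whiskerRight _)
  have hn : ((r.tensor (.tprod fun _ : Fin k => .unit X)).tensor (.tprod f)).letters.Nodup := by
    change ([none] ++ (Lab.tprod fun _ : Fin k => .unit X).letters ++ (Lab.tprod f).letters).Nodup
    rw [Lab.letters_tprod_unit,
      show (Lab.tprod f).letters = _ from Lab.letters_tprod_single some fun _ => rfl]
    simpa using (List.nodup_finRange l).map (Option.some_injective _)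
  have key := IsCan.ext hn h1 h2
  have e1 : R ◁ tprodMap (fun i => (λ_ (Y i)).inv ≫ e i ▷ Y i ≫ P i ◁ t i) =
      R ◁ tprodMap t ≫ R ◁ tprodMap (fun i => (λ_ (tprod fun j => F (fibEmb g i j))).inv) ≫
        (𝟙 R ⊗ₘ tprodMap fun i => e i ⊗ₘ tprodMap fun j => 𝟙 (F (fibEmb g i j))) := by
    rw [id_tensorHom, ← MonoidalCategory.whiskerLeft_comp, ← MonoidalCategory.whiskerLeft_comp,
      ← tprodMap_comp, ← tprodMap_comp]
    congr 2
    funext i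
    rw [tprodMap_id, ← whisker_exchange]
    simp
  rw [e1, Category.assoc, Category.assoc,
    regroup_naturality g (𝟙 R) e fun j => 𝟙 (F j), reassoc_of% key,
    MonoidalCategory.whiskerLeft_comp, Category.assoc, tprodMap_id, tensorHom_id, id_tensorHom,
    ← comp_whiskerRight, Category.assoc, ← MonoidalCategory.whiskerLeft_comp, tprodUnit_map]
  simp only [Category.id_comp]

end Units

/-! ### Quasibijections: change of the source and of the base of a multiplication. -/

section Quasibijections

open NOrdinal

variable {V : Type u} [Category.{v} V] [MonoidalCategory V] [SymmetricCategory V] {d : ℕ}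

theorem fibMap_bijective {n l k : ℕ} {f : Fin n → Fin l} {g : Fin l → Fin k} {h : Fin n → Fin k}
    (c : ∀ x, h x = g (f x)) (hf : Function.Bijective f) (i : Fin k) :
    Function.Bijective (fibMap c i) := by
  constructor
  · intro x y hxy
    have := congrArg (fibEmb g i) hxy
    rw [fibEmb_fibMap, fibEmb_fibMap] at this
    exact (fibEmb h i).injective (hf.1 this)
  · intro y
    obtain ⟨x, hx⟩ := hf.2 (fibEmb g i y)
    obtain ⟨z, rfl⟩ := exists_fibEmb_eq h (i := i) (x := x) (by rw [c, hx, map_fibEmb g])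
    exact ⟨z, (fibEmb g i).injective (by rw [fibEmb_fibMap, hx])⟩

theorem NOrdinal.isQuasibijection_fibreMap {T S R : NOrdinal d} {σ : T ⟶ S}
    (h : IsQuasibijection σ) (ω : S ⟶ R) (i : Fin R.card) :
    IsQuasibijection (fibreMap σ ω i) :=
  fibMap_bijective (fn_comp_apply σ ω) h i

theorem NOrdinal.isQuasibijection_comp {T S R : NOrdinal d} {σ : T ⟶ S} {ω : S ⟶ R}
    (h : IsQuasibijection σ) (h' : IsQuasibijection ω) : IsQuasibijection (σ ≫ ω) :=
  Function.Bijective.comp (g := fn ω) (f := fn σ) h' h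

/-- Associativity for `σ ≫ ω` with units in all fibres of `σ`. By `regroup_unit_right` the units
move next to the inner multiplications, which thereby become the morphisms of the quasibijections
`σ_i`. -/
theorem NOperad.mul_quasi (A : NOperad d V) {T S R : NOrdinal d} (σ : T ⟶ S) (ω : S ⟶ R)
    (h : IsQuasibijection σ) :
    A.mul ω ≫ A.quasi σ h =
      A.obj R ◁ tprodMap (fun i =>
        A.quasi (fibreMap σ ω i) (isQuasibijection_fibreMap h ω i)) ≫ A.mul (σ ≫ ω) := by
  have e := regroup_unit_right (fn ω) (A.obj R) (fun i => A.obj (fibre ω i)) (fun j =>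
    A.unit ≫ eqToHom (congrArg A.obj (fibre_of_isQuasibijection h j).symm))
  have e1 : A.mul ω ≫ A.quasi σ h = (ρ_ (A.obj R ⊗ tprod fun i => A.obj (fibre ω i))).inv ≫
      (A.obj R ⊗ tprod fun i => A.obj (fibre ω i)) ◁ tprodUnit (fun j =>
        A.unit ≫ eqToHom (congrArg A.obj (fibre_of_isQuasibijection h j).symm)) ≫
      A.mul ω ▷ tprod (fun j => A.obj (fibre σ j)) ≫ A.mul σ := by
    rw [NOperadData.quasi, whisker_exchange_assoc]
    simp
  rw [e1, ← reassoc_of% e, A.assoc, ← MonoidalCategory.whiskerLeft_comp_assoc, ← tprodMap_comp]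
  congr 3
  funext i
  rw [NOperadData.quasi, Category.assoc, ← MonoidalCategory.whiskerLeft_comp_assoc, tprodUnit_map]
  congr 4
  funext j
  simp

/-- The case of `mul_quasi` in which `ω` is a quasibijection as well: all fibres are points, and the
inner quasibijections act trivially. -/
theorem NOperad.quasi_comp (A : NOperad d V) {T S R : NOrdinal d} (σ : T ⟶ S) (ω : S ⟶ R)
    (h : IsQuasibijection σ) (h' : IsQuasibijection ω) :
    A.quasi (σ ≫ ω) (isQuasibijection_comp h h') = A.quasi ω h' ≫ A.quasi σ h := by
  -- A quasibijection between one-point ordinals acts as the identity, by `mul_unit`. Fibres are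
  -- only propositionally equal to `terminal d`, hence the `eqToHom`.
  have hn : ∀ {T S : NOrdinal d} (σ : T ⟶ S) (h : IsQuasibijection σ), T = terminal d → S = terminal d →
      ∀ (e : S = T), A.quasi σ h = eqToHom (congrArg A.obj e) := by
    rintro T _ σ h rfl rfl e
    obtain rfl : σ = 𝟙 _ := NOrdinal.Hom.ext (funext fun x => Subsingleton.elim (α := Fin 1) _ _)
    exact A.mul_unit _
  have e1 : A.quasi ω h' ≫ A.quasi σ h = (ρ_ _).inv ≫ A.obj R ◁ tprodUnit (fun i => A.unit ≫
      eqToHom (congrArg A.obj (fibre_of_isQuasibijection h' i).symm)) ≫ A.mul ω ≫ A.quasi σ h := by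
    rw [NOperadData.quasi]
    simp
  rw [e1, A.mul_quasi, ← MonoidalCategory.whiskerLeft_comp_assoc, tprodUnit_map,
    NOperadData.quasi]
  congr 5
  funext i
  rw [hn _ _ (fibre_of_isQuasibijection (isQuasibijection_comp h h') i)
    (fibre_of_isQuasibijection h' i) ((fibre_of_isQuasibijection h' i).trans
      (fibre_of_isQuasibijection (isQuasibijection_comp h h') i).symm)]
  simp

/-- The left unit axiom for a target which equals the terminal ordinal only propositionally. Of the
identification `t` nothing is kept but its canonicity, which is what coherence needs. -/
theorem NOperad.exists_unit_mul (A : NOperad d V) {ι : Type*} {X : ι → V} {T S : NOrdinal d}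
    (τ : T ⟶ S) (hS : S = terminal d) (x : ι) (h : A.obj T = X x)
    (h' : ∀ j, A.obj (fibre τ j) = X x) :
    ∃ t : A.obj T ⟶ tprod (fun j => A.obj (fibre τ j)),
      IsCan (.single x h) (.tprod fun j => .single x (h' j)) t ∧
        (λ_ (A.obj T)).inv ≫ (A.unit ≫ eqToHom (congrArg A.obj hS.symm)) ▷ A.obj T ≫
          A.obj S ◁ t ≫ A.mul τ = 𝟙 _ := by
  subst hS
  refine ⟨eqToHom (congrArg A.obj (fibre_terminal τ (0 : Fin 1)).symm) ≫
    tprodOne (fun i => A.obj (fibre τ i)), ?_, ?_⟩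
  · exact (IsCan.single_eqToHom rfl h (h' _) _).comp
      (IsCan.tprodOne fun j => Lab.single x (h' j))
  · simpa using A.unit_mul τ

theorem NOrdinal.fibre_comp_of_isQuasibijection {T S R : NOrdinal d} (σ : T ⟶ S) {ω : S ⟶ R}
    (h : IsQuasibijection ω) {i : Fin R.card} {j : Fin S.card} (hj : fn ω j = i) :
    fibre (σ ≫ ω) i = fibre σ j := by
  refine T.restrict_eq ?_
  rw [range_fibEmb, range_fibEmb]
  subst hj
  ext x
  exact h.1.eq_iff

/-- Multiplication after the change of the base by a quasibijection `ω`; here `w` is the inverse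
of `ω`, and `s` is the canonical symmetry. -/
theorem NOperad.quasi_mul (A : NOperad d V) {T S R : NOrdinal d} (σ : T ⟶ S) (ω : S ⟶ R)
    (h : IsQuasibijection ω) {w : Fin R.card → Fin S.card} (hw : ∀ i, fn ω (w i) = i)
    {s : tprod (fun i => A.obj (fibre (σ ≫ ω) i)) ⟶ tprod (fun j => A.obj (fibre σ j))}
    (hs : IsCan (X := fun j => A.obj (fibre σ j))
      (.tprod fun i => .single (w i)
        (congrArg A.obj (fibre_comp_of_isQuasibijection σ h (hw i))))
      (.tprod fun j => .single j rfl) s) :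
    A.obj R ◁ s ≫ A.quasi ω h ▷ _ ≫ A.mul σ = A.mul (σ ≫ ω) := by
  have hj : ∀ i (j : Fin (fibre ω i).card), fibEmb (fn ω) i j = w i := fun i j =>
    h.1 ((map_fibEmb (fn ω) i j).trans (hw i).symm)
  choose t ht1 ht2 using fun i => A.exists_unit_mul (X := fun j => A.obj (fibre σ j))
    (fibreMap σ ω i) (fibre_of_isQuasibijection h i) (w i)
    (congrArg A.obj (fibre_comp_of_isQuasibijection σ h (hw i)))
    (fun j => congrArg A.obj ((fibre_fibreMap σ ω i j).trans (congrArg (fibre σ) (hj i j))))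
  have e := regroup_unit_left (fn ω) (A.obj R) (F := fun j => A.obj (fibre σ j))
    (fun i => A.unit ≫ eqToHom (congrArg A.obj (fibre_of_isQuasibijection h i).symm))
    (fun i => t i ≫ tprodMap fun j => eqToHom (congrArg A.obj (fibre_fibreMap σ ω i j)))
  -- As `s` is determined by its labels, it may be replaced by the composite that occurs in
  -- `regroup_unit_left`.
  have hs' : s = tprodMap (fun i => t i ≫ tprodMap fun j =>
      eqToHom (congrArg A.obj (fibre_fibreMap σ ω i j))) ≫
        tprodFibres (fn ω) (fun j => A.obj (fibre σ j)) := by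
    refine IsCan.ext (Lab.nodup_tprod_single Function.injective_id _) hs ?_
    exact (IsCan.tprodMap fun i => (ht1 i).comp (IsCan.tprodMap fun j =>
      IsCan.single_eqToHom (hj i j).symm _ rfl _)).comp
      (IsCan.tprodFibres (fn ω) fun j => Lab.single j rfl)
  have e2 : A.quasi ω h ▷ tprod (fun j => A.obj (fibre σ j)) =
      ((ρ_ (A.obj R)).inv ≫ A.obj R ◁ tprodUnit (fun i => A.unit ≫
        eqToHom (congrArg A.obj (fibre_of_isQuasibijection h i).symm))) ▷ _ ≫ A.mul ω ▷ _ := by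
    rw [NOperadData.quasi, ← comp_whiskerRight, Category.assoc]
  rw [hs', e2, Category.assoc, ← reassoc_of% e, A.assoc, ← MonoidalCategory.whiskerLeft_comp_assoc,
    ← tprodMap_comp]
  -- The fibres of `ω` are points, so the left unit axiom collapses each inner multiplication.
  have e3 : ∀ i, ((λ_ (A.obj (fibre (σ ≫ ω) i))).inv ≫
      (A.unit ≫ eqToHom (congrArg A.obj (fibre_of_isQuasibijection h i).symm)) ▷
        A.obj (fibre (σ ≫ ω) i) ≫ A.obj (fibre ω i) ◁ (t i ≫ tprodMap fun j =>
          eqToHom (congrArg A.obj (fibre_fibreMap σ ω i j)))) ≫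
      A.obj (fibre ω i) ◁ tprodMap (fun j =>
        eqToHom (congrArg A.obj (fibre_fibreMap σ ω i j).symm)) ≫ A.mul (fibreMap σ ω i) =
      𝟙 _ := by
    intro i
    rw [← ht2 i, Category.assoc, Category.assoc, ← MonoidalCategory.whiskerLeft_comp_assoc,
      Category.assoc, ← tprodMap_comp]
    simp [tprodMap_id]
  simp only [e3, tprodMap_id]
  simp

end Quasibijections

/-! ## Positive permutation braids -/

section PositiveBraids

variable {n : ℕ}

theorem val_adjSwap (i : Fin (n - 1)) (x : Fin n) : (adjSwap i x).val =
    if x.val = i.val then i.val + 1 else if x.val = i.val + 1 then i.val else x := by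
  rw [adjSwap, Equiv.swap_apply_def]
  simp only [Fin.ext_iff]
  split_ifs <;> rfl

/-- The values of a permutation at the places `i` and `i + 1` are in the right order. -/
def IsAscent (w : Equiv.Perm (Fin n)) (i : Fin (n - 1)) : Prop :=
  w ⟨i.val, by omega⟩ < w ⟨i.val + 1, by omega⟩

theorem isAscent_mul_adjSwap {w : Equiv.Perm (Fin n)} {i : Fin (n - 1)} :
    IsAscent (w * adjSwap i) i ↔ w ⟨i.val + 1, by omega⟩ < w ⟨i.val, by omega⟩ := by
  rw [IsAscent, Equiv.Perm.mul_apply, Equiv.Perm.mul_apply]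
  exact iff_of_eq (congrArg₂ (fun x y => w x < w y) (adjSwap_left i.2) (adjSwap_right i.2))

theorem isAscent_mul_adjSwap' {w : Equiv.Perm (Fin n)} {i : Fin (n - 1)} :
    IsAscent (w * adjSwap i) i ↔ ¬ IsAscent w i := by
  rw [isAscent_mul_adjSwap, lt_iff_le_and_ne]
  exact (and_iff_left fun h => by simpa using congrArg Fin.val (w.injective h)).trans not_lt.symm

/-- Exchanging the values at an ascent lowers the sum by `w (i + 1) - w i`. The sum serves as a
substitute for the length: it goes down whenever a reduced word grows by a letter. -/
theorem sum_mul_adjSwap_lt {w : Equiv.Perm (Fin n)} {i : Fin (n - 1)} (h : IsAscent w i) :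
    ∑ a, a.val * ((w * adjSwap i) a).val < ∑ a, a.val * (w a).val := by
  have h1 : ∑ a, a.val * ((w * adjSwap i) a).val = ∑ a, (adjSwap i a).val * (w a).val := by
    rw [← Equiv.sum_comp (adjSwap i)]
    refine Finset.sum_congr rfl fun a _ => ?_
    rw [← Equiv.Perm.mul_apply, mul_assoc, adjSwap_mul_self, mul_one]
  rw [h1]
  zify
  rw [← sub_pos, ← Finset.sum_sub_distrib, Fintype.sum_eq_add (⟨i.val, by omega⟩ : Fin n)
    ⟨i.val + 1, by omega⟩ (by simp)]
  · have e1 := adjSwap_left i.2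
    have e2 := adjSwap_right i.2
    rw [show adjSwap i ⟨i.val, _⟩ = _ from e1, show adjSwap i ⟨i.val + 1, _⟩ = _ from e2]
    have : (w ⟨i.val, by omega⟩).val < (w ⟨i.val + 1, by omega⟩).val := h
    push_cast
    zify at this
    linarith
  · rintro a ⟨ha, ha'⟩
    have : adjSwap i a = a := Equiv.swap_apply_of_ne_of_ne ha ha'
    rw [this, sub_self]

/-- A crude bound, needed so that the truncated subtraction in the induction measure `n * (n * n) -
∑ a, a * w a` loses nothing. -/
theorem sum_mul_perm_le (w : Equiv.Perm (Fin n)) : ∑ a, a.val * (w a).val ≤ n * (n * n) := by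
  refine (Finset.sum_le_card_nsmul _ _ (n * n) fun a _ => ?_).trans (by simp)
  exact Nat.mul_le_mul a.2.le (w a).2.le

theorem eq_one_of_isAscent {w : Equiv.Perm (Fin n)} (h : ∀ i, IsAscent w i) : w = 1 := by
  cases n with
  | zero => exact Subsingleton.elim _ _
  | succ n =>
    have hw : StrictMono w := Fin.strictMono_iff_lt_succ.2 fun i => h i
    have : w.toOrderIso hw.monotone (fun x y hxy => by
        have := hw.le_iff_le (a := w.symm x) (b := w.symm y)
        simpa [hxy] using this) = OrderIso.refl _ := Subsingleton.elim _ _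
    ext x
    exact congrArg (fun e : Fin (n + 1) ≃o Fin (n + 1) => (e x).val) this

/-- Induction on reduced words of a permutation. -/
theorem ascent_induction {p : Equiv.Perm (Fin n) → Prop} (one : p 1)
    (mul : ∀ w i, IsAscent w i → p w → p (w * adjSwap i)) (w : Equiv.Perm (Fin n)) : p w := by
  induction hN : n * (n * n) - ∑ a, a.val * (w a).val using Nat.strong_induction_on
    generalizing w with
  | _ N ih =>
    by_cases h : ∀ i, IsAscent w i
    · exact eq_one_of_isAscent h ▸ one
    · push Not at h
      obtain ⟨i, hi⟩ := h
      have h1 := isAscent_mul_adjSwap'.2 hi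
      have h2 := sum_mul_adjSwap_lt h1
      rw [mul_assoc, adjSwap_mul_self, mul_one] at h2
      have h3 := sum_mul_perm_le (w * adjSwap i)
      have := mul _ _ h1 (ih _ (by omega) _ rfl)
      rwa [mul_assoc, adjSwap_mul_self, mul_one] at this

/-- The braids given by the reduced words of a permutation. -/
inductive PosLift : Equiv.Perm (Fin n) → BraidGroup n → Prop
  | one : PosLift 1 1
  | mul {w : Equiv.Perm (Fin n)} {b : BraidGroup n} (i : Fin (n - 1)) (hi : IsAscent w i)
      (h : PosLift w b) : PosLift (w * adjSwap i) (b * PresentedGroup.of i)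

theorem PosLift.exists (w : Equiv.Perm (Fin n)) : ∃ b, PosLift w b := by
  induction w using ascent_induction with
  | one => exact ⟨_, .one⟩
  | mul w i hi ih => exact ⟨_, .mul i hi ih.choose_spec⟩

theorem braidGroup_braid {i j : Fin (n - 1)} (h : i.val + 1 = j.val) :
    (PresentedGroup.of i * PresentedGroup.of j * PresentedGroup.of i : BraidGroup n) =
      PresentedGroup.of j * PresentedGroup.of i * PresentedGroup.of j := by
  have := PresentedGroup.one_of_mem (rels := {r | ArtinRel n r}) (ArtinRel.braid i j h)
  rwa [map_mul, map_inv, mul_inv_eq_one, map_mul, map_mul, map_mul, map_mul] at this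

theorem braidGroup_comm {i j : Fin (n - 1)} (h : i.val + 1 < j.val) :
    (PresentedGroup.of i * PresentedGroup.of j : BraidGroup n) =
      PresentedGroup.of j * PresentedGroup.of i := by
  have := PresentedGroup.one_of_mem (rels := {r | ArtinRel n r}) (ArtinRel.comm i j h)
  rwa [map_mul, map_inv, mul_inv_eq_one, map_mul, map_mul] at this

theorem isAscent_mul_of_far {w : Equiv.Perm (Fin n)} {i j : Fin (n - 1)}
    (h : i.val + 1 < j.val ∨ j.val + 1 < i.val) : IsAscent (w * adjSwap i) j ↔ IsAscent w j := by
  rw [IsAscent, IsAscent, Equiv.Perm.mul_apply, Equiv.Perm.mul_apply]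
  exact iff_of_eq (congrArg₂ (fun x y => w x < w y)
    (adjSwap_ne i.2 (by omega) (by omega) (by omega))
    (adjSwap_ne i.2 (by omega) (by omega) (by omega)))

/-- Two descents of a permutation are the ends of two reduced words that differ by one of Artin's
relations. -/
theorem PosLift.exists_common {w : Equiv.Perm (Fin n)} {i j : Fin (n - 1)} (hij : i.val < j.val)
    (hi : IsAscent (w * adjSwap i) i) (hj : IsAscent (w * adjSwap j) j) :
    ∃ b b' : BraidGroup n, PosLift (w * adjSwap i) b ∧ PosLift (w * adjSwap j) b' ∧
      b * PresentedGroup.of i = b' * PresentedGroup.of j := by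
  rcases Nat.lt_or_ge (i.val + 1) j.val with h | h
  · obtain ⟨c, hc⟩ := PosLift.exists (w * adjSwap i * adjSwap j)
    have e1 : w * adjSwap i * adjSwap j * adjSwap j = w * adjSwap i := by
      rw [mul_assoc, adjSwap_mul_self, mul_one]
    have e2 : w * adjSwap i * adjSwap j * adjSwap i = w * adjSwap j := by
      rw [mul_assoc w, adjSwap_comm i j h, ← mul_assoc, mul_assoc, adjSwap_mul_self, mul_one]
    have h1 : IsAscent (w * adjSwap i * adjSwap j) j := by
      rw [isAscent_mul_adjSwap', isAscent_mul_of_far (Or.inl h), ← isAscent_mul_adjSwap']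
      exact hj
    have h2 : IsAscent (w * adjSwap i * adjSwap j) i := by
      rw [isAscent_mul_of_far (Or.inr h)]
      exact hi
    refine ⟨_, _, e1 ▸ hc.mul j h1, e2 ▸ hc.mul i h2, ?_⟩
    rw [mul_assoc, mul_assoc, braidGroup_comm h]
  · have h : i.val + 1 = j.val := by omega
    -- The values of `w` at `i`, `i + 1`, `i + 2` decrease, so `w` ends in the longest permutation
    -- of these three places. It is stripped off and rebuilt along each of its two reduced words.
    obtain ⟨c, hc⟩ := PosLift.exists (w * adjSwap i * adjSwap j * adjSwap i)
    obtain ⟨i, hi'⟩ := i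
    obtain ⟨j, hj'⟩ := j
    simp only at h
    subst h
    rw [isAscent_mul_adjSwap] at hi hj
    simp only at hi hj
    set s := adjSwap (⟨i, hi'⟩ : Fin (n - 1))
    set t := adjSwap (⟨i + 1, hj'⟩ : Fin (n - 1))
    have s0 : s ⟨i, by omega⟩ = ⟨i + 1, by omega⟩ := adjSwap_left hi'
    have s1 : s ⟨i + 1, by omega⟩ = ⟨i, by omega⟩ := adjSwap_right hi'
    have s2 : s ⟨i + 1 + 1, by omega⟩ = ⟨i + 1 + 1, by omega⟩ :=
      adjSwap_ne hi' (by omega) (by omega) (by omega)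
    have t0 : t ⟨i, by omega⟩ = ⟨i, by omega⟩ := adjSwap_ne hj' (by omega) (by omega) (by omega)
    have t1 : t ⟨i + 1, by omega⟩ = ⟨i + 1 + 1, by omega⟩ := adjSwap_left hj'
    have t2 : t ⟨i + 1 + 1, by omega⟩ = ⟨i + 1, by omega⟩ := adjSwap_right hj'
    have ss : s * s = 1 := adjSwap_mul_self _
    have tt : t * t = 1 := adjSwap_mul_self _
    have sts : s * t * s = t * s * t := adjSwap_braid _ _ rfl
    have e1 : w * s * t * s * s * t = w * s := by simp only [mul_assoc, ss, tt, mul_one]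
    have e2 : w * s * t * s * t * s = w * t := by
      calc w * s * t * s * t * s = w * (s * t * s) * (t * s) := by simp only [mul_assoc]
        _ = w * (t * s * (t * t) * s) := by rw [sts]; simp only [mul_assoc]
        _ = w * t := by rw [tt, mul_one, mul_assoc t, ss, mul_one]
    have h1 : IsAscent (w * s * t * s) ⟨i, hi'⟩ := by
      simpa [IsAscent, s0, s1, s2, t0, t1, t2] using hj
    have h2 : IsAscent (w * s * t * s * s) ⟨i + 1, hj'⟩ := by
      simpa [IsAscent, s0, s1, s2, t0, t1, t2] using hj.trans hi
    have h3 : IsAscent (w * s * t * s) ⟨i + 1, hj'⟩ := by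
      simpa [IsAscent, s0, s1, s2, t0, t1, t2] using hi
    have h4 : IsAscent (w * s * t * s * t) ⟨i, hi'⟩ := by
      simpa [IsAscent, s0, s1, s2, t0, t1, t2] using hj.trans hi
    refine ⟨_, _, e1 ▸ (hc.mul _ h1).mul _ h2, e2 ▸ (hc.mul _ h3).mul _ h4, ?_⟩
    have := braidGroup_braid (n := n) (i := ⟨i, hi'⟩) (j := ⟨i + 1, hj'⟩) rfl
    rw [mul_assoc, mul_assoc, mul_assoc, mul_assoc, ← mul_assoc (PresentedGroup.of _), this,
      mul_assoc]

/-- Matsumoto's theorem for the symmetric groups. By induction on the length: two reduced words with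
different last letters `i`, `j` are compared with the two words of `PosLift.exists_common`, which
end in the same letters and give the same braid. -/
theorem PosLift.unique {w : Equiv.Perm (Fin n)} {b b' : BraidGroup n} (h : PosLift w b)
    (h' : PosLift w b') : b = b' := by
  induction hN : n * (n * n) - ∑ a, a.val * (w a).val using Nat.strong_induction_on
    generalizing w b b' with
  | _ N ih =>
    have hlt : ∀ {w' : Equiv.Perm (Fin n)} {i : Fin (n - 1)}, IsAscent w' i → w' * adjSwap i = w →
        n * (n * n) - ∑ a, a.val * (w' a).val < N := by
      rintro w' i h1 rfl
      have h2 := sum_mul_adjSwap_lt h1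
      have h3 := sum_mul_perm_le w'
      omega
    have hone : ∀ {w' : Equiv.Perm (Fin n)} {i : Fin (n - 1)}, IsAscent w' i →
        w' * adjSwap i ≠ 1 := by
      intro w' i h1 h2
      have := (isAscent_mul_adjSwap' (w := w') (i := i)).not.2 (not_not.2 h1)
      rw [h2] at this
      exact this (Fin.lt_def.2 (Nat.lt_succ_self _))
    -- With two names for the permutation, both derivations can be split into cases.
    generalize hw : w = w0 at h'
    cases h with
    | one =>
      cases h' with
      | one => rfl
      | mul i hi h' => exact absurd hw.symm (hone hi)
    | @mul w1 b1 i hi h1 =>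
      cases h' with
      | one => exact absurd hw (hone hi)
      | @mul w2 b2 j hj h2 =>
        have e1 : w1 * adjSwap i * adjSwap i = w1 := by
          rw [mul_assoc, adjSwap_mul_self, mul_one]
        have e2 : w1 * adjSwap i * adjSwap j = w2 := by
          rw [hw, mul_assoc, adjSwap_mul_self, mul_one]
        rcases lt_trichotomy i.val j.val with hij | hij | hij
        · obtain ⟨c, c', hc, hc', h⟩ := PosLift.exists_common (w := w1 * adjSwap i) hij
            (by rwa [e1]) (by rwa [e2])
          rw [e1] at hc
          rw [e2] at hc'
          rw [ih _ (hlt hi rfl) h1 hc rfl, ih _ (hlt hj hw.symm) h2 hc' rfl, h]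
        · obtain rfl := Fin.ext hij
          obtain rfl : w1 = w2 := mul_right_cancel hw
          rw [ih _ (hlt hi rfl) h1 h2 rfl]
        · obtain ⟨c, c', hc, hc', h⟩ := PosLift.exists_common (w := w1 * adjSwap i) hij
            (by rwa [e2]) (by rwa [e1])
          rw [e2] at hc
          rw [e1] at hc'
          rw [ih _ (hlt hi rfl) h1 hc' rfl, ih _ (hlt hj hw.symm) h2 hc rfl, h]

/-- The positive permutation braid of a permutation. -/
noncomputable def posBraid (w : Equiv.Perm (Fin n)) : BraidGroup n := (PosLift.exists w).choose

theorem posLift_posBraid (w : Equiv.Perm (Fin n)) : PosLift w (posBraid w) :=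
  (PosLift.exists w).choose_spec

@[simp]
theorem posBraid_one : posBraid (1 : Equiv.Perm (Fin n)) = 1 :=
  (posLift_posBraid 1).unique .one

theorem posBraid_mul_adjSwap {w : Equiv.Perm (Fin n)} {i : Fin (n - 1)} (h : IsAscent w i) :
    posBraid (w * adjSwap i) = posBraid w * PresentedGroup.of i :=
  (posLift_posBraid _).unique ((posLift_posBraid w).mul i h)

theorem posBraid_adjSwap (i : Fin (n - 1)) : posBraid (adjSwap i) = PresentedGroup.of i := by
  have : IsAscent 1 i := Fin.lt_def.2 (Nat.lt_succ_self _)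
  simpa using posBraid_mul_adjSwap this

theorem perm_of (i : Fin (n - 1)) :
    BraidGroup.perm (PresentedGroup.of i : BraidGroup n) = adjSwap i :=
  BraidGroup.lift_of _ _ _ i

@[simp]
theorem perm_posBraid (w : Equiv.Perm (Fin n)) : (posBraid w).perm = w := by
  induction w using ascent_induction with
  | one => simp
  | mul w i hi ih => rw [posBraid_mul_adjSwap hi, map_mul, ih, perm_of]

/-- The positive permutation braid of a product of permutations whose lengths add up. -/
theorem posBraid_mul {v u : Equiv.Perm (Fin n)}
    (h : ∀ a b, a < b → u b < u a → v (u b) < v (u a)) :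
    posBraid (v * u) = posBraid v * posBraid u := by
  induction u using ascent_induction with
  | one => simp
  | mul u i hi ih =>
    have e1 := adjSwap_left i.2
    have e2 := adjSwap_right i.2
    have hlt : (⟨i.val, by omega⟩ : Fin n) < ⟨i.val + 1, by omega⟩ :=
      Fin.lt_def.2 (Nat.lt_succ_self _)
    have h1 : IsAscent (v * u) i := by
      have := h _ _ hlt
      rw [Equiv.Perm.mul_apply, Equiv.Perm.mul_apply, show adjSwap i ⟨i.val, _⟩ = _ from e1,
        show adjSwap i ⟨i.val + 1, _⟩ = _ from e2] at this
      exact this hi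
    rw [← mul_assoc, posBraid_mul_adjSwap h1, posBraid_mul_adjSwap hi, ih, mul_assoc]
    intro a b hab hu
    -- The pair `(i, i + 1)` is not an inversion of `u`, which ascends there, and `adjSwap i` keeps
    -- the order of every other pair.
    have hne : ¬ (a.val = i.val ∧ b.val = i.val + 1) := by
      rintro ⟨ha, hb⟩
      have ha' : a = ⟨i.val, by omega⟩ := Fin.ext ha
      have hb' : b = ⟨i.val + 1, by omega⟩ := Fin.ext hb
      exact lt_asymm (hb' ▸ ha' ▸ hu) hi
    have hs : adjSwap i a < adjSwap i b := by
      rw [Fin.lt_def] at hab ⊢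
      rw [val_adjSwap, val_adjSwap]
      split_ifs <;> omega
    have := h _ _ hs
    simp only [Equiv.Perm.mul_apply, ← Equiv.Perm.mul_apply (adjSwap i), adjSwap_mul_self,
      Equiv.Perm.one_apply] at this
    exact this hu

/-- The positive permutation braids. -/
def IsSimple (b : BraidGroup n) : Prop := b = posBraid b.perm

theorem isSimple_posBraid (w : Equiv.Perm (Fin n)) : IsSimple (posBraid w) := by
  rw [IsSimple, perm_posBraid]

/-- The method for equations between braids: once both sides are positive permutation braids, only
permutations have to be compared. -/
theorem IsSimple.eq {b b' : BraidGroup n} (h : IsSimple b) (h' : IsSimple b')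
    (e : b.perm = b'.perm) : b = b' := by
  rw [h, h', e]

theorem isSimple_one : IsSimple (1 : BraidGroup n) := by simp [IsSimple]

theorem isSimple_of (i : Fin (n - 1)) : IsSimple (PresentedGroup.of i : BraidGroup n) := by
  rw [IsSimple, perm_of, posBraid_adjSwap]

theorem IsSimple.mul {b b' : BraidGroup n} (h : IsSimple b) (h' : IsSimple b')
    (hadd : ∀ x y, x < y → b'.perm y < b'.perm x → b.perm (b'.perm y) < b.perm (b'.perm x)) :
    IsSimple (b * b') := by
  rw [IsSimple, map_mul, posBraid_mul hadd, ← h, ← h']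

theorem isSimple_crossing (i : ℕ) : IsSimple (crossing n i) := by
  unfold crossing
  split_ifs
  · exact isSimple_of _
  · exact isSimple_one

theorem perm_crossing {i : ℕ} (h : i + 1 < n) (x : Fin n) :
    ((crossing n i).perm x).val = if x.val = i then i + 1 else if x.val = i + 1 then i else x := by
  have h' : i < n - 1 := by omega
  rw [crossing, dif_pos h', perm_of, val_adjSwap]

theorem BraidGroup.induction {p : BraidGroup n → Prop} (of : ∀ i, p (PresentedGroup.of i))
    (one : p 1) (mul : ∀ a b, p a → p b → p (a * b)) (inv : ∀ a, p a → p a⁻¹)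
    (b : BraidGroup n) : p b := by
  have hmem : b ∈ Subgroup.closure (Set.range (PresentedGroup.of (rels := {r | ArtinRel n r}))) := by
    rw [PresentedGroup.closure_range_of]; trivial
  induction hmem using Subgroup.closure_induction with
  | mem x hx =>
    obtain ⟨i, rfl⟩ := hx
    exact of i
  | one => exact one
  | mul x y _ _ hx hy => exact mul x y hx hy
  | inv x _ hx => exact inv x hx

end PositiveBraids

/-! ## Cables and direct sums of positive permutation braids -/

section Cables

variable {k n : ℕ}

/-- The strand with the number `j` of the block `i`. -/
def Blocks.incl (m : Blocks k n) (i : Fin k) (j : Fin (m.1 i)) : Fin n :=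
  ⟨m.offset i.val + j.val, by
    have := m.offset_succ i
    have := m.offset_le (i.val + 1)
    omega⟩

theorem Blocks.incl_lt_of_lt (m : Blocks k n) {i i' : Fin k} (h : i < i') (j : Fin (m.1 i))
    (j' : Fin (m.1 i')) : m.incl i j < m.incl i' j' := by
  have h1 := m.offset_succ i
  have h2 := m.offset_mono (t := i.val + 1) (t' := i'.val) h
  exact Fin.lt_def.2 (by simp only [Blocks.incl]; omega)

theorem Blocks.incl_lt_iff (m : Blocks k n) {i : Fin k} {j j' : Fin (m.1 i)} :
    m.incl i j < m.incl i j' ↔ j < j' := by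
  rw [Fin.lt_def, Fin.lt_def]
  exact Nat.add_lt_add_iff_left

theorem Blocks.lt_or_eq_of_incl_lt (m : Blocks k n) {i i' : Fin k} {j : Fin (m.1 i)}
    {j' : Fin (m.1 i')} (h : m.incl i j < m.incl i' j') : i ≤ i' := by
  by_contra h'
  exact lt_asymm h (m.incl_lt_of_lt (not_le.1 h') _ _)

theorem Blocks.exists_incl (m : Blocks k n) (x : Fin n) : ∃ i j, m.incl i j = x := by
  have hinj : Function.Injective fun p : Σ i, Fin (m.1 i) => m.incl p.1 p.2 := by
    rintro ⟨i, j⟩ ⟨i', j'⟩ h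
    rcases lt_trichotomy i i' with hi | rfl | hi
    · exact absurd h (m.incl_lt_of_lt hi _ _).ne
    · have := congrArg Fin.val h
      simp only [Blocks.incl] at this
      have : j = j' := Fin.ext (by omega)
      rw [this]
    · exact absurd h (m.incl_lt_of_lt hi _ _).ne'
  have hb := (Fintype.bijective_iff_injective_and_card _).2 ⟨hinj, by simp [m.2]⟩
  obtain ⟨⟨i, j⟩, h⟩ := hb.2 x
  exact ⟨i, j, h⟩

theorem val_perm_strandCross {p b : ℕ} (h : p + b < n) (x : Fin n) :
    ((strandCross n p b).perm x).val =
      if x.val < p then x.val else if x.val = p then p + b else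
        if x.val ≤ p + b then x.val - 1 else x.val := by
  induction b with
  | zero =>
    simp only [strandCross, map_one, Equiv.Perm.one_apply]
    split_ifs <;> omega
  | succ b ih =>
    rw [strandCross, map_mul, Equiv.Perm.mul_apply, perm_crossing (by omega), ih (by omega)]
    split_ifs <;> omega

theorem isSimple_strandCross {p b : ℕ} (h : p + b < n) : IsSimple (strandCross n p b) := by
  induction b with
  | zero => exact isSimple_one
  | succ b ih =>
    refine (isSimple_crossing _).mul (ih (by omega)) fun x y hxy h' => ?_
    rw [Fin.lt_def] at hxy h' ⊢
    rw [val_perm_strandCross (by omega), val_perm_strandCross (by omega)] at h'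
    rw [perm_crossing (by omega), perm_crossing (by omega), val_perm_strandCross (by omega),
      val_perm_strandCross (by omega)]
    split_ifs at h' ⊢ <;> omega

theorem val_perm_blockCross {p a b : ℕ} (h : p + a + b ≤ n) (x : Fin n) :
    ((blockCross n p a b).perm x).val =
      if x.val < p then x.val else if x.val < p + a then x.val + b else
        if x.val < p + a + b then x.val - a else x.val := by
  induction a generalizing x with
  | zero =>
    simp only [blockCross, map_one, Equiv.Perm.one_apply]
    split_ifs <;> omega
  | succ a ih =>
    rw [blockCross, map_mul, Equiv.Perm.mul_apply, ih (by omega), val_perm_strandCross (by omega)]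
    split_ifs <;> omega

theorem isSimple_blockCross {p a b : ℕ} (h : p + a + b ≤ n) : IsSimple (blockCross n p a b) := by
  induction a with
  | zero => exact isSimple_one
  | succ a ih =>
    refine (ih (by omega)).mul (isSimple_strandCross (by omega)) fun x y hxy h' => ?_
    rw [Fin.lt_def] at hxy h' ⊢
    rw [val_perm_strandCross (by omega), val_perm_strandCross (by omega)] at h'
    -- The only inversions of the new factor pair the strand at `p + a` with the `b` strands after
    -- it; the earlier crossings do not reverse these pairs again.
    have hx : x.val = p + a ∧ p + a < y.val ∧ y.val ≤ p + a + b := by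
      split_ifs at h' <;> omega
    have ex : ((strandCross n (p + a) b).perm x).val = p + a + b := by
      rw [val_perm_strandCross (by omega), if_neg (by omega), if_pos hx.1]
    have ey : ((strandCross n (p + a) b).perm y).val = y.val - 1 := by
      rw [val_perm_strandCross (by omega), if_neg (by omega), if_neg (by omega), if_pos hx.2.2]
    rw [val_perm_blockCross (by omega), val_perm_blockCross (by omega), ex, ey]
    split_ifs <;> omega

theorem blockGen_le (i : Fin (k - 1)) (m : Blocks k n) :
    m.offset i.val + m.1 ⟨i.val + 1, by omega⟩ + m.1 ⟨i.val, by omega⟩ = m.offset (i.val + 2) := by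
  have h1 := m.offset_succ ⟨i.val, by omega⟩
  have h2 := m.offset_succ ⟨i.val + 1, by omega⟩
  simp only at h1 h2
  rw [show i.val + 2 = i.val + 1 + 1 from rfl]
  omega

theorem isSimple_blockGen (i : Fin (k - 1)) (m : Blocks k n) : IsSimple (blockGen i m) :=
  isSimple_blockCross ((blockGen_le i m).trans_le (m.offset_le _))

theorem val_perm_blockGen (i : Fin (k - 1)) (m : Blocks k n) (j : Fin k) {t : ℕ} {x : Fin n}
    (ht : t < m.1 (adjSwap i j)) (hx : x.val = (m.permute (adjSwap i)).offset j.val + t) :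
    ((blockGen i m).perm x).val = m.offset (adjSwap i j).val + t := by
  have hle := blockGen_le i m
  have o1 := m.offset_succ ⟨i.val, by omega⟩
  have p0 := m.offset_permute_adjSwap i (t := i.val) (by omega)
  have p1 := (m.permute (adjSwap i)).offset_succ ⟨i.val, by omega⟩
  have v0 : (m.permute (adjSwap i)).1 ⟨i.val, by omega⟩ = m.1 ⟨i.val + 1, by omega⟩ :=
    congrArg m.1 (adjSwap_left i.2)
  simp only at o1 p1
  rw [blockGen, val_perm_blockCross (hle.trans_le (m.offset_le _)), hx]
  rcases lt_trichotomy j.val i.val with h | h | h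
  · have e : adjSwap i j = j := adjSwap_ne i.2 j.2 (by omega) (by omega)
    have q := m.offset_permute_adjSwap i (t := j.val) (by omega)
    have o := m.offset_succ j
    have o' := m.offset_mono (t := j.val + 1) (t' := i.val) h
    rw [e] at ht ⊢
    rw [q, if_pos (by omega)]
  · have e : adjSwap i j = ⟨i.val + 1, by omega⟩ :=
      (congrArg (adjSwap i) (Fin.ext h)).trans (adjSwap_left i.2)
    rw [e] at ht ⊢
    rw [h, p0, if_neg (by omega), if_pos (by omega)]
    simp only
    omega
  · rcases Nat.lt_or_ge (i.val + 1) j.val with h' | h'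
    · have e : adjSwap i j = j := adjSwap_ne i.2 j.2 (by omega) (by omega)
      have q := m.offset_permute_adjSwap i (t := j.val) (by omega)
      have o' := m.offset_mono (t := i.val + 2) (t' := j.val) h'
      rw [e] at ht ⊢
      rw [q, if_neg (by omega), if_neg (by omega), if_neg (by omega)]
    · have h : j.val = i.val + 1 := by omega
      have e : adjSwap i j = ⟨i.val, by omega⟩ :=
        (congrArg (adjSwap i) (Fin.ext h)).trans (adjSwap_right i.2)
      rw [e] at ht ⊢
      rw [h, if_neg (by omega), if_neg (by omega), if_pos (by omega)]
      simp only
      omega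

theorem perm_blockGen (i : Fin (k - 1)) (m : Blocks k n) (j : Fin k)
    (t : Fin (m.1 (adjSwap i j))) :
    (blockGen i m).perm ((m.permute (adjSwap i)).incl j t) = m.incl (adjSwap i j) t :=
  Fin.ext (val_perm_blockGen i m j t.2 rfl)

theorem cable_one (m : Blocks k n) : cable 1 m = 1 := by
  simp [cable]

theorem perm_cable_posBraid (π : Equiv.Perm (Fin k)) (m : Blocks k n) (i : Fin k)
    (j : Fin (m.1 (π i))) :
    (cable (posBraid π) m).perm ((m.permute π).incl i j) = m.incl (π i) j := by
  induction π using ascent_induction generalizing i with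
  | one =>
    simp only [posBraid_one, cable_one, map_one]
    rfl
  | mul π s hs ih =>
    have h := perm_blockGen s (m.permute π) i j
    rw [posBraid_mul_adjSwap hs, cable_mul, perm_posBraid, cable_of, map_mul,
      Equiv.Perm.mul_apply]
    exact (congrArg _ h).trans (ih (adjSwap s i) j)

/-- Strands of one block stay parallel. The block crossing at `s` reverses only pairs from the
blocks at `s` and `s + 1`, and the cable of `π` does not cross them a second time because `π`
ascends at `s`. -/
theorem isSimple_cable_posBraid (π : Equiv.Perm (Fin k)) (m : Blocks k n) :
    IsSimple (cable (posBraid π) m) := by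
  induction π using ascent_induction with
  | one =>
    rw [posBraid_one, cable_one]
    exact isSimple_one
  | mul π s hs ih =>
    rw [posBraid_mul_adjSwap hs, cable_mul, perm_posBraid, cable_of]
    refine ih.mul (isSimple_blockGen _ _) fun x y hxy h => ?_
    obtain ⟨i, j, rfl⟩ := ((m.permute π).permute (adjSwap s)).exists_incl x
    obtain ⟨i', j', rfl⟩ := ((m.permute π).permute (adjSwap s)).exists_incl y
    have e1 : (blockGen s (m.permute π)).perm _ = _ := perm_blockGen s (m.permute π) i j
    have e2 : (blockGen s (m.permute π)).perm _ = _ := perm_blockGen s (m.permute π) i' j'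
    have e3 : (cable (posBraid π) m).perm _ = _ := perm_cable_posBraid π m (adjSwap s i) j
    have e4 : (cable (posBraid π) m).perm _ = _ := perm_cable_posBraid π m (adjSwap s i') j'
    rw [e1, e2] at h ⊢
    rw [e3, e4]
    have h1 := Blocks.lt_or_eq_of_incl_lt _ hxy
    have h2 := Blocks.lt_or_eq_of_incl_lt _ h
    have hne : i ≠ i' := by
      rintro rfl
      exact lt_asymm ((Blocks.incl_lt_iff ((m.permute π).permute (adjSwap s))).1 hxy)
        ((Blocks.incl_lt_iff (m.permute π) (i := adjSwap s i)).1 h)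
    have hne' : adjSwap s i' ≠ adjSwap s i := fun h => hne ((adjSwap s).injective h).symm
    have h3 := lt_of_le_of_ne h1 hne
    have h4 := lt_of_le_of_ne h2 hne'
    rw [Fin.lt_def] at h3 h4
    rw [val_adjSwap, val_adjSwap] at h4
    have hi : i.val = s.val ∧ i'.val = s.val + 1 := by
      split_ifs at h4 <;> omega
    have e5 : adjSwap s i = ⟨s.val + 1, by omega⟩ :=
      (congrArg (adjSwap s) (Fin.ext hi.1)).trans (adjSwap_left s.2)
    have e6 : adjSwap s i' = ⟨s.val, by omega⟩ :=
      (congrArg (adjSwap s) (Fin.ext hi.2)).trans (adjSwap_right s.2)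
    refine Blocks.incl_lt_of_lt _ ?_ _ _
    have := hs
    rw [IsAscent] at this
    rw [e5, e6]
    exact this

theorem val_perm_shift {off m : ℕ} (h : off + m ≤ n) (ρ : BraidGroup m) {j : Fin m} {x : Fin n}
    (hx : x.val = off + j.val) :
    ((shift off m n h ρ).perm x).val = off + (ρ.perm j).val := by
  induction ρ using BraidGroup.induction generalizing j x with
  | of i =>
    have e : shift off m n h (PresentedGroup.of i) = crossing n (off + i.val) :=
      BraidGroup.lift_of _ _ _ i
    rw [e, perm_crossing (by omega), perm_of, val_adjSwap]
    split_ifs <;> omega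
  | one => simpa using hx
  | mul a b ha hb =>
    rw [map_mul, map_mul, map_mul, Equiv.Perm.mul_apply, ha (hb hx), Equiv.Perm.mul_apply]
  | inv a ha =>
    have hlt := (a⁻¹.perm j).2
    have h0 : a.perm (a⁻¹.perm j) = j := by simp
    have h1 := ha (j := a⁻¹.perm j) (x := ⟨off + (a⁻¹.perm j).val, by omega⟩) rfl
    have h2 : (shift off m n h a).perm ⟨off + (a⁻¹.perm j).val, by omega⟩ = x :=
      Fin.ext (by rw [h1, h0, hx])
    rw [← h2, map_inv (shift off m n h), map_inv]
    exact congrArg Fin.val (Equiv.symm_apply_apply _ _)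

theorem perm_shift_of_ne {off m : ℕ} (h : off + m ≤ n) (ρ : BraidGroup m) {x : Fin n}
    (hx : x.val < off ∨ off + m ≤ x.val) : (shift off m n h ρ).perm x = x := by
  induction ρ using BraidGroup.induction with
  | of i =>
    have e : shift off m n h (PresentedGroup.of i) = crossing n (off + i.val) :=
      BraidGroup.lift_of _ _ _ i
    refine Fin.ext ?_
    rw [e, perm_crossing (by omega)]
    split_ifs <;> omega
  | one => simp
  | mul a b ha hb => rw [map_mul, map_mul, Equiv.Perm.mul_apply, hb, ha]
  | inv a ha => rw [map_inv, map_inv, Equiv.Perm.inv_eq_iff_eq, ha]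

theorem isSimple_shift_posBraid {off m : ℕ} (h : off + m ≤ n) (π : Equiv.Perm (Fin m)) :
    IsSimple (shift off m n h (posBraid π)) := by
  induction π using ascent_induction with
  | one => simpa using isSimple_one
  | mul π i hi ih =>
    have e : shift off m n h (PresentedGroup.of i) = crossing n (off + i.val) :=
      BraidGroup.lift_of _ _ _ i
    rw [posBraid_mul_adjSwap hi, map_mul, e]
    refine ih.mul (isSimple_crossing _) fun x y hxy h' => ?_
    rw [Fin.lt_def, perm_crossing (by omega), perm_crossing (by omega)] at h'
    rw [Fin.lt_def] at hxy
    have hx : x.val = off + i.val ∧ y.val = off + i.val + 1 := by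
      split_ifs at h' <;> omega
    have ex : ((crossing n (off + i.val)).perm x).val = off + (i.val + 1) := by
      rw [perm_crossing (by omega), if_pos hx.1]; rfl
    have ey : ((crossing n (off + i.val)).perm y).val = off + i.val := by
      rw [perm_crossing (by omega), if_neg (by omega), if_pos hx.2]
    rw [Fin.lt_def, val_perm_shift h (posBraid π) (j := ⟨i.val, by omega⟩) ey,
      val_perm_shift h (posBraid π) (j := ⟨i.val + 1, by omega⟩) ex, perm_posBraid]
    exact Nat.add_lt_add_left hi off

/-- A braid on the strands of one block. -/
def blockShift (m : Blocks k n) (i : Fin k) : BraidGroup (m.1 i) →* BraidGroup n :=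
  shift (m.offset i.val) (m.1 i) n (by rw [← m.offset_succ]; exact m.offset_le _)

theorem perm_blockShift (m : Blocks k n) (i : Fin k) (ρ : BraidGroup (m.1 i)) (j : Fin (m.1 i)) :
    (blockShift m i ρ).perm (m.incl i j) = m.incl i (ρ.perm j) :=
  Fin.ext (val_perm_shift _ ρ rfl)

theorem perm_blockShift_of_ne (m : Blocks k n) {i i' : Fin k} (h : i ≠ i') (ρ : BraidGroup (m.1 i))
    (j : Fin (m.1 i')) : (blockShift m i ρ).perm (m.incl i' j) = m.incl i' j := by
  refine perm_shift_of_ne _ ρ ?_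
  have o := m.offset_succ i
  have o' := m.offset_succ i'
  simp only [Blocks.incl]
  rcases lt_or_gt_of_ne h with h | h
  · have := m.offset_mono (t := i.val + 1) (t' := i'.val) h
    omega
  · have := m.offset_mono (t := i'.val + 1) (t' := i.val) h
    omega

theorem directSum_eq (m : Blocks k n) (ρ : ∀ i : Fin k, BraidGroup (m.1 i)) :
    directSum m ρ = ((List.finRange k).map fun i => blockShift m i (ρ i)).prod := by
  rw [directSum, List.ofFn_eq_map]
  rfl

theorem perm_prod_blockShift (m : Blocks k n) (ρ : ∀ i : Fin k, BraidGroup (m.1 i))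
    (L : List (Fin k)) (hL : L.Nodup) (i : Fin k) (j : Fin (m.1 i)) :
    (L.map fun i => blockShift m i (ρ i)).prod.perm (m.incl i j) =
      m.incl i (if i ∈ L then (ρ i).perm j else j) := by
  induction L with
  | nil => simp
  | cons a L ih =>
    rw [List.nodup_cons] at hL
    rw [List.map_cons, List.prod_cons, map_mul, Equiv.Perm.mul_apply, ih hL.2]
    by_cases h : a = i
    · subst h
      rw [if_neg hL.1, if_pos List.mem_cons_self, perm_blockShift]
    · rw [perm_blockShift_of_ne m h]
      simp [Ne.symm h]

theorem perm_directSum (m : Blocks k n) (ρ : ∀ i : Fin k, BraidGroup (m.1 i)) (i : Fin k)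
    (j : Fin (m.1 i)) : (directSum m ρ).perm (m.incl i j) = m.incl i ((ρ i).perm j) := by
  rw [directSum_eq, perm_prod_blockShift _ _ _ (List.nodup_finRange k)]
  simp

/-- A pair that crosses lies in a single block, and each factor of the product moves the strands of
its own block only, so no pair crosses twice. -/
theorem isSimple_directSum (m : Blocks k n) (π : ∀ i : Fin k, Equiv.Perm (Fin (m.1 i))) :
    IsSimple (directSum m fun i => posBraid (π i)) := by
  rw [directSum_eq]
  suffices ∀ L : List (Fin k), L.Nodup →
      IsSimple (L.map fun i => blockShift m i (posBraid (π i))).prod from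
    this _ (List.nodup_finRange k)
  intro L hL
  induction L with
  | nil => exact isSimple_one
  | cons a L ih =>
    rw [List.nodup_cons] at hL
    rw [List.map_cons, List.prod_cons]
    refine (isSimple_shift_posBraid _ _).mul (ih hL.2) fun x y hxy h => ?_
    obtain ⟨i, j, rfl⟩ := m.exists_incl x
    obtain ⟨i', j', rfl⟩ := m.exists_incl y
    rw [perm_prod_blockShift m _ L hL.2, perm_prod_blockShift m _ L hL.2] at h ⊢
    obtain rfl : i = i' :=
      le_antisymm (m.lt_or_eq_of_incl_lt hxy) (m.lt_or_eq_of_incl_lt h)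
    by_cases hi : i ∈ L
    · have hai : a ≠ i := by
        rintro rfl
        exact hL.1 hi
      have e := perm_blockShift_of_ne m hai (posBraid (π a))
      rw [blockShift] at e
      rw [e, e]
      exact h
    · rw [if_neg hi, if_neg hi] at h
      exact absurd h (lt_asymm hxy)

end Cables

/-! ## The permutation that sorts the values of a function -/

section Sorting

variable {n l k : ℕ}

/-- `Fin n` has no order automorphism except the identity, so a bijection onto it is determined by
the order that it pulls back. -/
theorem equiv_eq_of_lt {α : Type*} {e e' : α ≃ Fin n} (h : ∀ x y, e x < e y → e' x < e' y) :
    e = e' := by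
  have hs : StrictMono (e.symm.trans e') := fun x y hxy => by
    simpa using h (e.symm x) (e.symm y) (by simpa using hxy)
  have := Subsingleton.elim (hs.orderIsoOfSurjective _ (e.symm.trans e').surjective)
    (OrderIso.refl (Fin n))
  ext x : 1
  have h2 : (hs.orderIsoOfSurjective _ (e.symm.trans e').surjective) (e x) = e x := by rw [this]; rfl
  have h3 : e' (e.symm (e x)) = e x := h2
  rw [← h3, Equiv.symm_apply_apply]

theorem Blocks.incl_bijective (m : Blocks k n) :
    Function.Bijective fun p : Σ i, Fin (m.1 i) => m.incl p.1 p.2 := by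
  refine (Fintype.bijective_iff_surjective_and_card _).2 ⟨fun x => ?_, by simp [m.2]⟩
  obtain ⟨i, j, h⟩ := m.exists_incl x
  exact ⟨⟨i, j⟩, h⟩

/-- The strands, sorted by blocks. -/
noncomputable def Blocks.equiv (m : Blocks k n) : (Σ i, Fin (m.1 i)) ≃ Fin n :=
  Equiv.ofBijective _ m.incl_bijective

theorem Blocks.incl_lt_incl_iff (m : Blocks k n) {i i' : Fin k} {j : Fin (m.1 i)}
    {j' : Fin (m.1 i')} :
    m.incl i j < m.incl i' j' ↔ i < i' ∨ (i = i' ∧ j.val < j'.val) := by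
  rcases lt_trichotomy i i' with h | rfl | h
  · simp [h, m.incl_lt_of_lt h]
  · simp only [m.incl_lt_iff, lt_irrefl, true_and, false_or]
    exact Fin.lt_def
  · simp [h.ne', (m.incl_lt_of_lt h j' j).not_gt, h.not_gt]

theorem fibEmb_bijective (f : Fin n → Fin k) :
    Function.Bijective fun p : Σ i, Fin (fibCard f i) => fibEmb f p.1 p.2 := by
  refine (Fintype.bijective_iff_surjective_and_card _).2 ⟨fun x => ?_, by simp [sum_fibCard]⟩
  obtain ⟨j, h⟩ := exists_fibEmb_eq f (x := x) rfl
  exact ⟨⟨f x, j⟩, h⟩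

/-- The elements of the source of a map, sorted by fibres. -/
noncomputable def fibEquiv (f : Fin n → Fin k) : (Σ i, Fin (fibCard f i)) ≃ Fin n :=
  Equiv.ofBijective _ (fibEmb_bijective f)

/-- The permutation that puts the fibres of `f` one after another. -/
noncomputable def sortPerm (f : Fin n → Fin k) : Equiv.Perm (Fin n) :=
  (fibEquiv f).symm.trans (fibBlocks f).equiv

theorem sortPerm_fibEmb (f : Fin n → Fin k) (i : Fin k) (j : Fin (fibCard f i)) :
    sortPerm f (fibEmb f i j) = (fibBlocks f).incl i j := by
  have h : (fibEquiv f).symm (fibEmb f i j) = ⟨i, j⟩ :=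
    (fibEquiv f).symm_apply_eq.2 rfl
  exact congrArg (fibBlocks f).equiv h

/-- The sort is stable: it realises the lexicographic order of the pairs `(f x, x)`. Together with
`eq_sortPerm`, this recognises a sort from the order alone. -/
theorem sortPerm_lt_iff (f : Fin n → Fin k) {x y : Fin n} :
    sortPerm f x < sortPerm f y ↔ f x < f y ∨ (f x = f y ∧ x < y) := by
  obtain ⟨⟨i, j⟩, rfl⟩ := (fibEmb_bijective f).2 x
  obtain ⟨⟨i', j'⟩, rfl⟩ := (fibEmb_bijective f).2 y
  simp only [sortPerm_fibEmb, map_fibEmb]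
  refine (Blocks.incl_lt_incl_iff _).trans (or_congr Iff.rfl (and_congr_right ?_))
  rintro rfl
  rw [(fibEmb f i).lt_iff_lt]
  exact Iff.rfl

theorem eq_sortPerm {f : Fin n → Fin k} {π : Equiv.Perm (Fin n)}
    (h : ∀ x y, (f x < f y ∨ (f x = f y ∧ x < y)) → π x < π y) : π = sortPerm f :=
  (equiv_eq_of_lt fun x y hxy => h x y ((sortPerm_lt_iff f).1 hxy)).symm

theorem sortPerm_of_monotone {f : Fin n → Fin k} (hf : Monotone f) : sortPerm f = 1 := by
  refine (eq_sortPerm fun x y h => ?_).symm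
  rcases h with h | h
  · exact hf.reflect_lt h
  · exact h.2

theorem sortPerm_perm (π : Equiv.Perm (Fin n)) : sortPerm π = π := by
  refine (eq_sortPerm fun x y h => ?_).symm
  rcases h with h | h
  · exact h
  · exact absurd (π.injective h.1) h.2.ne

theorem fibEmb_of_monotone {f : Fin n → Fin k} (hf : Monotone f) (i : Fin k)
    (j : Fin (fibCard f i)) : fibEmb f i j = (fibBlocks f).incl i j := by
  rw [← sortPerm_fibEmb, sortPerm_of_monotone hf, Equiv.Perm.one_apply]

/-- The number of the block of a strand. -/
noncomputable def Blocks.index (m : Blocks k n) : Fin n →o Fin k where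
  toFun x := (m.equiv.symm x).1
  monotone' x y h := by
    obtain ⟨⟨i, j⟩, rfl⟩ := m.equiv.surjective x
    obtain ⟨⟨i', j'⟩, rfl⟩ := m.equiv.surjective y
    simp only [Equiv.symm_apply_apply]
    rcases h.lt_or_eq with h | h
    · exact m.lt_or_eq_of_incl_lt h
    · exact le_of_eq (congrArg Sigma.fst (m.equiv.injective h))

theorem Blocks.index_incl (m : Blocks k n) (i : Fin k) (j : Fin (m.1 i)) :
    m.index (m.incl i j) = i :=
  congrArg Sigma.fst (m.equiv.symm_apply_apply ⟨i, j⟩)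

theorem fibCard_index (m : Blocks k n) (i : Fin k) : fibCard m.index i = m.1 i := by
  let φ : Fin (m.1 i) ↪o Fin n := OrderEmbedding.ofStrictMono (m.incl i) fun _ _ h =>
    m.incl_lt_iff.2 h
  refine eq_of_range_eq (φ := fibEmb m.index i) (ψ := φ) ?_
  rw [range_fibEmb]
  ext x
  obtain ⟨i', j', rfl⟩ := m.exists_incl x
  simp only [Set.mem_ofPred_eq, Set.mem_range, m.index_incl]
  constructor
  · rintro rfl
    exact ⟨j', rfl⟩
  · rintro ⟨j, h⟩
    exact (m.index_incl i' j').symm.trans ((congrArg m.index h).symm.trans (m.index_incl i j))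

theorem fibBlocks_index (m : Blocks k n) : fibBlocks m.index = m :=
  Subtype.ext (funext fun i => fibCard_index m i)

theorem index_fibBlocks (σ : Fin n →o Fin k) : (fibBlocks σ).index = σ := by
  ext x : 2
  obtain ⟨i, j, rfl⟩ := (fibBlocks σ).exists_incl x
  refine ((fibBlocks σ).index_incl i j).trans ?_
  exact (map_fibEmb σ i j).symm.trans (congrArg σ (fibEmb_of_monotone σ.monotone i j))

theorem fibCard_perm_comp (π : Equiv.Perm (Fin l)) (f : Fin n → Fin l) (i : Fin l) :
    fibCard (fun x => π (f x)) (π i) = fibCard f i := by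
  simp [fibCard]

theorem permute_fibBlocks_perm_comp (π : Equiv.Perm (Fin l)) (f : Fin n → Fin l) :
    (fibBlocks fun x => π (f x)).permute π = fibBlocks f :=
  Subtype.ext (funext fun i => fibCard_perm_comp π f i)

/-- The comparison of the two braids which arise from a composite of two maps: first the fibres of
`f` are sorted and then those of `g`, or the fibres of the composite are sorted first and then
their inner parts. -/
theorem cable_posBraid_sortPerm {f : Fin n → Fin l} {g : Fin l → Fin k} {h : Fin n → Fin k}
    (c : ∀ x, h x = g (f x)) (hfg : ∀ x y, x < y → f y < f x → g (f y) ≤ g (f x)) :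
    cable (posBraid (sortPerm g)) (fibBlocks fun x => sortPerm g (f x)) * posBraid (sortPerm f) =
      directSum (fibBlocks h) (fun i => posBraid (sortPerm (fibMap c i))) *
        posBraid (sortPerm h) := by
  -- Both braids sort by the value of `h`, then by the value of `f`, then by position; this is the
  -- sort of `x ↦ sortPerm g (f x)`.
  have e1 : (cable (posBraid (sortPerm g)) (fibBlocks fun x => sortPerm g (f x)) *
      posBraid (sortPerm f)).perm = sortPerm fun x => sortPerm g (f x) := by
    ext x : 1
    obtain ⟨⟨i, j⟩, rfl⟩ := (fibEmb_bijective f).2 x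
    rw [map_mul, Equiv.Perm.mul_apply, perm_posBraid, sortPerm_fibEmb]
    have key : ∀ (m : Blocks l n) (hm : m = fibBlocks f) (j' : Fin (m.1 i)), j'.val = j.val →
        m.incl i j' = (fibBlocks f).incl i j := by
      rintro _ rfl j' hj
      rw [Fin.ext hj]
    obtain ⟨j', hj'⟩ : ∃ j' : Fin (fibCard (fun x => sortPerm g (f x)) (sortPerm g i)),
        j'.val = j.val := ⟨Fin.cast (fibCard_perm_comp _ f i).symm j, rfl⟩
    rw [← key _ (permute_fibBlocks_perm_comp (sortPerm g) f) j' hj']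
    refine (perm_cable_posBraid (sortPerm g) (fibBlocks fun x => sortPerm g (f x)) i j').trans ?_
    refine (sortPerm_fibEmb (fun x => sortPerm g (f x)) _ j').symm.trans (congrArg _ ?_)
    have hr : Set.range (fibEmb (fun x => sortPerm g (f x)) (sortPerm g i)) =
        Set.range (fibEmb f i) := by
      rw [range_fibEmb, range_fibEmb]
      ext x
      simp
    have key2 : ∀ {a : ℕ} (φ : Fin a ↪o Fin n) (ψ : Fin (fibCard f i) ↪o Fin n)
        (ha : a = fibCard f i) (h : Set.range φ = Set.range ψ) (t : Fin a), t.val = j.val →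
        φ t = ψ j := by
      rintro a φ ψ rfl h t ht
      rw [OrderEmbedding.range_inj.1 h, Fin.ext ht]
    exact key2 _ _ (fibCard_perm_comp _ f i) hr j' hj'
  have e2 : (directSum (fibBlocks h) (fun i => posBraid (sortPerm (fibMap c i))) *
      posBraid (sortPerm h)).perm = sortPerm fun x => sortPerm g (f x) := by
    refine eq_sortPerm fun x y hxy => ?_
    obtain ⟨⟨i, j⟩, rfl⟩ := (fibEmb_bijective h).2 x
    obtain ⟨⟨i', j'⟩, rfl⟩ := (fibEmb_bijective h).2 y
    simp only [sortPerm_lt_iff, ← c, map_fibEmb, EmbeddingLike.apply_eq_iff_eq] at hxy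
    simp only [map_mul, Equiv.Perm.mul_apply, perm_posBraid, sortPerm_fibEmb]
    erw [perm_directSum, perm_directSum]
    rw [Blocks.incl_lt_incl_iff]
    rcases hxy with (hi | ⟨rfl, hj⟩) | ⟨he, hj⟩
    · exact Or.inl hi
    · refine Or.inr ⟨rfl, ?_⟩
      rw [perm_posBraid, ← Fin.lt_def]
      refine (sortPerm_lt_iff (fibMap c i)).2 ?_
      refine Or.inl ?_
      rwa [← fibEmb_fibMap c, ← fibEmb_fibMap c, (fibEmb g i).lt_iff_lt] at hj
    · obtain rfl : i = i' := by rw [← map_fibEmb h i j, ← map_fibEmb h i' j', c, c, he]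
      refine Or.inr ⟨rfl, ?_⟩
      rw [perm_posBraid, ← Fin.lt_def]
      refine (sortPerm_lt_iff (fibMap c i)).2 ?_
      refine Or.inr ⟨?_, (fibEmb h i).lt_iff_lt.1 hj⟩
      rwa [← fibEmb_fibMap c, ← fibEmb_fibMap c, (fibEmb g i).injective.eq_iff] at he
  refine IsSimple.eq ?_ ?_ (e1.trans e2.symm)
  -- By `hfg`, a pair that `f` reverses is not reversed again by `g`, so the lengths add.
  · refine (isSimple_cable_posBraid _ _).mul (isSimple_posBraid _) fun x y hxy h' => ?_
    rw [← Equiv.Perm.mul_apply, ← Equiv.Perm.mul_apply, ← map_mul, e1]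
    rw [perm_posBraid, sortPerm_lt_iff] at h'
    have h1 : f y < f x := h'.resolve_right fun h2 => lt_asymm hxy h2.2
    rw [sortPerm_lt_iff, sortPerm_lt_iff]
    rcases (hfg x y hxy h1).lt_or_eq with h2 | h2
    · exact Or.inl (Or.inl h2)
    · exact Or.inl (Or.inr ⟨h2, h1⟩)
  -- A pair reversed by `sortPerm h` lies in two different fibres of `h`, and sorting inside the
  -- fibres does not cross it again.
  · refine (isSimple_directSum _ _).mul (isSimple_posBraid _) fun x y hxy h' => ?_
    rw [← Equiv.Perm.mul_apply, ← Equiv.Perm.mul_apply, ← map_mul, e2]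
    rw [perm_posBraid, sortPerm_lt_iff] at h'
    have h1 : h y < h x := h'.resolve_right fun h2 => lt_asymm hxy h2.2
    rw [sortPerm_lt_iff, sortPerm_lt_iff, ← c, ← c]
    exact Or.inl (Or.inl h1)

/-- Reversing a pair raises the index of its relation strictly. Two reversals in a row would need
three indices `p < r < s`, and for `d = 2` there are only two. -/
theorem NOrdinal.le_of_lt_of_lt {T S R : NOrdinal 2} (σ : T ⟶ S) (ω : S ⟶ R) (x y : Fin T.card)
    (hxy : x < y) (h : fn σ y < fn σ x) : fn ω (fn σ y) ≤ fn ω (fn σ x) := by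
  obtain ⟨p, hp, -⟩ := T.existsUnique x y hxy.ne
  have hp : T.lt p x y := hp.resolve_right fun h' => lt_asymm hxy (T.lt_of_lt h')
  have h1 : ∃ r, p < r ∧ S.lt r (fn σ y) (fn σ x) := by
    rcases σ.cond hp with ⟨r, -, hr⟩ | h1 | h1
    · exact absurd (S.lt_of_lt hr) (lt_asymm h)
    · exact absurd h1 h.ne'
    · exact h1
  obtain ⟨r, hr, h1⟩ := h1
  rcases ω.cond h1 with ⟨s, -, hs⟩ | h2 | ⟨s, hs, -⟩
  · exact (R.lt_of_lt hs).le
  · exact h2.le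
  · exact absurd (hr.trans hs) (by omega)

end Sorting

/-! ## Operads with a multiplication for every map of finite ordinals -/

section CardOperads

open NOrdinal

variable (V : Type u) [Category.{v} V] [MonoidalCategory V] [SymmetricCategory V]

/-- A `2`-operad whose objects depend only on the cardinality of a `2`-ordinal, and whose
multiplications depend only on the underlying maps of sets. -/
structure CardOperad where
  obj : ℕ → V
  unit : 𝟙_ V ⟶ obj 1
  mul : ∀ {n k : ℕ} (f : Fin n → Fin k), obj k ⊗ tprod (fun i => obj (fibCard f i)) ⟶ obj n
  -- Required only for functions that underlie composable maps of `2`-ordinals. For other composites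
  -- a pair could be reversed twice, which in a braid group is a full twist and not trivial.
  assoc : ∀ {T S R : NOrdinal 2} (σ : T ⟶ S) (ω : S ⟶ R),
    regroup (fn ω) (obj R.card) (fun i => obj (fibCard (fn ω) i))
          (fun j => obj (fibCard (fn σ) j)) ≫
        mul (fn ω) ▷ tprod (fun j => obj (fibCard (fn σ) j)) ≫ mul (fn σ) =
      obj R.card ◁ tprodMap (fun i =>
          obj (fibCard (fn ω) i) ◁ tprodMap (fun j =>
            eqToHom (congrArg obj (fibCard_fibMap (fn_comp_apply σ ω) i j).symm)) ≫
            mul (fibMap (fn_comp_apply σ ω) i)) ≫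
        mul (fn (σ ≫ ω))
  mul_unit : ∀ n : ℕ,
    (ρ_ (obj n)).inv ≫
        obj n ◁ tprodUnit (fun i => unit ≫
          eqToHom (congrArg obj (fibCard_bijective Function.bijective_id i).symm)) ≫
        mul (id : Fin n → Fin n) = 𝟙 (obj n)
  unit_mul : ∀ {n : ℕ} (f : Fin n → Fin 1),
    (λ_ (obj n)).inv ≫ unit ▷ obj n ≫
        obj 1 ◁ (eqToHom (congrArg obj (fibCard_fin_one f 0).symm) ≫
          tprodOne (fun i => obj (fibCard f i))) ≫
        mul f = 𝟙 (obj n)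

variable {V}

/-- The underlying `2`-operad. -/
abbrev CardOperad.toNOperad (C : CardOperad V) : NOperad 2 V where
  obj T := C.obj T.card
  unit := C.unit
  mul σ := C.mul (fn σ)
  assoc σ ω := C.assoc σ ω
  mul_unit T := C.mul_unit T.card
  unit_mul σ := C.unit_mul (fn σ)

end CardOperads

theorem tensorHom_comp_right {V : Type u} [Category.{v} V] [MonoidalCategory V] {A A' P P' P'' Z : V}
    (a : A ⟶ A') (b : P ⟶ P') (c : P' ⟶ P'') (x : A' ⊗ P'' ⟶ Z) :
    (a ⊗ₘ (b ≫ c)) ≫ x = (a ⊗ₘ b) ≫ A' ◁ c ≫ x := by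
  rw [← id_tensorHom, tensorHom_comp_tensorHom_assoc, Category.comp_id]

/-! ### Multiplications of a braided operad, indexed by block sizes. -/

namespace BraidedOperad

variable {V : Type u} [Category.{v} V] [MonoidalCategory V] [SymmetricCategory V]
variable (B : BraidedOperad V) {n l k : ℕ}

/-- The multiplication for the order preserving map with fibres of given sizes. -/
noncomputable def blockMul (m : Blocks k n) : B.obj k ⊗ tprod (fun i => B.obj (m.1 i)) ⟶ B.obj n :=
  B.obj k ◁ tprodMap (fun i => eqToHom (congrArg B.obj (fibCard_index m i).symm)) ≫ B.mul m.index

/-- An order preserving map is determined by the sizes of its fibres. -/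
theorem blockMul_eq {m : Blocks k n} (σ : Fin n →o Fin k) (h : ∀ i, m.1 i = fibCard σ i) :
    B.blockMul m = B.obj k ◁ tprodMap (fun i => eqToHom (congrArg B.obj (h i))) ≫ B.mul σ := by
  obtain rfl : σ = m.index := by
    have : m = fibBlocks σ := Subtype.ext (funext h)
    rw [this, index_fibBlocks]
  rfl

theorem blockMul_fibBlocks (σ : Fin n →o Fin k) : B.blockMul (fibBlocks σ) = B.mul σ := by
  have h : B.obj k ◁ tprodMap (fun i => 𝟙 (B.obj (fibCard σ i))) ≫ B.mul σ = B.mul σ := by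
    rw [tprodMap_id, whiskerLeft_id, Category.id_comp]
  exact (B.blockMul_eq σ fun _ => rfl).trans h

theorem blockMul_congr {k' n' : ℕ} (hk : k = k') (hn : n = n') {m : Blocks k n} {m' : Blocks k' n'}
    (h : ∀ i i', i.val = i'.val → m.1 i = m'.1 i')
    (e : tprod (fun i => B.obj (m.1 i)) = tprod (fun i => B.obj (m'.1 i))) :
    (eqToHom (congrArg B.obj hk) ⊗ₘ eqToHom e) ≫ B.blockMul m' =
      B.blockMul m ≫ eqToHom (congrArg B.obj hn) := by
  subst hk
  subst hn
  obtain rfl : m = m' := Subtype.ext (funext fun i => h i i rfl)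
  simp

theorem tprodMap_blockMul {m m' : Blocks k n} (h : ∀ i, m.1 i = m'.1 i) :
    B.obj k ◁ tprodMap (fun i => eqToHom (congrArg B.obj (h i))) ≫ B.blockMul m' =
      B.blockMul m := by
  obtain rfl : m = m' := Subtype.ext (funext h)
  simp [tprodMap_id]

theorem blockMul_act_directSum (m : Blocks k n) (ρ : ∀ i, BraidGroup (m.1 i)) :
    B.blockMul m ≫ B.act (directSum m ρ) =
      B.obj k ◁ tprodMap (fun i => B.act (ρ i)) ≫ B.blockMul m := by
  obtain ⟨σ, rfl⟩ : ∃ σ : Fin n →o Fin k, m = fibBlocks σ := ⟨m.index, (fibBlocks_index m).symm⟩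
  rw [blockMul_fibBlocks]
  exact B.equivariance_fibre σ ρ

theorem blockMul_act_cable (m : Blocks k n) (ρ : BraidGroup k) :
    B.blockMul m ≫ B.act (cable ρ m) =
      (B.act ρ ⊗ₘ tprodSymm ρ.perm (fun i => B.obj (m.1 i))) ≫
        B.blockMul (m.permute ρ.perm) := by
  obtain ⟨σ, rfl⟩ : ∃ σ : Fin n →o Fin k, m = fibBlocks σ := ⟨m.index, (fibBlocks_index m).symm⟩
  have h := B.equivariance_base σ ((fibBlocks σ).permute ρ.perm).index ρ fun i => fibCard_index _ i
  rw [blockMul_fibBlocks]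
  exact h.trans (tensorHom_comp_right _ _ _ _)

/-- The multiplication for an arbitrary map: the braid group acts to reduce it to the case of an
order preserving map. -/
noncomputable def sortMul (f : Fin n → Fin k) :
    B.obj k ⊗ tprod (fun i => B.obj (fibCard f i)) ⟶ B.obj n :=
  B.blockMul (fibBlocks f) ≫ B.act (posBraid (sortPerm f))

theorem sortMul_of_monotone (σ : Fin n →o Fin k) : B.sortMul σ = B.mul σ := by
  rw [sortMul, blockMul_fibBlocks, sortPerm_of_monotone σ.monotone, posBraid_one, B.act_one,
    Category.comp_id]

end BraidedOperad

/-! ### Regrouping along a map and along its sorted form. -/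

section Regroup

variable {V : Type u} [Category.{v} V] [MonoidalCategory V] [SymmetricCategory V]

theorem tprod_congr {a b : ℕ} (h : a = b) {F : Fin a → V} {G : Fin b → V}
    (hFG : ∀ i j, i.val = j.val → F i = G j) : tprod F = tprod G := by
  subst h
  obtain rfl : F = G := funext fun i => hFG i i rfl
  rfl

theorem IsCan.tprod_single_eqToHom {ι : Type*} {X : ι → V} {a b : ℕ} (h : a = b) {F : Fin a → V}
    {G : Fin b → V} {e : Fin a → ι} {e' : Fin b → ι} (hF : ∀ i, F i = X (e i))
    (hG : ∀ i, G i = X (e' i)) (he : ∀ i j, i.val = j.val → e i = e' j) (E : tprod F = tprod G) :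
    IsCan (.tprod fun i => .single (e i) (hF i)) (.tprod fun i => .single (e' i) (hG i))
      (eqToHom E) := by
  subst h
  obtain rfl : e = e' := funext fun i => he i i rfl
  obtain rfl : F = fun i => X (e i) := funext hF
  obtain rfl : G = fun i => X (e i) := funext hG
  exact IsCan.id _

/-- The comparison of the symmetries `regroup` for two maps which differ by a permutation that
preserves the order on the fibres. -/
theorem regroup_reindex {l k : ℕ} {g ω : Fin l → Fin k} (π : Equiv.Perm (Fin l)) (R : V)
    {P P' : Fin k → V} {F F' : Fin l → V} (hP : ∀ i, P i = P' i) (hF : ∀ j, F' (π j) = F j)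
    (hc : ∀ i, fibCard g i = fibCard ω i)
    (he : ∀ i j j', j.val = j'.val → fibEmb ω i j' = π (fibEmb g i j))
    (E : ∀ i, tprod (fun j => F (fibEmb g i j)) = tprod (fun j => F' (fibEmb ω i j))) :
    regroup g R P F ≫ (R ◁ tprodMap fun i => eqToHom (hP i)) ▷ tprod F =
      R ◁ tprodMap (fun i => eqToHom (hP i) ⊗ₘ eqToHom (E i)) ≫ regroup ω R P' F' ≫
        (R ⊗ tprod P') ◁ (tprodSymm π F' ≫ tprodMap fun j => eqToHom (hF j)) := by
  -- `R`, the `P i` and the `F j` get different letters, and `F' (π j)` gets the letter of `F j`;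
  -- both sides then realise the same permutation of letters.
  let X : Option (Fin k ⊕ Fin l) → V := fun o => o.elim R (Sum.elim P F)
  let r : Lab X R := .single none rfl
  let p : ∀ i, Lab X (P i) := fun i => .single (some (.inl i)) rfl
  let p' : ∀ i, Lab X (P' i) := fun i => .single (some (.inl i)) (hP i).symm
  let f : ∀ j, Lab X (F j) := fun j => .single (some (.inr j)) rfl
  have hF' : ∀ j, F' j = F (π.symm j) := fun j => by
    rw [← hF, Equiv.apply_symm_apply]
  let f' : ∀ j, Lab X (F' j) := fun j => .single (some (.inr (π.symm j))) (hF' j)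
  have h1 : IsCan (r.tensor (.tprod fun i => (p i).tensor (.tprod fun j => f (fibEmb g i j))))
      ((r.tensor (.tprod p')).tensor (.tprod f))
      (regroup g R P F ≫ (R ◁ tprodMap fun i => eqToHom (hP i)) ▷ tprod F) :=
    (IsCan.regroup g r p f).comp (IsCan.whiskerRight (IsCan.whiskerLeft r
      (IsCan.tprodMap fun i => IsCan.single_eqToHom rfl _ _ _)) _)
  have h2 : IsCan (r.tensor (.tprod fun i => (p i).tensor (.tprod fun j => f (fibEmb g i j))))
      ((r.tensor (.tprod p')).tensor (.tprod f))
      (R ◁ tprodMap (fun i => eqToHom (hP i) ⊗ₘ eqToHom (E i)) ≫ regroup ω R P' F' ≫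
        (R ⊗ tprod P') ◁ (tprodSymm π F' ≫ tprodMap fun j => eqToHom (hF j))) := by
    refine (IsCan.whiskerLeft r (IsCan.tprodMap (b := fun i => (p' i).tensor
      (.tprod fun j => f' (fibEmb ω i j))) fun i => ?_)).comp ((IsCan.regroup ω r p' f').comp ?_)
    · refine (IsCan.single_eqToHom rfl _ _ _).tensor
        (IsCan.tprod_single_eqToHom (hc i) _ _ (fun j j' h => ?_) (E i))
      rw [he i j j' h, Equiv.symm_apply_apply]
    · refine IsCan.whiskerLeft _ ((IsCan.tprodSymm π f').comp (IsCan.tprodMap fun j => ?_))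
      exact IsCan.single_eqToHom (by rw [Equiv.symm_apply_apply]) _ _ _
  refine IsCan.ext ?_ h1 h2
  have e1 := Lab.letters_tprod_single (X := X) (F := P') (fun i => some (Sum.inl i))
    fun i => (hP i).symm
  have e2 := Lab.letters_tprod_single (X := X) (F := F) (fun i => some (Sum.inr i)) fun i => rfl
  have h : ([none] ++ (List.finRange k).map (fun i => some (Sum.inl i)) ++
      (List.finRange l).map (fun i => some (Sum.inr i))).Nodup := by
    refine List.nodup_append.2 ⟨List.nodup_append.2 ⟨by simp, (List.nodup_finRange k).map
      fun _ _ h => ?_, by simp⟩, (List.nodup_finRange l).map fun _ _ h => ?_, by simp⟩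
    · simpa using h
    · simpa using h
  rw [← e1, ← e2] at h
  exact h

end Regroup

/-! ### Fibres of sorted maps and of composites. -/

section Sorted

variable {n l k : ℕ}

theorem index_sortPerm (f : Fin n → Fin k) (x : Fin n) :
    (fibBlocks f).index (sortPerm f x) = f x := by
  obtain ⟨⟨i, j⟩, rfl⟩ := (fibEmb_bijective f).2 x
  rw [sortPerm_fibEmb]
  exact ((fibBlocks f).index_incl i j).trans (map_fibEmb f i j).symm

theorem fibCard_comp_perm (f : Fin n → Fin k) (π : Equiv.Perm (Fin n)) (i : Fin k) :
    fibCard (fun x => f (π x)) i = fibCard f i := by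
  unfold fibCard
  refine Finset.card_equiv π fun x => ?_
  simp

theorem fibEmb_index (m : Blocks k n) (i : Fin k) {j : Fin (m.1 i)} {j' : Fin (fibCard m.index i)}
    (h : j.val = j'.val) : fibEmb m.index i j' = m.incl i j := by
  rw [fibEmb_of_monotone m.index.monotone]
  have key : ∀ (m' : Blocks k n) (hm : m' = m) (t : Fin (m'.1 i)), t.val = j.val →
      m'.incl i t = m.incl i j := by
    rintro _ rfl t ht
    rw [Fin.ext ht]
  exact key _ (fibBlocks_index m) j' h.symm

variable {f : Fin n → Fin l} {g : Fin l → Fin k} {h : Fin n → Fin k}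

/-- The sizes of the fibres of the map `f_i : h⁻¹(i) → g⁻¹(i)`, for `h = g ∘ f`. -/
def innerBlocks (c : ∀ x, h x = g (f x)) (i : Fin k) : Blocks (fibCard g i) (fibCard h i) :=
  ⟨fun j => fibCard f (fibEmb g i j), by
    rw [← sum_fibCard (fibMap c i)]
    exact Finset.sum_congr rfl fun j _ => (fibCard_fibMap c i j).symm⟩

end Sorted

/-- The diagram chase of `blockMul_assoc` with unspecified objects, so that equations between fibre
sizes do not obstruct rewriting. -/
theorem whiskerRight_comp_square {V : Type u} [Category.{v} V] [MonoidalCategory V]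
    {A A' P P' S S' Q W Y Z : V} {r : A ⟶ S ⊗ P} {c : S ⟶ S'} {z : A ⟶ A'} {r' : A' ⟶ S' ⊗ P'}
    {t : P' ⟶ P} {m : S' ⟶ Q} {a : Q ⟶ W} {b : W ⊗ P ⟶ Z} {m' : Q ⊗ P' ⟶ Y} {a' : Y ⟶ Z}
    (h : r ≫ c ▷ P = z ≫ r' ≫ S' ◁ t) (h' : m' ≫ a' = (a ⊗ₘ t) ≫ b) :
    r ≫ (c ≫ m ≫ a) ▷ P ≫ b = z ≫ (r' ≫ m ▷ P' ≫ m') ≫ a' := by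
  simp only [comp_whiskerRight, Category.assoc]
  rw [reassoc_of% h, h', MonoidalCategory.tensorHom_def', Category.assoc, whisker_exchange_assoc]

theorem whiskerLeft_tprodMap_square {V : Type u} [Category.{v} V] [MonoidalCategory V]
    (R : V) {k : ℕ} {D G C E : Fin k → V} {d : ∀ i, D i ⟶ G i} {g : ∀ i, G i ⟶ E i}
    {b : ∀ i, D i ⟶ C i} {c : ∀ i, C i ⟶ E i} (h : ∀ i, d i ≫ g i = b i ≫ c i) {X Y : V}
    (m : R ⊗ tprod E ⟶ X) (a : X ⟶ Y) :
    R ◁ tprodMap d ≫ (R ◁ tprodMap g ≫ m) ≫ a =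
      R ◁ tprodMap b ≫ (R ◁ tprodMap c ≫ m) ≫ a := by
  have e : tprodMap d ≫ tprodMap g = tprodMap b ≫ tprodMap c := by
    rw [← tprodMap_comp, ← tprodMap_comp, funext h]
  simp only [Category.assoc, ← whiskerLeft_comp_assoc, e]

namespace BraidedOperad

variable {V : Type u} [Category.{v} V] [MonoidalCategory V] [SymmetricCategory V]
variable (B : BraidedOperad V) {n l k : ℕ}

theorem mul_act_cable (σ : Fin n →o Fin k) (m : Blocks k n) (ρ : BraidGroup k)
    (h : ∀ i, fibCard σ (ρ.perm i) = m.1 i) :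
    B.mul σ ≫ B.act (cable ρ (fibBlocks σ)) =
      (B.act ρ ⊗ₘ (tprodSymm ρ.perm (fun i => B.obj (fibCard σ i)) ≫
        tprodMap fun i => eqToHom (congrArg B.obj (h i)))) ≫ B.blockMul m := by
  obtain rfl : (fibBlocks σ).permute ρ.perm = m := Subtype.ext (funext h)
  rw [tensorHom_comp_right]
  have e : B.obj k ◁ tprodMap (fun i => 𝟙 (B.obj (fibCard σ (ρ.perm i)))) ≫
      B.blockMul ((fibBlocks σ).permute ρ.perm) = B.blockMul ((fibBlocks σ).permute ρ.perm) := by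
    rw [tprodMap_id, whiskerLeft_id]
    exact Category.id_comp _
  refine Eq.trans ?_ (congrArg _ e.symm)
  have := B.blockMul_act_cable (fibBlocks σ) ρ
  rwa [blockMul_fibBlocks] at this

/-- Here `ω` is the order preserving form of `g`, and `σ` has the fibre sizes of `f` in the order
prescribed by `sortPerm g`. The operad is associative for these two maps, and the first equivariance
condition carries the braid of `g` through the multiplication of `σ`, where it becomes its cable. -/
theorem blockMul_assoc {f : Fin n → Fin l} {g : Fin l → Fin k} {h : Fin n → Fin k}
    (c : ∀ x, h x = g (f x)) :
    regroup g (B.obj k) (fun i => B.obj (fibCard g i)) (fun j => B.obj (fibCard f j)) ≫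
        (B.sortMul g ▷ tprod (fun j => B.obj (fibCard f j))) ≫ B.blockMul (fibBlocks f) =
      B.obj k ◁ tprodMap (fun i => B.blockMul (innerBlocks c i)) ≫ B.blockMul (fibBlocks h) ≫
        B.act (cable (posBraid (sortPerm g)) (fibBlocks fun x => sortPerm g (f x))) := by
  obtain ⟨ω, hω⟩ : ∃ ω, ω = (fibBlocks g).index := ⟨_, rfl⟩
  obtain ⟨σ, hσ⟩ : ∃ σ, σ = (fibBlocks fun x => sortPerm g (f x)).index := ⟨_, rfl⟩
  have bσ : fibBlocks (fun x => sortPerm g (f x)) = fibBlocks σ := by rw [hσ, fibBlocks_index]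
  have hc : ∀ i, fibCard g i = fibCard ω i := fun i => by rw [hω, fibCard_index]; rfl
  have hF : ∀ j, fibCard σ ((posBraid (sortPerm g)).perm j) = fibCard f j := fun j => by
    rw [hσ, fibCard_index, perm_posBraid]
    exact fibCard_perm_comp _ f j
  have he : ∀ i (j : Fin (fibCard g i)) (j' : Fin (fibCard ω i)), j.val = j'.val →
      fibEmb ω i j' = (posBraid (sortPerm g)).perm (fibEmb g i j) := by
    subst hω
    intro i j j' h
    rw [perm_posBraid, sortPerm_fibEmb]
    exact fibEmb_index _ i h
  have hF2 : ∀ i (j : Fin (fibCard g i)) (j' : Fin (fibCard ω i)), j.val = j'.val →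
      fibCard f (fibEmb g i j) = fibCard σ (fibEmb ω i j') := fun i j j' h => by
    rw [he i j j' h, hF]
  have hh : ∀ i, fibCard h i = fibCard (ω.comp σ) i := fun i => by
    rw [← fibCard_comp_perm (ω.comp σ) (sortPerm fun x => sortPerm g (f x))]
    refine congrArg (fun h => fibCard h i) (funext fun x => ?_)
    rw [orderHom_comp_apply, hσ, index_sortPerm, hω, index_sortPerm, c]
  have E : ∀ i, tprod (fun j => B.obj (fibCard f (fibEmb g i j))) =
      tprod (fun j => B.obj (fibCard σ (fibEmb ω i j))) := fun i =>
    tprod_congr (hc i) fun j j' h => congrArg B.obj (hF2 i j j' h)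
  have key := regroup_reindex (posBraid (sortPerm g)).perm (B.obj k)
    (P := fun i => B.obj (fibCard g i)) (P' := fun i => B.obj (fibCard ω i))
    (F := fun j => B.obj (fibCard f j)) (F' := fun j => B.obj (fibCard σ j))
    (fun i => congrArg B.obj (hc i)) (fun j => congrArg B.obj (hF j)) hc he E
  have e1 : B.sortMul g = (B.obj k ◁ tprodMap fun i => eqToHom (congrArg B.obj (hc i))) ≫
      B.mul ω ≫ B.act (posBraid (sortPerm g)) := by
    exact (congrArg (· ≫ _) (B.blockMul_eq ω hc)).trans (Category.assoc _ _ _)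
  have e2 : ∀ i, (eqToHom (congrArg B.obj (hc i)) ⊗ₘ eqToHom (E i)) ≫
      (B.obj (fibCard ω i) ◁ tprodMap (fun j =>
        eqToHom (congrArg B.obj (fibCard_fibHom σ ω i j).symm)) ≫ B.mul (fibHom σ ω i)) =
      B.blockMul (innerBlocks c i) ≫ eqToHom (congrArg B.obj (hh i)) := fun i => by
    have h1 := B.blockMul_eq (m := innerBlocks (orderHom_comp_apply σ ω) i) (fibHom σ ω i)
      fun j => (fibCard_fibHom σ ω i j).symm
    have h2 := B.blockMul_congr (hc i) (hh i) (m := innerBlocks c i)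
      (m' := innerBlocks (orderHom_comp_apply σ ω) i) (hF2 i) (E i)
    rw [← h2, h1]
    rfl
  have e3 : B.blockMul (fibBlocks h) = B.obj k ◁ tprodMap (fun i =>
      eqToHom (congrArg B.obj (hh i))) ≫ B.mul (ω.comp σ) := B.blockMul_eq (ω.comp σ) hh
  have e4 := B.mul_act_cable σ (fibBlocks f) (posBraid (sortPerm g)) hF
  have e5 := B.assoc σ ω
  have e6 := whiskerRight_comp_square (m := B.mul ω) key e4
  rw [e5] at e6
  rw [e1, bσ, e3]
  exact e6.trans (whiskerLeft_tprodMap_square _ e2 _ _)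

end BraidedOperad

/-! ## Some `2`-ordinals -/

namespace NOrdinal

/-- The `2`-ordinal in which `a <_1 b` for the elements of the same block and `a <_0 b` for elements
of different blocks. -/
abbrev ofBlocks {n : ℕ} (c : Fin n →o ℕ) : NOrdinal 2 where
  card := n
  lt p a b := a < b ∧ (c a = c b ↔ p = 1)
  irrefl p a h := lt_irrefl a h.1
  existsUnique a b h := by
    refine ⟨if c a = c b then 1 else 0, ?_, ?_⟩
    · rcases lt_or_gt_of_ne h with h | h
      · refine Or.inl ⟨h, ?_⟩
        split_ifs with h' <;> simp [h']
      · refine Or.inr ⟨h, ?_⟩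
        rw [eq_comm]
        split_ifs with h' <;> simp [h']
    · rintro p (⟨-, h'⟩ | ⟨-, h'⟩) <;> split_ifs <;> omega
  trans {p q a b d} h h' := by
    refine ⟨h.1.trans h'.1, ?_⟩
    have h1 := c.monotone h.1.le
    have h2 := c.monotone h'.1.le
    have e : c a = c d ↔ c a = c b ∧ c b = c d := by omega
    rw [e, h.2, h'.2]
    constructor
    · rintro ⟨rfl, rfl⟩
      rfl
    · intro h3
      constructor
      · have := min_le_left p q
        rw [h3] at this
        omega
      · have := min_le_right p q
        rw [h3] at this
        omega
  lt_of_lt h := h.1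

/-- The `2`-ordinal with one block. -/
abbrev oneBlock (n : ℕ) : NOrdinal 2 := ofBlocks (n := n) ⟨fun _ => 0, fun _ _ _ => le_rfl⟩

/-- The `2`-ordinal whose blocks have one element. -/
abbrev discrete (n : ℕ) : NOrdinal 2 := ofBlocks (n := n) ⟨Fin.val, fun _ _ h => h⟩

/-- The map to the `2`-ordinal with one block. -/
abbrev toOneBlock (T : NOrdinal 2) : T ⟶ oneBlock T.card where
  toFun := id
  cond {p i j} h := Or.inl ⟨1, by omega, T.lt_of_lt h, iff_of_true rfl rfl⟩

theorem isQuasibijection_toOneBlock (T : NOrdinal 2) : IsQuasibijection (toOneBlock T) :=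
  Function.bijective_id

/-- An arbitrary map, as a map of `2`-ordinals. -/
abbrev ofFun {n k : ℕ} (f : Fin n → Fin k) : discrete n ⟶ oneBlock k where
  toFun := f
  cond {p i j} h := by
    -- In `discrete n` only `<_0` occurs and in `oneBlock k` only `<_1`, so the images may come in
    -- either order.
    have hp : p = 0 := by
      have h1 := h.1.ne
      have h2 : i.val = j.val ↔ p = 1 := h.2
      omega
    rcases lt_trichotomy (f i) (f j) with h' | h' | h'
    · exact Or.inl ⟨1, by omega, h', iff_of_true rfl rfl⟩
    · exact Or.inr (Or.inl h')
    · exact Or.inr (Or.inr ⟨1, by omega, h', iff_of_true rfl rfl⟩)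

end NOrdinal

open NOrdinal

/-! ### Morphisms of operads commute with quasibijections. -/

section NOperads

variable {d : ℕ} {V : Type u} [Category.{v} V] [MonoidalCategory V] [SymmetricCategory V]

theorem NOperad.Hom.eqToHom_app {A B : NOperad d V} (G : A ⟶ B) {T S : NOrdinal d} (h : T = S) :
    eqToHom (congrArg A.obj h) ≫ G.app S = G.app T ≫ eqToHom (congrArg B.obj h) := by
  subst h
  simp

theorem NOperad.Hom.quasi {A B : NOperad d V} (G : A ⟶ B) {T S : NOrdinal d} (σ : T ⟶ S)
    (h : IsQuasibijection σ) : A.quasi σ h ≫ G.app T = G.app S ≫ B.quasi σ h := by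
  have e : (fun i => (A.unit ≫ eqToHom (congrArg A.obj (fibre_of_isQuasibijection h i).symm)) ≫
      G.app (fibre σ i)) =
      fun i => B.unit ≫ eqToHom (congrArg B.obj (fibre_of_isQuasibijection h i).symm) :=
    funext fun i => by
      rw [Category.assoc, NOperad.Hom.eqToHom_app G (fibre_of_isQuasibijection h i).symm,
        ← Category.assoc, G.unit]
  have e1 := tprodUnit_map (e := fun i => A.unit ≫ eqToHom (congrArg A.obj
    (fibre_of_isQuasibijection h i).symm)) fun i => G.app (fibre σ i)
  rw [NOperadData.quasi, Category.assoc, Category.assoc, G.mul, NOperadData.quasi, ← e, ← e1]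
  simp only [MonoidalCategory.tensorHom_def, whiskerLeft_comp, Category.assoc]
  rw [whisker_exchange_assoc, rightUnitor_inv_naturality_assoc]

end NOperads

/-! ## From braided operads to `2`-operads -/

theorem tprodMap_comp_square {V : Type u} [Category.{v} V] [MonoidalCategory V]
    {R A A' W W' Q Z : V} {k : ℕ} {F G H : Fin k → V} {t : ∀ i, F i ⟶ G i} {w : ∀ i, G i ⟶ H i}
    {r : R ⊗ tprod F ⟶ A} {s : A ⟶ A'} {b : A' ⟶ Q} {b' : R ⊗ tprod G ⟶ W} {c : W ⟶ Q} {a : Q ⟶ Z}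
    {d : W ⟶ W'} {a' : W' ⟶ Z} {b'' : R ⊗ tprod H ⟶ W'}
    (h1 : r ≫ s ≫ b = R ◁ tprodMap t ≫ b' ≫ c) (h2 : c ≫ a = d ≫ a')
    (h3 : b' ≫ d = R ◁ tprodMap w ≫ b'') :
    r ≫ s ≫ b ≫ a = R ◁ tprodMap (fun i => t i ≫ w i) ≫ b'' ≫ a' := by
  have h4 := congrArg (· ≫ a) h1
  simp only [Category.assoc] at h4
  rw [h4, h2, reassoc_of% h3, tprodMap_comp, whiskerLeft_comp, Category.assoc]

namespace BraidedOperad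

variable {V : Type u} [Category.{v} V] [MonoidalCategory V] [SymmetricCategory V]
variable (B : BraidedOperad V) {n l k : ℕ}

/-- `blockMul_assoc` leaves a cable followed by the braid of `f`. The comparison of braids rewrites
it as a direct sum followed by the braid of `h`, and the second equivariance condition distributes
the direct sum over the inner multiplications. -/
theorem sortMul_assoc {f : Fin n → Fin l} {g : Fin l → Fin k} {h : Fin n → Fin k}
    (c : ∀ x, h x = g (f x)) (hfg : ∀ x y, x < y → f y < f x → g (f y) ≤ g (f x)) :
    regroup g (B.obj k) (fun i => B.obj (fibCard g i)) (fun j => B.obj (fibCard f j)) ≫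
        (B.sortMul g ▷ tprod (fun j => B.obj (fibCard f j))) ≫ B.sortMul f =
      B.obj k ◁ tprodMap (fun i => B.obj (fibCard g i) ◁ tprodMap (fun j =>
            eqToHom (congrArg B.obj (fibCard_fibMap c i j).symm)) ≫ B.sortMul (fibMap c i)) ≫
        B.sortMul h := by
  have e1 := B.blockMul_assoc c
  have e2 := cable_posBraid_sortPerm c hfg
  have e3 := B.blockMul_act_directSum (fibBlocks h) fun i => posBraid (sortPerm (fibMap c i))
  have e4 : ∀ i, B.blockMul (innerBlocks c i) ≫ B.act (posBraid (sortPerm (fibMap c i))) =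
      (B.obj (fibCard g i) ◁ tprodMap (fun j =>
        eqToHom (congrArg B.obj (fibCard_fibMap c i j).symm)) ≫ B.sortMul (fibMap c i)) := fun i => by
    have := B.tprodMap_blockMul (m := innerBlocks c i) (m' := fibBlocks (fibMap c i))
      fun j => (fibCard_fibMap c i j).symm
    exact (congrArg (· ≫ _) this.symm).trans (Category.assoc _ _ _)
  have e5 : B.act (cable (posBraid (sortPerm g)) (fibBlocks fun x => sortPerm g (f x))) ≫
      B.act (posBraid (sortPerm f)) =
      B.act (directSum (fibBlocks h) fun i => posBraid (sortPerm (fibMap c i))) ≫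
      B.act (posBraid (sortPerm h)) := by
    rw [← B.act_mul, e2, B.act_mul]
  have e7 := funext e4
  rw [← e7]
  exact tprodMap_comp_square e1 e5 e3

/-- The operad with multiplications for all maps given by a braided operad. -/
noncomputable abbrev toCardOperad : CardOperad V where
  obj := B.obj
  unit := B.unit
  mul := B.sortMul
  assoc σ ω := B.sortMul_assoc (fn_comp_apply σ ω) (le_of_lt_of_lt σ ω)
  mul_unit n := by
    have h : B.sortMul (id : Fin n → Fin n) = B.mul OrderHom.id :=
      B.sortMul_of_monotone (OrderHom.id : Fin n →o Fin n)
    rw [h]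
    exact B.mul_unit n
  unit_mul {n} f := by
    obtain ⟨σ, rfl⟩ : ∃ σ : Fin n →o Fin 1, f = σ :=
      ⟨⟨f, fun _ _ _ => le_of_eq (Subsingleton.elim _ _)⟩, rfl⟩
    rw [sortMul_of_monotone]
    exact B.unit_mul σ

end BraidedOperad

open NOrdinal

theorem reassoc_eq {C : Type u} [Category.{v} C] {X Y Z W Q : C} (a : X ⟶ Y) (b : Y ⟶ Z) (c : Z ⟶ W)
    (d : W ⟶ Q) : (a ≫ b ≫ c) ≫ d = a ≫ b ≫ c ≫ d := by
  simp only [Category.assoc]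

namespace BraidedOperad

variable {V : Type u} [Category.{v} V] [MonoidalCategory V] [SymmetricCategory V]

section

variable (B : BraidedOperad V) {n : ℕ}

/-- All fibres of a bijection are points, so the order preserving part is the identity map; the unit
axiom removes it and leaves the braid. -/
theorem unit_sortMul {f : Fin n → Fin n} (hf : Function.Bijective f) :
    (ρ_ (B.obj n)).inv ≫ B.obj n ◁ tprodUnit (fun i => B.unit ≫
      eqToHom (congrArg B.obj (fibCard_bijective hf i).symm)) ≫ B.sortMul f =
    B.act (posBraid (sortPerm f)) := by
  have h : ∀ i, fibCard f i = fibCard (OrderHom.id : Fin n →o Fin n) i := fun i =>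
    (fibCard_bijective hf i).trans (fibCard_bijective Function.bijective_id i).symm
  have e1 : B.sortMul f = B.obj n ◁ tprodMap (fun i => eqToHom (congrArg B.obj (h i))) ≫
      B.mul OrderHom.id ≫ B.act (posBraid (sortPerm f)) :=
    (congrArg (· ≫ _) (B.blockMul_eq (m := fibBlocks f) OrderHom.id h)).trans
      (Category.assoc _ _ _)
  have e2 := tprodUnit_map (e := fun i => B.unit ≫
    eqToHom (congrArg B.obj (fibCard_bijective hf i).symm)) fun i => eqToHom (congrArg B.obj (h i))
  have e3 := B.mul_unit n
  rw [e1, ← whiskerLeft_comp_assoc, e2]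
  simp only [Category.assoc, eqToHom_trans]
  have h4 := congrArg (· ≫ B.act (posBraid (sortPerm f))) e3
  refine Eq.trans ?_ (h4.trans (Category.id_comp _))
  exact (reassoc_eq _ _ _ _).symm

/-- The `2`-operad given by a braided operad. -/
noncomputable abbrev toNOperad : NOperad 2 V := B.toCardOperad.toNOperad

/-- Quasibijections act by positive braids. The permutation `f` is a separate argument because the
cardinalities of `T` and `S` agree only propositionally. -/
theorem toNOperad_quasi (f : Equiv.Perm (Fin n)) {T S : NOrdinal 2} (hT : T.card = n)
    (hS : S.card = n) (σ : T ⟶ S) (h : IsQuasibijection σ)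
    (hσ : ∀ x, (fn σ x).val = (f (x.cast hT)).val) :
    B.toNOperad.quasi σ h = eqToHom (congrArg B.obj hS) ≫ B.act (posBraid f) ≫
      eqToHom (congrArg B.obj hT.symm) := by
  obtain ⟨n', lt, h1, h2, h3, h4⟩ := T
  obtain ⟨m', lt', h1', h2', h3', h4'⟩ := S
  simp only at hT hS
  subst hT
  subst hS
  have e : fn σ = f := funext fun x => Fin.ext (hσ x)
  have := (B.unit_sortMul h).trans
    (congrArg (fun f => B.act (posBraid f)) ((congrArg sortPerm e).trans (sortPerm_perm f)))
  refine Eq.trans ?_ ((Category.id_comp _).trans (Category.comp_id _)).symm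
  exact this

instance (ρ : BraidGroup n) : IsIso (B.act ρ) :=
  ⟨B.act ρ⁻¹, by rw [← B.act_mul, mul_inv_cancel, B.act_one],
    by rw [← B.act_mul, inv_mul_cancel, B.act_one]⟩

theorem isQuasisymmetric_toNOperad : IsQuasisymmetric 2 V B.toNOperad := by
  intro T S σ h
  have hc : T.card = S.card := by simpa using Fintype.card_of_bijective h
  rw [B.toNOperad_quasi ((finCongr hc.symm).trans (Equiv.ofBijective _ h)) hc rfl σ h
    fun x => rfl]
  infer_instance

end

section

variable {A B : BraidedOperad V} (φ : A ⟶ B) {n k : ℕ}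

theorem Hom.blockMul (m : Blocks k n) :
    A.blockMul m ≫ φ.app n = (φ.app k ⊗ₘ tprodMap fun i => φ.app (m.1 i)) ≫ B.blockMul m := by
  obtain ⟨σ, rfl⟩ : ∃ σ : Fin n →o Fin k, m = fibBlocks σ := ⟨m.index, (fibBlocks_index m).symm⟩
  rw [A.blockMul_fibBlocks, B.blockMul_fibBlocks]
  exact φ.mul σ

theorem Hom.sortMul (f : Fin n → Fin k) :
    A.sortMul f ≫ φ.app n = (φ.app k ⊗ₘ tprodMap fun i => φ.app (fibCard f i)) ≫ B.sortMul f := by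
  have h := congrArg (· ≫ B.act (posBraid (sortPerm f))) (φ.blockMul (fibBlocks f))
  simp only [Category.assoc, ← φ.act] at h
  exact (Category.assoc _ _ _).trans h

/-- The morphism of `2`-operads given by a morphism of braided operads. -/
abbrev Hom.toNOperad : A.toNOperad ⟶ B.toNOperad where
  app T := φ.app T.card
  unit := φ.unit
  mul σ := φ.sortMul (fn σ)

/-- `toOneBlock T` is the identity on points, so it acts trivially in both operads, and naturality
for it identifies the two components. -/
theorem toNOperad_hom_app (G : A.toNOperad ⟶ B.toNOperad) (T : NOrdinal 2) :
    G.app T = G.app (oneBlock T.card) := by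
  have h := G.quasi (toOneBlock T) (isQuasibijection_toOneBlock T)
  have e := fun B : BraidedOperad V => B.toNOperad_quasi 1 (T := T) (S := oneBlock T.card) rfl rfl
    (toOneBlock T) (isQuasibijection_toOneBlock T) fun _ => rfl
  rw [e A, e B, posBraid_one, A.act_one, B.act_one] at h
  simpa using h

/-- The generator at `i` is the action of the quasibijection `ofFun (adjSwap i)`, with which every
morphism of `2`-operads commutes; the other braids follow by multiplicativity. -/
theorem toNOperad_hom_act (G : A.toNOperad ⟶ B.toNOperad) (ρ : BraidGroup n) :
    A.act ρ ≫ G.app (oneBlock n) = G.app (oneBlock n) ≫ B.act ρ := by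
  induction ρ using BraidGroup.induction with
  | of i =>
    have h := G.quasi (ofFun (adjSwap i)) (adjSwap i).bijective
    have e := fun B : BraidedOperad V => B.toNOperad_quasi (adjSwap i) (T := discrete n)
      (S := oneBlock n) rfl rfl (ofFun (adjSwap i)) (adjSwap i).bijective fun _ => rfl
    rw [e A, e B, posBraid_adjSwap, toNOperad_hom_app G (discrete n)] at h
    simpa using h
  | one => rw [A.act_one, B.act_one, Category.id_comp, Category.comp_id]
  | mul a b ha hb => rw [A.act_mul, B.act_mul, Category.assoc, hb, reassoc_of% ha]
  | inv a ha =>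
    rw [← cancel_epi (A.act a), reassoc_of% ha, ← Category.assoc, ← A.act_mul,
      ← B.act_mul, mul_inv_cancel, A.act_one, B.act_one, Category.comp_id, Category.id_comp]

/-- The morphism of braided operads given by a morphism of `2`-operads. -/
abbrev homOfToNOperad (G : A.toNOperad ⟶ B.toNOperad) : A ⟶ B where
  app n := G.app (oneBlock n)
  act ρ := toNOperad_hom_act G ρ
  unit := by
    rw [← toNOperad_hom_app G (terminal 2)]
    exact G.unit
  mul {n k} σ := by
    -- For an order preserving function the sorting braid is trivial, so this multiplication is that
    -- of the braided operad.
    have h := G.mul (ofFun σ)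
    have e : (fun i => G.app (fibre (ofFun σ) i)) = fun i => G.app (oneBlock (fibCard σ i)) :=
      funext fun i => toNOperad_hom_app G _
    rw [e, toNOperad_hom_app G (discrete n)] at h
    have e1 : ∀ B : BraidedOperad V, B.toNOperad.mul (ofFun σ) = B.mul σ := fun B =>
      B.sortMul_of_monotone σ
    rw [e1, e1] at h
    exact h

end

variable (V) in
/-- The functor from braided operads to `2`-operads. -/
noncomputable abbrev toNOperadFunctor : BraidedOperad V ⥤ NOperad 2 V where
  obj B := B.toNOperad
  map φ := φ.toNOperad

instance : (toNOperadFunctor V).Faithful where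
  map_injective {A B _ _} h := BraidedOperad.Hom.ext (funext fun n =>
    congrArg (fun G : A.toNOperad ⟶ B.toNOperad => G.app (oneBlock n)) h)

instance : (toNOperadFunctor V).Full where
  map_surjective G := ⟨homOfToNOperad G, NOperad.Hom.ext (funext fun T =>
    (toNOperad_hom_app G T).symm)⟩

end BraidedOperad

open NOrdinal

/-! ## Transport of structure -/

section Transport

variable {d : ℕ} {V : Type u} [Category.{v} V] [MonoidalCategory V] [SymmetricCategory V]

theorem eqToHom_iso_hom {κ : Type*} {F G : κ → V} (φ : ∀ t, F t ≅ G t) {s t : κ} (h : s = t) :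
    eqToHom (congrArg F h) ≫ (φ t).hom = (φ s).hom ≫ eqToHom (congrArg G h) := by
  subst h
  simp

theorem tprodOne_map {F G : Fin 1 → V} (f : ∀ i, F i ⟶ G i) :
    tprodOne F ≫ tprodMap f = f 0 ≫ tprodOne G := by
  have h : (ρ_ (F 0)).inv ≫ (f 0 ⊗ₘ 𝟙 (𝟙_ V)) = f 0 ≫ (ρ_ (G 0)).inv := by simp
  exact h

theorem rightUnitor_inv_tensorHom {X Y P P' Z W : V} (e : 𝟙_ V ⟶ P) (f : X ⟶ Y) (t : P ⟶ P')
    (m : Y ⊗ P' ⟶ Z) (i : Z ⟶ W) :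
    (ρ_ X).inv ≫ X ◁ e ≫ (f ⊗ₘ t) ≫ m ≫ i =
      f ≫ ((ρ_ Y).inv ≫ Y ◁ (e ≫ t) ≫ m) ≫ i := by
  simp [MonoidalCategory.tensorHom_def, whisker_exchange_assoc]

theorem leftUnitor_inv_tensorHom {U U' X Y P P' : V} (u : 𝟙_ V ⟶ U') (a : U ≅ U') (b : X ≅ Y)
    {t : X ⟶ P} {p : P ⟶ P'} {t' : Y ⟶ P'} (m : U' ⊗ P' ⟶ Y) (h : t ≫ p = b.hom ≫ t')
    (h' : (λ_ Y).inv ≫ u ▷ Y ≫ U' ◁ t' ≫ m = 𝟙 Y) :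
    (λ_ X).inv ≫ (u ≫ a.inv) ▷ X ≫ U ◁ t ≫ (a.hom ⊗ₘ p) ≫ m ≫ b.inv = 𝟙 X := by
  have e : (λ_ X).inv ≫ (u ≫ a.inv) ▷ X ≫ U ◁ t ≫ (a.hom ⊗ₘ p) ≫ m ≫ b.inv =
      b.hom ≫ ((λ_ Y).inv ≫ u ▷ Y ≫ U' ◁ t' ≫ m) ≫ b.inv := by
    rw [MonoidalCategory.tensorHom_def', Category.assoc, ← whiskerLeft_comp_assoc, h]
    simp only [comp_whiskerRight, whiskerLeft_comp, Category.assoc]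
    rw [← whisker_exchange_assoc, ← whisker_exchange_assoc]
    simp [whisker_exchange_assoc]
  rw [e, h', Category.id_comp, Iso.hom_inv_id]

variable (A : NOperad d V) {X : NOrdinal d → V} (φ : ∀ T, X T ≅ A.obj T)

/-- The multiplications on objects isomorphic to those of an operad. -/
abbrev NOperad.transportMul {T S : NOrdinal d} (σ : T ⟶ S) :
    X S ⊗ tprod (fun i => X (fibre σ i)) ⟶ X T :=
  ((φ S).hom ⊗ₘ tprodMap fun i => (φ (fibre σ i)).hom) ≫ A.mul σ ≫ (φ T).inv

/-- The data of an operad on objects isomorphic to those of a given operad. -/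
abbrev NOperad.transportData : NOperadData d V where
  obj := X
  unit := A.unit ≫ (φ (terminal d)).inv
  mul σ := A.transportMul φ σ

theorem NOperad.transport_assoc {T S R : NOrdinal d} (σ : T ⟶ S) (ω : S ⟶ R) :
    regroup (fn ω) (X R) (fun i => X (fibre ω i)) (fun j => X (fibre σ j)) ≫
        A.transportMul φ ω ▷ tprod (fun j => X (fibre σ j)) ≫ A.transportMul φ σ =
      X R ◁ tprodMap (fun i =>
          X (fibre ω i) ◁ tprodMap (fun j =>
            eqToHom (congrArg X (fibre_fibreMap σ ω i j).symm)) ≫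
              A.transportMul φ (fibreMap σ ω i)) ≫
        A.transportMul φ (σ ≫ ω) := by
  have e1 : A.transportMul φ ω ▷ tprod (fun j => X (fibre σ j)) ≫ A.transportMul φ σ =
      (((φ R).hom ⊗ₘ tprodMap fun i => (φ (fibre ω i)).hom) ⊗ₘ
        tprodMap fun j => (φ (fibre σ j)).hom) ≫
      A.mul ω ▷ _ ≫ A.mul σ ≫ (φ T).inv := by
    simp only [NOperad.transportMul, comp_whiskerRight, Category.assoc]
    rw [← tensorHom_id (φ S).inv, tensorHom_comp_tensorHom_assoc, Iso.inv_hom_id,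
      Category.id_comp, id_tensorHom, ← whisker_exchange_assoc]
    simp only [MonoidalCategory.tensorHom_def ((φ R).hom ⊗ₘ _), Category.assoc]
  have e2 : ∀ i, X (fibre ω i) ◁ tprodMap (fun j =>
      eqToHom (congrArg X (fibre_fibreMap σ ω i j).symm)) ≫ A.transportMul φ (fibreMap σ ω i) =
      ((φ (fibre ω i)).hom ⊗ₘ tprodMap fun j => (φ (fibre σ (fibEmb (fn ω) i j))).hom) ≫
      (A.obj (fibre ω i) ◁ tprodMap (fun j =>
      eqToHom (congrArg A.obj (fibre_fibreMap σ ω i j).symm)) ≫ A.mul (fibreMap σ ω i)) ≫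
      (φ (fibre (σ ≫ ω) i)).inv := fun i => by
    have h : tprodMap (fun j => eqToHom (congrArg X (fibre_fibreMap σ ω i j).symm)) ≫
        tprodMap (fun j => (φ (fibre (fibreMap σ ω i) j)).hom) =
        tprodMap (fun j => (φ (fibre σ (fibEmb (fn ω) i j))).hom) ≫
        tprodMap (fun j => eqToHom (congrArg A.obj (fibre_fibreMap σ ω i j).symm)) := by
      rw [← tprodMap_comp, ← tprodMap_comp]
      exact congrArg tprodMap (funext fun j => eqToHom_iso_hom φ (fibre_fibreMap σ ω i j).symm)
    rw [NOperad.transportMul, ← id_tensorHom, tensorHom_comp_tensorHom_assoc, h,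
      Category.id_comp, Category.assoc]
    exact tensorHom_comp_right _ _ _ _
  have e3 := regroup_naturality (fn ω) (φ R).hom (fun i => (φ (fibre ω i)).hom)
    (fun j => (φ (fibre σ j)).hom)
  have e4 : ∀ (i : Fin R.card), (φ (fibre (σ ≫ ω) i)).inv ≫ (φ (fibre (σ ≫ ω) i)).hom = 𝟙 _ :=
    fun i => Iso.inv_hom_id _
  rw [funext e2, e1, ← reassoc_of% e3, reassoc_of% (A.assoc σ ω), NOperad.transportMul,
    ← id_tensorHom (X R), tensorHom_comp_tensorHom_assoc, Category.id_comp, ← tprodMap_comp,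
    ← tensorHom_comp_right]
  rw [← tprodMap_comp]
  simp only [Category.assoc, Iso.inv_hom_id, Category.comp_id]

theorem NOperad.transportData_quasi {T S : NOrdinal d} (σ : T ⟶ S) (h : IsQuasibijection σ) :
    (A.transportData φ).quasi σ h = (φ S).hom ≫ A.quasi σ h ≫ (φ T).inv := by
  have e1 : tprodUnit (fun i => (A.unit ≫ (φ (terminal d)).inv) ≫
        eqToHom (congrArg X (fibre_of_isQuasibijection h i).symm)) ≫
      tprodMap (fun i => (φ (fibre σ i)).hom) =
      tprodUnit fun i => A.unit ≫
        eqToHom (congrArg A.obj (fibre_of_isQuasibijection h i).symm) := by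
    rw [tprodUnit_map]
    refine congrArg tprodUnit (funext fun i => ?_)
    rw [Category.assoc, eqToHom_iso_hom φ (fibre_of_isQuasibijection h i).symm, Category.assoc,
      Iso.inv_hom_id_assoc]
  rw [NOperadData.quasi, NOperadData.quasi, ← e1]
  exact rightUnitor_inv_tensorHom _ _ _ _ _

/-- Transport of the structure of an operad along isomorphisms of its objects. -/
abbrev NOperad.transport : NOperad d V where
  toNOperadData := A.transportData φ
  assoc := A.transport_assoc φ
  mul_unit T := by
    rw [A.transportData_quasi φ, A.mul_unit, Category.id_comp, Iso.hom_inv_id]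
  unit_mul {T} σ := by
    refine leftUnitor_inv_tensorHom _ (φ (terminal d)) (φ T) _ ?_ (A.unit_mul σ)
    have h := eqToHom_iso_hom φ (fibre_terminal σ (0 : Fin 1)).symm
    rw [Category.assoc, tprodOne_map]
    exact (reassoc_of% h) _

end Transport

open NOrdinal

/-! ## From quasisymmetric `2`-operads to operads indexed by cardinalities -/

section Normalize

variable {V : Type u} [Category.{v} V] [MonoidalCategory V] [SymmetricCategory V]

/-- The map from the `2`-ordinal with blocks of one element, with the identity as underlying map. -/
abbrev NOrdinal.fromDiscrete (T : NOrdinal 2) : discrete T.card ⟶ T where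
  toFun := id
  cond {p i j} h := by
    have hp : p = 0 := by
      have h1 := h.1.ne
      have h2 : i.val = j.val ↔ p = 1 := h.2
      omega
    obtain ⟨q, hq, -⟩ := T.existsUnique i j h.1.ne
    have hq : T.lt q i j := hq.resolve_right fun h' => lt_asymm h.1 (T.lt_of_lt h')
    exact Or.inl ⟨q, by omega, hq⟩

variable (A : NOperad 2 V) (hA : IsQuasisymmetric 2 V A)

namespace NOperad

/-- The objects of a quasisymmetric `2`-operad depend only on cardinalities, up to isomorphism. -/
noncomputable def cardIso (T : NOrdinal 2) : A.obj (oneBlock T.card) ≅ A.obj T :=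
  haveI := hA (toOneBlock T) (isQuasibijection_toOneBlock T)
  asIso (A.quasi (toOneBlock T) (isQuasibijection_toOneBlock T))

/-- `toOneBlock (oneBlock n)` is the identity map. This normalisation makes every `toOneBlock T` act
as an identity after the transport. -/
theorem cardIso_oneBlock (n : ℕ) : A.cardIso hA (oneBlock n) = Iso.refl _ :=
  Iso.ext (A.mul_unit (oneBlock n))

end NOperad

section CardData

variable {X : ℕ → V} {e : 𝟙_ V ⟶ X 1}
  {m : ∀ {T S : NOrdinal 2} (σ : T ⟶ S),
    X S.card ⊗ tprod (fun i => X (fibCard (fn σ) i)) ⟶ X T.card}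

variable (X e m) in
/-- The data of a `2`-operad whose objects depend only on cardinalities. -/
abbrev cardData : NOperadData 2 V where
  obj T := X T.card
  unit := e
  mul σ := m σ

/-- If `σ` is the identity on points, then `σ ≫ toOneBlock S` is `toOneBlock T` up to the equality
of cardinalities. Functoriality and `hq` leave nothing but this equality. -/
theorem cardData_quasi {N : NOperad 2 V}
    (hN : N.toNOperadData = cardData X e m)
    (hq : ∀ T, (cardData X e m).quasi (toOneBlock T) (isQuasibijection_toOneBlock T) =
      𝟙 (X T.card))
    {T S : NOrdinal 2} (σ : T ⟶ S) (hc : S.card = T.card)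
    (hσ : ∀ x, (fn σ x).val = x.val) (h : IsQuasibijection σ) :
    (cardData X e m).quasi σ h = eqToHom (congrArg X hc) := by
  have key : ∀ (k : ℕ) (hk : k = T.card) (τ : T ⟶ oneBlock k) (hτ : ∀ x, (fn τ x).val = x.val)
      (h : IsQuasibijection τ), (cardData X e m).quasi τ h = eqToHom (congrArg X hk) := by
    rintro _ rfl τ hτ h
    obtain rfl : τ = toOneBlock T := NOrdinal.Hom.ext (funext fun x => Fin.ext (hτ x))
    exact hq T
  have e := N.quasi_comp σ (toOneBlock S) h (isQuasibijection_toOneBlock S)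
  rw [hN] at e
  rw [hq S] at e
  exact ((Category.id_comp _).symm.trans e.symm).trans (key _ hc _ hσ _)

/-- The composite of `fromDiscrete T`, `σ` and `toOneBlock S` is `ofFun (fn σ)`. The two outer maps
are the identity on points, so by `mul_quasi` and `quasi_mul` composing with them does not change
the multiplication. -/
theorem cardData_mul {N : NOperad 2 V}
    (hN : N.toNOperadData = cardData X e m)
    (hq : ∀ T, (cardData X e m).quasi (toOneBlock T) (isQuasibijection_toOneBlock T) =
      𝟙 (X T.card))
    {T S : NOrdinal 2} (σ : T ⟶ S) : m σ = m (ofFun (fn σ)) := by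
  have hδ : IsQuasibijection (fromDiscrete T) := Function.bijective_id
  have e0 : ∀ x, (fn (fromDiscrete T) x).val = x.val := fun _ => rfl
  have ec : T.card = (discrete T.card).card := rfl
  have e1 : (cardData X e m).quasi (fromDiscrete T) hδ = 𝟙 (X T.card) :=
    (cardData_quasi hN hq (fromDiscrete T) ec e0 hδ).trans (eqToHom_refl _ _)
  have e2 : ∀ i, (cardData X e m).quasi (fibreMap (fromDiscrete T) σ i)
      (isQuasibijection_fibreMap hδ σ i) = 𝟙 (X (fibCard (fn σ) i)) := fun i => by
    have e3 : ∀ x, (fn (fibreMap (fromDiscrete T) σ i) x).val = x.val := fun x =>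
      congrArg Fin.val ((fibEmb (fn σ) i).injective
        (fibEmb_fibMap (fn_comp_apply (fromDiscrete T) σ) i x))
    have e4 : (fibre σ i).card = (fibre (fromDiscrete T ≫ σ) i).card := rfl
    exact (cardData_quasi hN hq (fibreMap (fromDiscrete T) σ i) e4 e3
      (isQuasibijection_fibreMap hδ σ i)).trans (eqToHom_refl _ _)
  have h1 : m σ ≫ (cardData X e m).quasi (fromDiscrete T) hδ =
      X S.card ◁ tprodMap (fun i => (cardData X e m).quasi (fibreMap (fromDiscrete T) σ i)
        (isQuasibijection_fibreMap hδ σ i)) ≫ m (fromDiscrete T ≫ σ) := by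
    have key : ∀ D : NOperadData 2 V, N.toNOperadData = D → D.mul σ ≫ D.quasi (fromDiscrete T) hδ =
        D.obj S ◁ tprodMap (fun i => D.quasi (fibreMap (fromDiscrete T) σ i)
          (isQuasibijection_fibreMap hδ σ i)) ≫ D.mul (fromDiscrete T ≫ σ) := by
      rintro _ rfl
      exact N.mul_quasi (fromDiscrete T) σ hδ
    exact key _ hN
  have h2 : X S.card ◁ 𝟙 _ ≫ (cardData X e m).quasi (toOneBlock S)
      (isQuasibijection_toOneBlock S) ▷ _ ≫ m (fromDiscrete T ≫ σ) =
      m ((fromDiscrete T ≫ σ) ≫ toOneBlock S) := by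
    have key : ∀ D : NOperadData 2 V, N.toNOperadData = D →
        D.obj (oneBlock S.card) ◁ 𝟙 (tprod fun i => D.obj (fibre (fromDiscrete T ≫ σ) i)) ≫
          D.quasi (toOneBlock S) (isQuasibijection_toOneBlock S) ▷ _ ≫ D.mul (fromDiscrete T ≫ σ) =
        D.mul ((fromDiscrete T ≫ σ) ≫ toOneBlock S) := by
      rintro _ rfl
      exact N.quasi_mul (fromDiscrete T ≫ σ) (toOneBlock S) (isQuasibijection_toOneBlock S)
        (w := id) (fun _ => rfl) (IsCan.id _)
    exact key _ hN
  rw [e1, funext e2] at h1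
  rw [hq S] at h2
  have h3 : m σ = m (fromDiscrete T ≫ σ) := by
    refine (Category.comp_id _).symm.trans (h1.trans ?_)
    have : X S.card ◁ tprodMap (fun i => 𝟙 (X (fibCard (fn σ) i))) ≫ m (fromDiscrete T ≫ σ) =
        m (fromDiscrete T ≫ σ) := by
      rw [tprodMap_id, whiskerLeft_id]
      exact Category.id_comp _
    exact this
  refine h3.trans (Eq.trans ?_ h2)
  rw [whiskerLeft_id, id_whiskerRight]
  exact ((Category.id_comp _).trans (Category.id_comp _)).symm

end CardData

end Normalize

open NOrdinal

section

variable {d : ℕ} {V : Type u} [Category.{v} V] [MonoidalCategory V] [SymmetricCategory V]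

/-- An isomorphism of operads from isomorphisms of objects which are compatible with units and
multiplications. -/
def NOperad.isoMk {A B : NOperad d V} (φ : ∀ T, A.obj T ≅ B.obj T)
    (hu : A.unit ≫ (φ (terminal d)).hom = B.unit)
    (hm : ∀ {T S : NOrdinal d} (σ : T ⟶ S), A.mul σ ≫ (φ T).hom =
      ((φ S).hom ⊗ₘ tprodMap fun i => (φ (fibre σ i)).hom) ≫ B.mul σ) : A ≅ B where
  hom :=
    { app := fun T => (φ T).hom
      unit := hu
      mul := hm }
  inv :=
    { app := fun T => (φ T).inv
      unit := by rw [← hu, Category.assoc, Iso.hom_inv_id, Category.comp_id]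
      mul := fun {T S} σ => by
        have e : tprodMap (fun i => (φ (fibre σ i)).inv) ≫
            tprodMap (fun i => (φ (fibre σ i)).hom) = 𝟙 _ := by
          rw [← tprodMap_comp]
          simp only [Iso.inv_hom_id]
          exact tprodMap_id _
        rw [Iso.comp_inv_eq, Category.assoc, hm, tensorHom_comp_tensorHom_assoc, e,
          Iso.inv_hom_id, id_tensorHom_id, Category.id_comp] }
  hom_inv_id := NOperad.Hom.ext (funext fun T => (φ T).hom_inv_id)
  inv_hom_id := NOperad.Hom.ext (funext fun T => (φ T).inv_hom_id)

end

section

variable {V : Type u} [Category.{v} V] [MonoidalCategory V] [SymmetricCategory V]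

theorem assoc_congr {R A P Q Z : V} {k : ℕ} {F G H : Fin k → V} {r : R ⊗ tprod F ⟶ A ⊗ P}
    {a a' : A ⟶ Q} {b b' : Q ⊗ P ⟶ Z} {q : ∀ i, F i ⟶ G i} {c c' : ∀ i, G i ⟶ H i}
    {t t' : R ⊗ tprod H ⟶ Z} (ha : a = a') (hb : b = b') (hc : ∀ i, c i = c' i) (ht : t = t')
    (h : r ≫ a ▷ P ≫ b = R ◁ tprodMap (fun i => q i ≫ c i) ≫ t) :
    r ≫ a' ▷ P ≫ b' = R ◁ tprodMap (fun i => q i ≫ c' i) ≫ t' := by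
  obtain rfl := ha
  obtain rfl := hb
  obtain rfl := funext hc
  obtain rfl := ht
  exact h

variable {X : ℕ → V} {e : 𝟙_ V ⟶ X 1}
  {m : ∀ {T S : NOrdinal 2} (σ : T ⟶ S),
    X S.card ⊗ tprod (fun i => X (fibCard (fn σ) i)) ⟶ X T.card}

/-- A `2`-operad whose objects depend only on cardinalities, if the canonical morphisms between
objects of the same cardinality are identities. -/
abbrev CardOperad.ofNOperad {N : NOperad 2 V} (hN : N.toNOperadData = cardData X e m)
    (hq : ∀ T, (cardData X e m).quasi (toOneBlock T) (isQuasibijection_toOneBlock T) =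
      𝟙 (X T.card)) : CardOperad V where
  obj := X
  unit := e
  mul f := m (ofFun f)
  assoc {T S R} σ ω := by
    -- Stated for variable data `D`, so that the equation `hN` can be substituted without rewriting
    -- inside dependent types.
    have key : ∀ D : NOperadData 2 V, N.toNOperadData = D →
        regroup (fn ω) (D.obj R) (fun i => D.obj (fibre ω i)) (fun j => D.obj (fibre σ j)) ≫
            D.mul ω ▷ tprod (fun j => D.obj (fibre σ j)) ≫ D.mul σ =
          D.obj R ◁ tprodMap (fun i => D.obj (fibre ω i) ◁ tprodMap (fun j =>
            eqToHom (congrArg D.obj (fibre_fibreMap σ ω i j).symm)) ≫ D.mul (fibreMap σ ω i)) ≫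
          D.mul (σ ≫ ω) := by
      rintro _ rfl
      exact N.assoc σ ω
    exact assoc_congr (cardData_mul hN hq ω) (cardData_mul hN hq σ)
      (fun i => cardData_mul hN hq (fibreMap σ ω i)) (cardData_mul hN hq (σ ≫ ω)) (key _ hN)
  mul_unit n := by
    have h := cardData_quasi hN hq (ofFun (id : Fin n → Fin n)) rfl (fun _ => rfl)
      Function.bijective_id
    exact h.trans (eqToHom_refl _ _)
  unit_mul {n} f := by
    have key : ∀ D : NOperadData 2 V, N.toNOperadData = D → ∀ σ : discrete n ⟶ terminal 2,
        (λ_ (D.obj (discrete n))).inv ≫ D.unit ▷ D.obj (discrete n) ≫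
        D.obj (terminal 2) ◁ (eqToHom (congrArg D.obj (fibre_terminal σ (0 : Fin 1)).symm) ≫
          tprodOne (fun i => D.obj (fibre σ i))) ≫
        D.mul σ = 𝟙 (D.obj (discrete n)) := by
      rintro _ rfl σ
      exact N.unit_mul σ
    -- Every function to a point underlies a map to the terminal `2`-ordinal, because all its values
    -- coincide.
    have h := key _ hN ⟨f, fun _ => Or.inr (Or.inl (Subsingleton.elim _ _))⟩
    have h1 := cardData_mul hN hq
      (⟨f, fun _ => Or.inr (Or.inl (Subsingleton.elim _ _))⟩ : discrete n ⟶ terminal 2)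
    exact (congrArg (fun t => _ ≫ _ ≫ _ ≫ t) h1.symm).trans h

end

section

variable {V : Type u} [Category.{v} V] [MonoidalCategory V] [SymmetricCategory V]
variable (A : NOperad 2 V) (hA : IsQuasisymmetric 2 V A)

namespace NOperad

theorem cardData_cardIso_quasi (T : NOrdinal 2) :
    (A.transportData (X := fun T => A.obj (oneBlock T.card)) (A.cardIso hA)).quasi (toOneBlock T)
      (isQuasibijection_toOneBlock T) = 𝟙 (A.obj (oneBlock T.card)) := by
  refine (A.transportData_quasi (A.cardIso hA) _ _).trans ?_
  rw [cardIso_oneBlock]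
  have h : (A.cardIso hA T).hom ≫ (A.cardIso hA T).inv = 𝟙 (A.obj (oneBlock T.card)) :=
    Iso.hom_inv_id _
  exact (Category.id_comp _).trans h

/-- The operad with objects indexed by cardinalities given by a quasisymmetric `2`-operad. -/
noncomputable abbrev toCardOperad : CardOperad V :=
  CardOperad.ofNOperad (X := fun n => A.obj (oneBlock n))
    (e := A.unit ≫ (A.cardIso hA (terminal 2)).inv)
    (m := fun σ => A.transportMul (X := fun T => A.obj (oneBlock T.card)) (A.cardIso hA) σ)
    (N := A.transport (A.cardIso hA)) rfl (A.cardData_cardIso_quasi hA)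

theorem toCardOperad_mul {T S : NOrdinal 2} (σ : T ⟶ S) :
    A.transportMul (X := fun T => A.obj (oneBlock T.card)) (A.cardIso hA) σ =
      (A.toCardOperad hA).mul (fn σ) :=
  cardData_mul (X := fun n => A.obj (oneBlock n))
    (e := A.unit ≫ (A.cardIso hA (terminal 2)).inv)
    (m := fun σ => A.transportMul (X := fun T => A.obj (oneBlock T.card)) (A.cardIso hA) σ)
    (N := A.transport (A.cardIso hA)) rfl (A.cardData_cardIso_quasi hA) σ

/-- A quasisymmetric `2`-operad is isomorphic to one with objects indexed by cardinalities. -/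
noncomputable def toCardOperadIso : (A.toCardOperad hA).toNOperad ≅ A :=
  NOperad.isoMk (A.cardIso hA)
    (by
      have h : (A.cardIso hA (terminal 2)).inv ≫ (A.cardIso hA (terminal 2)).hom = 𝟙 _ :=
        Iso.inv_hom_id _
      exact (Category.assoc _ _ _).trans ((congrArg (A.unit ≫ ·) h).trans (Category.comp_id _)))
    (fun {T S} σ => by
      have h : (A.cardIso hA T).inv ≫ (A.cardIso hA T).hom = 𝟙 _ := Iso.inv_hom_id _
      have h1 : A.transportMul (X := fun T => A.obj (oneBlock T.card)) (A.cardIso hA) σ ≫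
          (A.cardIso hA T).hom = ((A.cardIso hA S).hom ⊗ₘ
            tprodMap fun i => (A.cardIso hA (fibre σ i)).hom) ≫ A.mul σ := by
        rw [transportMul, Category.assoc, Category.assoc, h, Category.comp_id]
      exact (congrArg (· ≫ _) (A.toCardOperad_mul hA σ).symm).trans h1)

end NOperad

end

open NOrdinal

/-! ### From operads indexed by cardinalities to braided operads. -/

namespace NOrdinal

/-- Maps between `2`-ordinals given by blocks. -/
abbrev ofBlocksHom {n k : ℕ} {c : Fin n →o ℕ} {c' : Fin k →o ℕ} (f : Fin n → Fin k)
    (h1 : ∀ a b, a < b → c a = c b → f a ≤ f b ∧ c' (f a) = c' (f b))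
    (h2 : ∀ a b, a < b → f b < f a → c' (f b) = c' (f a)) : ofBlocks c ⟶ ofBlocks c' where
  toFun := f
  cond {p i j} h := by
    rcases lt_trichotomy (f i) (f j) with h' | h' | h'
    · by_cases hc : c' (f i) = c' (f j)
      · exact Or.inl ⟨1, by omega, h', iff_of_true hc rfl⟩
      · refine Or.inl ⟨0, ?_, h', iff_of_false hc (by decide)⟩
        have h3 : p ≠ 1 := fun hp => hc (h1 i j h.1 (h.2.2 hp)).2
        omega
    · exact Or.inr (Or.inl h')
    · refine Or.inr (Or.inr ⟨1, ?_, h', iff_of_true (h2 i j h.1 h') rfl⟩)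
      have h3 : p ≠ 1 := fun hp => absurd (h1 i j h.1 (h.2.2 hp)).1 (not_le.2 h')
      omega

/-- An order preserving map, as a map of `2`-ordinals with one block. -/
abbrev ofOrderHom {n k : ℕ} (σ : Fin n →o Fin k) : oneBlock n ⟶ oneBlock k :=
  ofBlocksHom σ (fun _ _ h _ => ⟨σ.monotone h.le, rfl⟩) fun _ _ _ _ => rfl

/-- An order preserving map, as a map of `2`-ordinals with blocks of one element. -/
abbrev ofOrderHomDiscrete {n k : ℕ} (σ : Fin n →o Fin k) : discrete n ⟶ discrete k :=
  ofBlocksHom σ (fun _ _ h h' => absurd h' (Fin.val_ne_of_ne h.ne)) fun _ _ h h' => absurd (σ.monotone h.le) h'.not_ge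

end NOrdinal

namespace CardOperad

variable {V : Type u} [Category.{v} V] [MonoidalCategory V] [SymmetricCategory V]
variable (C : CardOperad V) {n k : ℕ}

/-- The morphism induced by a permutation. -/
noncomputable def permMap (w : Equiv.Perm (Fin n)) : C.obj n ⟶ C.obj n :=
  C.toNOperad.quasi (ofFun w) w.bijective

theorem quasi_eq (w : Equiv.Perm (Fin n)) {T S : NOrdinal 2} (hT : T.card = n)
    (hS : S.card = n) (σ : T ⟶ S) (h : IsQuasibijection σ)
    (hσ : ∀ x, (fn σ x).val = (w (x.cast hT)).val) :
    C.toNOperad.quasi σ h = eqToHom (congrArg C.obj hS) ≫ C.permMap w ≫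
      eqToHom (congrArg C.obj hT.symm) := by
  obtain ⟨n', lt, h1, h2, h3, h4⟩ := T
  obtain ⟨m', lt', h1', h2', h3', h4'⟩ := S
  simp only at hT hS
  subst hT
  subst hS
  have e : fn σ = w := funext fun x => Fin.ext (hσ x)
  have key : ∀ (f g : Fin m' → Fin m') (hf : Function.Bijective f) (hg : Function.Bijective g)
      (_ : f = g), C.toNOperad.quasi (ofFun f) hf = C.toNOperad.quasi (ofFun g) hg := by
    rintro f _ hf hg rfl
    rfl
  refine Eq.trans ?_ ((Category.id_comp _).trans (Category.comp_id _)).symm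
  exact key (fn σ) w h w.bijective e

theorem permMap_one : C.permMap (1 : Equiv.Perm (Fin n)) = 𝟙 _ := C.mul_unit n

/-- The permutation is factored through a `2`-ordinal in which only `i` and `i + 1` share a block.
`adjSwap i` may reverse this pair, since its relation rises to `<_1`; `w` must then keep the order
inside the block, and this is the ascent. -/
theorem permMap_mul_adjSwap {w : Equiv.Perm (Fin n)} {i : Fin (n - 1)} (h : IsAscent w i) :
    C.permMap (w * adjSwap i) = C.permMap w ≫ C.permMap (adjSwap i) := by
  -- Block numbers: places up to `i` are their own number, later ones are lowered by one, so that `i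
  -- + 1` joins `i`.
  let c : Fin n →o ℕ := ⟨fun x => if x.val ≤ i.val then x.val else x.val - 1, fun a b hab => by
    have hab : a.val ≤ b.val := hab
    simp only
    split_ifs <;> omega⟩
  have hc : ∀ a b : Fin n, a < b → c a = c b → a.val = i.val ∧ b.val = i.val + 1 := by
    intro a b hab h
    have hab : a.val < b.val := hab
    have h : (if a.val ≤ i.val then a.val else a.val - 1) =
      if b.val ≤ i.val then b.val else b.val - 1 := h
    split_ifs at h <;> omega
  let σ : discrete n ⟶ ofBlocks c := ofBlocksHom (adjSwap i) (fun _ _ h h' => absurd h' (Fin.val_ne_of_ne h.ne))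
    fun a b hab h' => by
      have hab : a.val < b.val := hab
      have h' : (adjSwap i b).val < (adjSwap i a).val := h'
      change (if (adjSwap i b).val ≤ i.val then (adjSwap i b).val else (adjSwap i b).val - 1) =
        if (adjSwap i a).val ≤ i.val then (adjSwap i a).val else (adjSwap i a).val - 1
      rw [val_adjSwap, val_adjSwap] at h' ⊢
      split_ifs at h' ⊢ <;> omega
  let ω : ofBlocks c ⟶ oneBlock n := ofBlocksHom w (fun a b hab hc' => by
    obtain ⟨ha, hb⟩ := hc a b hab hc'
    have ea : a = ⟨i.val, by omega⟩ := Fin.ext ha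
    have eb : b = ⟨i.val + 1, by omega⟩ := Fin.ext hb
    exact ⟨(congrArg w ea).trans_le (h.le.trans_eq (congrArg w eb).symm), rfl⟩) fun _ _ _ _ => rfl
  exact C.toNOperad.quasi_comp σ ω (adjSwap i).bijective w.bijective

/-- The multiplication for a map, with the sizes of its fibres given in advance. -/
noncomputable def mulAt (m : Blocks k n) (f : Fin n → Fin k) (h : ∀ i, m.1 i = fibCard f i) :
    C.obj k ⊗ tprod (fun i => C.obj (m.1 i)) ⟶ C.obj n :=
  C.obj k ◁ tprodMap (fun i => eqToHom (congrArg C.obj (h i))) ≫ C.mul f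

theorem mulAt_congr {m : Blocks k n} {f g : Fin n → Fin k} (hf : ∀ i, m.1 i = fibCard f i)
    (hg : ∀ i, m.1 i = fibCard g i) (h : f = g) : C.mulAt m f hf = C.mulAt m g hg := by
  subst h
  rfl

theorem mulAt_fibBlocks (f : Fin n → Fin k) : C.mulAt (fibBlocks f) f (fun _ => rfl) = C.mul f := by
  have h : C.obj k ◁ tprodMap (fun i => 𝟙 (C.obj (fibCard f i))) ≫ C.mul f = C.mul f := by
    rw [tprodMap_id, whiskerLeft_id, Category.id_comp]
  exact h

/-- The multiplication for the order preserving map with fibres of given sizes. -/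
noncomputable def blockMul (m : Blocks k n) : C.obj k ⊗ tprod (fun i => C.obj (m.1 i)) ⟶ C.obj n :=
  C.mulAt m m.index fun i => (fibCard_index m i).symm

theorem blockMul_eq (σ : Fin n →o Fin k) {m : Blocks k n} (h : ∀ i, m.1 i = fibCard σ i) :
    C.blockMul m = C.mulAt m σ h := by
  refine C.mulAt_congr _ _ ?_
  obtain rfl : m = fibBlocks σ := Subtype.ext (funext h)
  rw [index_fibBlocks]

theorem blockMul_fibBlocks (σ : Fin n →o Fin k) : C.blockMul (fibBlocks σ) = C.mul σ :=
  (C.blockMul_eq σ fun _ => rfl).trans (C.mulAt_fibBlocks σ)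

/-- Multiplication followed by a permutation which sends the fibres of `f` to blocks. -/
theorem blockMul_permMap (m : Blocks k n) (p : Equiv.Perm (Fin n)) {f : Fin n → Fin k}
    (h : ∀ i, m.1 i = fibCard f i) (p' : ∀ i, Equiv.Perm (Fin (m.1 i)))
    (hp : ∀ i (j : Fin (fibCard f i)), p (fibEmb f i j) = m.incl i (p' i (j.cast (h i).symm))) :
    C.blockMul m ≫ C.permMap p =
      C.obj k ◁ tprodMap (fun i => C.permMap (p' i)) ≫ C.mulAt m f h := by
  obtain ⟨σ, rfl⟩ : ∃ σ : Fin n →o Fin k, m = fibBlocks σ := ⟨m.index, (fibBlocks_index m).symm⟩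
  -- Since `p` carries the fibre of `f` over `i` into the block `i`, `f` is the order preserving map
  -- after `p`, and `mul_quasi` applies to this composite.
  obtain rfl : f = fun x => σ (p x) := by
    funext x
    obtain ⟨⟨i, j⟩, rfl⟩ := (fibEmb_bijective f).2 x
    have h1 := hp i j
    have h2 : fibEmb σ i (p' i (j.cast (h i).symm)) = p (fibEmb f i j) :=
      (fibEmb_of_monotone σ.monotone i _).trans h1.symm
    exact (map_fibEmb f i j).trans ((map_fibEmb σ i _).symm.trans (congrArg σ h2))
  have key := C.toNOperad.mul_quasi (ofFun p) (ofOrderHom σ) p.bijective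
  -- The quasibijection induced by `p` on the fibre over `i` is `p' i`, up to the equality of
  -- cardinalities.
  have e : ∀ i, C.toNOperad.quasi (fibreMap (ofFun p) (ofOrderHom σ) i)
      (isQuasibijection_fibreMap (show IsQuasibijection (ofFun p) from p.bijective)
        (ofOrderHom σ) i) =
      C.permMap (p' i) ≫ eqToHom (congrArg C.obj (h i)) := fun i => by
    refine (C.quasi_eq (p' i) (h i).symm rfl _ _ fun x => ?_).trans (Category.id_comp _)
    refine congrArg Fin.val ((fibEmb σ i).injective ?_)
    refine (fibEmb_fibMap (fn_comp_apply (ofFun p) (ofOrderHom σ)) i x).trans ?_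
    exact (hp i x).trans (fibEmb_of_monotone σ.monotone i _).symm
  rw [funext e] at key
  have key' : C.mul σ ≫ C.permMap p = C.obj k ◁ tprodMap (fun i => C.permMap (p' i) ≫
      eqToHom (congrArg C.obj (h i))) ≫ C.mul (fun x => σ (p x)) := key
  rw [tprodMap_comp, whiskerLeft_comp, Category.assoc] at key'
  rw [blockMul_fibBlocks]
  exact key'

end CardOperad

open NOrdinal

/-! ### Symmetries of tensor products as actions of permutations. -/

section

variable {V : Type u} [Category.{v} V] [MonoidalCategory V] [SymmetricCategory V] {k : ℕ}

theorem isCan_tprodMap_tprodSymm {X F G : Fin k → V} (π : Equiv.Perm (Fin k))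
    (hF : ∀ i, F i = G i) (hG : ∀ j, G (π j) = X j) (h : ∀ i, F i = X (π.symm i)) :
    IsCan (.tprod fun i => .single (π.symm i) (h i)) (.tprod fun j => .single j rfl)
      (tprodMap (fun i => eqToHom (hF i)) ≫ tprodSymm π G ≫
        tprodMap fun j => eqToHom (hG j)) := by
  refine (IsCan.tprodMap fun i => IsCan.single_eqToHom rfl (h i) ((hF i).symm.trans (h i)) _).comp
    ((IsCan.tprodSymm π _).comp (IsCan.tprodMap fun j => ?_))
  exact IsCan.single_eqToHom (π.symm_apply_apply j) _ _ _

theorem tprodSymm_one (X : Fin k → V) : tprodSymm 1 X = 𝟙 (tprod X) :=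
  IsCan.ext (Lab.nodup_tprod_single Function.injective_id fun _ => rfl)
    (IsCan.tprodSymm (1 : Equiv.Perm (Fin k)) fun i => Lab.single i rfl) (IsCan.id _)

theorem tprodSymm_mul (π π' : Equiv.Perm (Fin k)) (X : Fin k → V) :
    tprodSymm (π * π') X = tprodSymm π X ≫ tprodSymm π' (fun i => X (π i)) :=
  IsCan.ext (Lab.nodup_tprod_single (e := fun i => π (π' i))
      (π.injective.comp π'.injective) fun _ => rfl)
    (IsCan.tprodSymm (π * π') fun i => Lab.single (X := X) i rfl)
    ((IsCan.tprodSymm π fun i => Lab.single (X := X) i rfl).comp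
      (IsCan.tprodSymm π' fun i => Lab.single (X := X) (π i) rfl))

theorem isIso_tprodSymm (π : Equiv.Perm (Fin k)) (X : Fin k → V) : IsIso (tprodSymm π X) :=
  (IsCan.tprodSymm π fun i => Lab.single (X := X) i rfl).isIso

theorem mul_eq_of_square {R R' P P' Q Q' Z : V} {a : P ⟶ Q} {a' : Q ⟶ P} {b : P ⟶ P'}
    {c : P' ⟶ Q'} {p : R ⟶ R'} {x : R ⊗ Q ⟶ Z} {y : R' ⊗ Q' ⟶ Z} (ha : a ≫ a' = 𝟙 P)
    (h : R ◁ (a' ≫ b ≫ c) ≫ p ▷ Q' ≫ y = x) :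
    R ◁ a ≫ x = (p ⊗ₘ b) ≫ R' ◁ c ≫ y := by
  rw [← h, ← MonoidalCategory.whiskerLeft_comp_assoc, reassoc_of% ha,
    MonoidalCategory.whiskerLeft_comp_assoc, whisker_exchange_assoc, tensorHom_def'_assoc]

end

namespace CardOperad

variable {V : Type u} [Category.{v} V] [MonoidalCategory V] [SymmetricCategory V]
variable (C : CardOperad V) {n k : ℕ}

/-- Multiplication for a map which permutes blocks. -/
theorem mulAt_permute (m : Blocks k n) (π : Equiv.Perm (Fin k)) {f : Fin n → Fin k}
    (hf : ∀ x, f x = π ((m.permute π).index x)) (h : ∀ i, m.1 i = fibCard f i) :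
    C.mulAt m f h = (C.permMap π ⊗ₘ tprodSymm π fun i => C.obj (m.1 i)) ≫
      C.blockMul (m.permute π) := by
  obtain rfl : f = fun x => π ((m.permute π).index x) := funext hf
  have h' : ∀ i, m.1 (π i) = fibCard (m.permute π).index i := fun i =>
    (fibCard_index (m.permute π) i).symm
  -- The map is the order preserving map of the permuted blocks, taken between discrete
  -- `2`-ordinals, followed by the quasibijection `π`: a change of base.
  have key := C.toNOperad.quasi_mul (ofOrderHomDiscrete (m.permute π).index) (ofFun π) π.bijective
    (w := π.symm) π.apply_symm_apply
    (isCan_tprodMap_tprodSymm (X := fun j => C.obj (fibCard (m.permute π).index j))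
      (F := fun i => C.obj (fibCard (fun x => π ((m.permute π).index x)) i))
      (G := fun i => C.obj (m.1 i)) π (fun i => congrArg C.obj (h i).symm)
      (fun i => congrArg C.obj (h' i)) _)
  refine mul_eq_of_square ?_ key
  rw [← tprodMap_comp]
  simp [tprodMap_id]

end CardOperad

open NOrdinal

theorem fibEmb_eq {n k a : ℕ} {f : Fin n → Fin k} {i : Fin k} (h : fibCard f i = a)
    {φ : Fin a → Fin n} (hφ : StrictMono φ) (hf : ∀ j, f (φ j) = i) (j : Fin (fibCard f i)) :
    fibEmb f i j = φ (j.cast h) := by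
  subst h
  exact (congrFun (Finset.orderEmbOfFin_unique rfl
    (fun x => Finset.mem_filter.2 ⟨Finset.mem_univ _, hf x⟩) hφ) j).symm

section

variable {V : Type u} [Category.{v} V] [MonoidalCategory V]

theorem tensorHom_comp_square {R R' R'' P P' P'' Z Z' Z'' : V} {x : R ⊗ P ⟶ Z} {x' : R' ⊗ P' ⟶ Z'}
    {x'' : R'' ⊗ P'' ⟶ Z''} {c : Z ⟶ Z'} {c' : Z' ⟶ Z''} {r : R ⟶ R'} {r' : R' ⟶ R''}
    {s : P ⟶ P'} {s' : P' ⟶ P''} (h : x ≫ c = (r ⊗ₘ s) ≫ x') (h' : x' ≫ c' = (r' ⊗ₘ s') ≫ x'') :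
    x ≫ c ≫ c' = ((r ≫ r') ⊗ₘ (s ≫ s')) ≫ x'' := by
  rw [reassoc_of% h, h', tensorHom_comp_tensorHom_assoc]

end

namespace CardOperad

variable {V : Type u} [Category.{v} V] [MonoidalCategory V] [SymmetricCategory V]
variable (C : CardOperad V) {n k : ℕ}

/-- Both sides are `permMap` of the same permutation, expanded along its two reduced words. -/
theorem permMap_braid {i j : Fin (n - 1)} (h : i.val + 1 = j.val) :
    C.permMap (adjSwap i) ≫ C.permMap (adjSwap j) ≫ C.permMap (adjSwap i) =
      C.permMap (adjSwap j) ≫ C.permMap (adjSwap i) ≫ C.permMap (adjSwap j) := by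
  have h1 : IsAscent (adjSwap i) j := by
    simp only [IsAscent, Fin.lt_def, val_adjSwap]
    split_ifs <;> omega
  have h2 : IsAscent (adjSwap i * adjSwap j) i := by
    simp only [IsAscent, Fin.lt_def, Equiv.Perm.mul_apply, val_adjSwap]
    split_ifs <;> omega
  have h3 : IsAscent (adjSwap j) i := by
    simp only [IsAscent, Fin.lt_def, val_adjSwap]
    split_ifs <;> omega
  have h4 : IsAscent (adjSwap j * adjSwap i) j := by
    simp only [IsAscent, Fin.lt_def, Equiv.Perm.mul_apply, val_adjSwap]
    split_ifs <;> omega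
  rw [← Category.assoc, ← Category.assoc, ← permMap_mul_adjSwap C h1, ← permMap_mul_adjSwap C h2,
    ← permMap_mul_adjSwap C h3, ← permMap_mul_adjSwap C h4, adjSwap_braid i j h]

theorem permMap_comm {i j : Fin (n - 1)} (h : i.val + 1 < j.val) :
    C.permMap (adjSwap i) ≫ C.permMap (adjSwap j) =
      C.permMap (adjSwap j) ≫ C.permMap (adjSwap i) := by
  have h1 : IsAscent (adjSwap i) j := by
    simp only [IsAscent, Fin.lt_def, val_adjSwap]
    split_ifs <;> omega
  have h3 : IsAscent (adjSwap j) i := by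
    simp only [IsAscent, Fin.lt_def, val_adjSwap]
    split_ifs <;> omega
  rw [← permMap_mul_adjSwap C h1, ← permMap_mul_adjSwap C h3, adjSwap_comm i j h]

variable (hC : IsQuasisymmetric 2 V C.toNOperad)

/-- The action of the braid groups, as homomorphisms to the groups of automorphisms. -/
noncomputable def braidHom (n : ℕ) : BraidGroup n →* (Aut (C.obj n))ᵐᵒᵖ :=
  BraidGroup.lift
    (fun i => MulOpposite.op (@asIso _ _ _ _ (C.permMap (adjSwap i))
      (hC (ofFun (adjSwap i)) (adjSwap i).bijective)))
    (fun _ _ h => MulOpposite.unop_injective (Iso.ext ((Category.assoc _ _ _).trans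
      ((C.permMap_braid h).trans (Category.assoc _ _ _).symm))))
    (fun _ _ h => MulOpposite.unop_injective (Iso.ext (C.permMap_comm h)))

/-- The action of the braid groups on a quasisymmetric operad. -/
noncomputable def act (ρ : BraidGroup n) : C.obj n ⟶ C.obj n := (C.braidHom hC n ρ).unop.hom

theorem act_one : C.act hC (1 : BraidGroup n) = 𝟙 (C.obj n) :=
  congrArg (fun x => x.unop.hom) (map_one (C.braidHom hC n))

theorem act_mul (a b : BraidGroup n) : C.act hC (a * b) = C.act hC a ≫ C.act hC b :=
  congrArg (fun x => x.unop.hom) (map_mul (C.braidHom hC n) a b)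

theorem act_of (i : Fin (n - 1)) :
    C.act hC (PresentedGroup.of i : BraidGroup n) = C.permMap (adjSwap i) :=
  congrArg (fun x : (Aut (C.obj n))ᵐᵒᵖ => x.unop.hom) (BraidGroup.lift_of _ _ _ i)

theorem act_posBraid (w : Equiv.Perm (Fin n)) : C.act hC (posBraid w) = C.permMap w := by
  induction w using ascent_induction with
  | one => rw [posBraid_one, act_one, permMap_one]
  | mul w i hi ih => rw [posBraid_mul_adjSwap hi, act_mul, ih, act_of, permMap_mul_adjSwap C hi]

/-- The bridge from braids back to the `2`-operad: simple braids act through quasibijections, so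
conditions on simple braids can be read off from the operad axioms. -/
theorem act_of_isSimple {b : BraidGroup n} (h : IsSimple b) : C.act hC b = C.permMap b.perm := by
  rw [← act_posBraid C hC, ← h]

theorem act_act_inv (a : BraidGroup n) : C.act hC a ≫ C.act hC a⁻¹ = 𝟙 _ := by
  rw [← act_mul, mul_inv_cancel, act_one]

/-- The block crossing is simple and its permutation is increasing on each block.
`blockMul_permMap`, with trivial inner permutations, turns its action into the multiplication for
the unsorted map `f`, and `mulAt_permute` resolves that by a change of base. -/
theorem blockMul_act_cable_of (m : Blocks k n) (i : Fin (k - 1)) :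
    C.blockMul m ≫ C.act hC (blockGen i m) =
      (C.permMap (adjSwap i) ⊗ₘ tprodSymm (adjSwap i) (fun j => C.obj (m.1 j))) ≫
        C.blockMul (m.permute (adjSwap i)) := by
  let f : Fin n → Fin k := fun x => adjSwap i ((m.permute (adjSwap i)).index x)
  have h : ∀ j, m.1 j = fibCard f j := fun j => by
    obtain ⟨j, rfl⟩ := (adjSwap i).surjective j
    exact ((fibCard_perm_comp (adjSwap i) (m.permute (adjSwap i)).index j).trans
      (fibCard_index _ j)).symm
  rw [act_of_isSimple C hC (isSimple_blockGen i m),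
    C.blockMul_permMap m _ h (fun _ => 1) fun j t => ?_, ← C.mulAt_permute m (adjSwap i)
      (fun _ => rfl) h]
  · simp only [permMap_one, tprodMap_id, whiskerLeft_id, Category.id_comp]
    rfl
  · obtain ⟨j, rfl⟩ := (adjSwap i).surjective j
    refine (congrArg _ (fibEmb_eq (h _).symm (φ := (m.permute (adjSwap i)).incl j)
      (fun _ _ h => (m.permute (adjSwap i)).incl_lt_iff.2 h)
      (fun t => congrArg (adjSwap i) ((m.permute (adjSwap i)).index_incl j t)) t)).trans ?_
    exact perm_blockGen i m j _

theorem tprodSymm_blockMul_permute (m : Blocks k n) {π : Equiv.Perm (Fin k)} (h : π = 1) :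
    (𝟙 (C.obj k) ⊗ₘ tprodSymm π (fun j => C.obj (m.1 j))) ≫ C.blockMul (m.permute π) =
      C.blockMul m := by
  subst h
  rw [tprodSymm_one]
  have e : (𝟙 (C.obj k) ⊗ₘ 𝟙 (tprod fun j => C.obj (m.1 j))) ≫ C.blockMul m = C.blockMul m := by
    rw [id_tensorHom_id, Category.id_comp]
  exact e

/-- By `cable_mul`, the condition for two braids implies the one for their product, so generators
and inverses suffice. -/
theorem blockMul_act_cable (m : Blocks k n) (ρ : BraidGroup k) :
    C.blockMul m ≫ C.act hC (cable ρ m) =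
      (C.act hC ρ ⊗ₘ tprodSymm ρ.perm (fun j => C.obj (m.1 j))) ≫
        C.blockMul (m.permute ρ.perm) := by
  -- The permutation is made a variable, since the types of the symmetry and of the permuted
  -- multiplication depend on it.
  suffices ∀ π, ρ.perm = π → ∀ m : Blocks k n, C.blockMul m ≫ C.act hC (cable ρ m) =
      (C.act hC ρ ⊗ₘ tprodSymm π (fun j => C.obj (m.1 j))) ≫ C.blockMul (m.permute π) from
    this _ rfl m
  clear m
  induction ρ using BraidGroup.induction with
  | of i =>
    rintro _ rfl m
    rw [perm_of, cable_of, act_of]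
    exact C.blockMul_act_cable_of hC m i
  | one =>
    rintro _ rfl m
    rw [map_one, cable_one, act_one, act_one]
    exact (Category.comp_id _).trans (C.tprodSymm_blockMul_permute m rfl).symm
  | mul a b iha ihb =>
    rintro _ rfl m
    rw [map_mul, cable_mul, act_mul, act_mul, tprodSymm_mul]
    exact tensorHom_comp_square (iha _ rfl m) (ihb _ rfl _)
  | inv a ih =>
    rintro π hπ m
    have h1 : a.perm * π = 1 := by rw [← hπ, map_inv, mul_inv_cancel]
    -- With `m` in this form, the cables of `a` and `a⁻¹` are composable and cancel, and the
    -- hypothesis for `a` can be used on the original blocks.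
    obtain ⟨m, rfl⟩ : ∃ m', m = Blocks.permute m' a.perm :=
      ⟨m.permute π, by rw [Blocks.permute_permute, mul_eq_one_comm.1 h1, Blocks.permute_one]⟩
    have := isIso_tprodSymm a.perm fun j => C.obj (m.1 j)
    have : IsIso (C.act hC a) := Iso.isIso_hom _
    refine (cancel_epi (C.act hC a ⊗ₘ tprodSymm a.perm fun j => C.obj (m.1 j))).1 ?_
    have e := C.tprodSymm_blockMul_permute m h1
    rw [tprodSymm_mul, ← act_act_inv C hC a] at e
    refine Eq.trans ?_ ((tensorHom_comp_tensorHom_assoc _ _ _ _ _).trans e).symm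
    refine (Category.assoc _ _ _).symm.trans ((congrArg (· ≫ _) (ih _ rfl m).symm).trans ?_)
    rw [Category.assoc, ← act_mul, ← cable_mul, mul_inv_cancel, cable_one, act_one,
      Category.comp_id]

end CardOperad

open NOrdinal

namespace CardOperad

variable {V : Type u} [Category.{v} V] [MonoidalCategory V] [SymmetricCategory V]
variable (C : CardOperad V) (hC : IsQuasisymmetric 2 V C.toNOperad) {n k : ℕ}

/-- The braid `b` acts on the values of the multiplication as the braids `ρ i` act on the
factors. -/
def ActsAs (m : Blocks k n) (b : BraidGroup n) (ρ : ∀ i, BraidGroup (m.1 i)) : Prop :=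
  C.blockMul m ≫ C.act hC b = C.obj k ◁ tprodMap (fun i => C.act hC (ρ i)) ≫ C.blockMul m

theorem actsAs_one (m : Blocks k n) : C.ActsAs hC m 1 1 := by
  simp only [ActsAs, Pi.one_apply, act_one, tprodMap_id, whiskerLeft_id, Category.id_comp,
    Category.comp_id]

variable {C hC}

theorem ActsAs.mul {m : Blocks k n} {a b : BraidGroup n} {ρ τ : ∀ i, BraidGroup (m.1 i)}
    (ha : C.ActsAs hC m a ρ) (hb : C.ActsAs hC m b τ) : C.ActsAs hC m (a * b) (ρ * τ) := by
  simp only [ActsAs] at ha hb ⊢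
  simp only [act_mul, Pi.mul_apply, tprodMap_comp, MonoidalCategory.whiskerLeft_comp,
    Category.assoc]
  rw [reassoc_of% ha, hb]

theorem ActsAs.inv {m : Blocks k n} {a : BraidGroup n} {ρ : ∀ i, BraidGroup (m.1 i)}
    (ha : C.ActsAs hC m a ρ) : C.ActsAs hC m a⁻¹ ρ⁻¹ := by
  have e : (C.obj k ◁ tprodMap fun i => C.act hC (ρ⁻¹ i)) ≫
      C.obj k ◁ tprodMap (fun i => C.act hC (ρ i)) = 𝟙 _ := by
    rw [← MonoidalCategory.whiskerLeft_comp, ← tprodMap_comp]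
    simp only [← act_mul, Pi.inv_apply, inv_mul_cancel, act_one, tprodMap_id, whiskerLeft_id]
  simp only [ActsAs] at ha ⊢
  have e' := congrArg (fun x => (C.obj k ◁ tprodMap fun i => C.act hC (ρ⁻¹ i)) ≫ x ≫ C.act hC a⁻¹)
    ha
  simp only [Category.assoc, act_act_inv, reassoc_of% e, Category.comp_id] at e'
  exact e'.symm

variable (C hC)

/-- For a generator the shifted braid is simple and permutes one block only, so `blockMul_permMap`
applies with the order preserving map itself and a single nontrivial inner permutation. -/
theorem actsAs_blockShift (m : Blocks k n) (i : Fin k) (x : BraidGroup (m.1 i)) :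
    C.ActsAs hC m (blockShift m i x) (Pi.mulSingle i x) := by
  induction x using BraidGroup.induction with
  | of t =>
    have hs : IsSimple (blockShift m i (PresentedGroup.of t)) := by
      rw [← posBraid_adjSwap]
      exact isSimple_shift_posBraid _ _
    have hs' : ∀ j, IsSimple ((Pi.mulSingle i (PresentedGroup.of t) :
        ∀ j, BraidGroup (m.1 j)) j) := fun j => by
      rcases eq_or_ne j i with rfl | hj
      · rw [Pi.mulSingle_eq_same]
        exact isSimple_of t
      · rw [Pi.mulSingle_eq_of_ne hj]
        exact isSimple_one
    have e := C.blockMul_permMap m (blockShift m i (PresentedGroup.of t)).perm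
      (fun j => (fibCard_index m j).symm)
      (fun j => ((Pi.mulSingle i (PresentedGroup.of t) : ∀ j, BraidGroup (m.1 j)) j).perm)
      fun j s => by
        refine (congrArg _ (fibEmb_eq (fibCard_index m j) (φ := m.incl j)
          (fun _ _ h => m.incl_lt_iff.2 h) (m.index_incl j) s)).trans ?_
        rcases eq_or_ne j i with rfl | hj
        · rw [Pi.mulSingle_eq_same]
          exact perm_blockShift _ _ _ _
        · rw [Pi.mulSingle_eq_of_ne hj, map_one]
          exact perm_blockShift_of_ne _ hj.symm _ _
    simp only [ActsAs, act_of_isSimple C hC hs, act_of_isSimple C hC (hs' _)]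
    exact e
  | one =>
    rw [map_one, Pi.mulSingle_one]
    exact C.actsAs_one hC m
  | mul a b iha ihb =>
    rw [map_mul, Pi.mulSingle_mul]
    exact iha.mul ihb
  | inv a ih =>
    rw [map_inv, Pi.mulSingle_inv]
    exact ih.inv

/-- A direct sum is a product of shifts into distinct blocks, and the corresponding families, each
with one nontrivial member, multiply to `ρ`. -/
theorem actsAs_directSum (m : Blocks k n) (ρ : ∀ i, BraidGroup (m.1 i)) :
    C.ActsAs hC m (directSum m ρ) ρ := by
  have h : ∀ L : List (Fin k), L.Nodup → ∀ τ : ∀ i, BraidGroup (m.1 i),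
      (∀ i ∈ L, τ i = ρ i) → (∀ i ∉ L, τ i = 1) →
      C.ActsAs hC m (L.map fun i => blockShift m i (ρ i)).prod τ := by
    intro L
    induction L with
    | nil =>
      intro _ τ _ h
      obtain rfl : τ = 1 := funext fun i => h i List.not_mem_nil
      exact C.actsAs_one hC m
    | cons i L ih =>
      intro hn τ h1 h2
      have hn := List.nodup_cons.1 hn
      -- As `i` is not in `L`, resetting `τ` to `1` at `i` gives a family that agrees with `ρ` on
      -- `L` and is trivial elsewhere.
      have e : τ = Pi.mulSingle i (ρ i) * Function.update τ i 1 := by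
        funext j
        rcases eq_or_ne j i with rfl | hj
        · simp [h1]
        · simp [hj]
      rw [e, List.map_cons, List.prod_cons]
      refine (C.actsAs_blockShift hC m i (ρ i)).mul (ih hn.2 _ (fun j hj => ?_) fun j hj => ?_)
      · rw [Function.update_of_ne (ne_of_mem_of_not_mem hj hn.1), h1 j (List.mem_cons_of_mem i hj)]
      · rcases eq_or_ne j i with rfl | hj'
        · simp
        · rw [Function.update_of_ne hj', h2 j fun h => (List.mem_cons.1 h).elim hj' hj]
  rw [directSum_eq]
  exact h _ (List.nodup_finRange k) ρ (fun _ _ => rfl) fun i hi => absurd (List.mem_finRange i) hi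

/-- The braided operad given by a quasisymmetric operad. -/
noncomputable def toBraidedOperad : BraidedOperad V where
  obj := C.obj
  act := C.act hC
  act_one n := C.act_one hC
  act_mul := C.act_mul hC
  unit := C.unit
  mul σ := C.mul σ
  assoc σ ω := C.assoc (ofOrderHom σ) (ofOrderHom ω)
  mul_unit n := C.mul_unit n
  unit_mul σ := C.unit_mul σ
  equivariance_base {n k} σ σ' ρ h := by
    have e := C.blockMul_act_cable hC (fibBlocks σ) ρ
    rw [blockMul_fibBlocks] at e
    have e' : C.blockMul ((fibBlocks σ).permute ρ.perm) =
      C.obj k ◁ tprodMap (fun i => eqToHom (congrArg C.obj (h i).symm)) ≫ C.mul σ' :=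
      C.blockMul_eq σ' fun i => (h i).symm
    exact e.trans ((congrArg (_ ≫ ·) e').trans (tensorHom_comp_right _ _ _ _).symm)
  equivariance_fibre σ ρ := by
    have e := C.actsAs_directSum hC (fibBlocks σ) ρ
    simp only [ActsAs, blockMul_fibBlocks] at e
    exact e

/-- `sortPerm f` carries the fibres of `f` to blocks without disturbing their inner order. Hence
`blockMul_permMap`, with trivial inner permutations, says that multiplying along the sorted map and
then acting by the sorting braid recovers the multiplication of `f`. -/
theorem sortMul_toBraidedOperad (f : Fin n → Fin k) :
    (C.toBraidedOperad hC).sortMul f = C.mul f := by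
  have e := C.blockMul_permMap (fibBlocks f) (sortPerm f) (f := f) (fun _ => rfl) (fun _ => 1)
    fun i j => sortPerm_fibEmb f i j
  rw [mulAt_fibBlocks] at e
  simp only [permMap_one, tprodMap_id, whiskerLeft_id] at e
  rw [← act_posBraid C hC] at e
  exact e.trans (Category.id_comp _)

/-- The operad given by the braided operad is the original one. -/
noncomputable def toBraidedOperadIso : (C.toBraidedOperad hC).toNOperad ≅ C.toNOperad :=
  NOperad.isoMk (fun T => Iso.refl (C.obj T.card)) (Category.comp_id _) fun {T S} σ => by
    have e : (C.toBraidedOperad hC).sortMul (fn σ) ≫ 𝟙 (C.obj T.card) =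
      (𝟙 (C.obj S.card) ⊗ₘ tprodMap fun i => 𝟙 (C.obj (fibCard (fn σ) i))) ≫ C.mul (fn σ) := by
      rw [sortMul_toBraidedOperad, tprodMap_id, id_tensorHom_id, Category.id_comp]
      exact Category.comp_id _
    exact e

end CardOperad

/-! ### The equivalence of categories. -/

section Equivalence

variable {V : Type u} [Category.{v} V] [MonoidalCategory V] [SymmetricCategory V]

theorem isQuasisymmetric_of_iso {d : ℕ} {A B : NOperad d V} (e : A ≅ B)
    (hB : IsQuasisymmetric d V B) : IsQuasisymmetric d V A := by
  intro T S σ h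
  have h1 : ∀ T, e.hom.app T ≫ e.inv.app T = 𝟙 _ := fun T =>
    congrFun (congrArg NOperad.Hom.app e.hom_inv_id) T
  have h2 : ∀ T, e.inv.app T ≫ e.hom.app T = 𝟙 _ := fun T =>
    congrFun (congrArg NOperad.Hom.app e.inv_hom_id) T
  have : IsIso (e.hom.app T) := ⟨_, h1 T, h2 T⟩
  have : IsIso (e.hom.app S) := ⟨_, h1 S, h2 S⟩
  have := hB σ h
  have : IsIso (A.quasi σ h ≫ e.hom.app T) := by
    rw [e.hom.quasi]
    infer_instance
  exact IsIso.of_isIso_comp_right _ (e.hom.app T)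

variable (V)

/-- Braided operads as quasisymmetric `2`-operads. -/
noncomputable def quasisymmetricFunctor : BraidedOperad V ⥤ QuasisymmetricOperad 2 V :=
  (IsQuasisymmetric 2 V).lift (BraidedOperad.toNOperadFunctor V) fun B => B.isQuasisymmetric_toNOperad

instance : (quasisymmetricFunctor V).Faithful :=
  Functor.Faithful.of_comp_iso ((IsQuasisymmetric 2 V).liftCompιIso
    (BraidedOperad.toNOperadFunctor V) fun B => B.isQuasisymmetric_toNOperad)

instance : (quasisymmetricFunctor V).Full :=
  Functor.Full.of_comp_faithful_iso ((IsQuasisymmetric 2 V).liftCompιIso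
    (BraidedOperad.toNOperadFunctor V) fun B => B.isQuasisymmetric_toNOperad)

instance : (quasisymmetricFunctor V).EssSurj where
  mem_essImage A := by
    have hA : IsQuasisymmetric 2 V A.obj := A.property
    have hC : IsQuasisymmetric 2 V (A.obj.toCardOperad hA).toNOperad :=
      isQuasisymmetric_of_iso (A.obj.toCardOperadIso hA) hA
    exact ⟨(A.obj.toCardOperad hA).toBraidedOperad hC, ⟨(IsQuasisymmetric 2 V).isoMk
      ((CardOperad.toBraidedOperadIso _ hC).trans (A.obj.toCardOperadIso hA))⟩⟩

instance : (quasisymmetricFunctor V).IsEquivalence where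

end Equivalence

end TwoOperads

theorem mainTheorem3 {V : Type u} [CategoryTheory.Category.{v} V]
    [CategoryTheory.MonoidalCategory V] [CategoryTheory.SymmetricCategory V] :
    Nonempty (TwoOperads.QuasisymmetricOperad 2 V ≌ TwoOperads.BraidedOperad V) :=
  ⟨(TwoOperads.quasisymmetricFunctor V).asEquivalence.symm⟩
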